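/- For $n\ge 1$ and $1\le i,j\le n$ consider the symmetric link functions $L_T(i,j)=|i-j|$ (Toeplitz, $T_n$), $L_{SC}(i,j)=\frac n2-\bigl|\frac n2-|i-j|\bigr|$ (Symmetric Circulant, $SC_n$), $L_H(i,j)=i+j$ (Hankel, $H_n$), $L_{RC}(i,j)=(i+j) \bmod n$ (Reverse Circulant, $RC_n$) and $L_{DH}(i,j)=\frac n2-\bigl|\frac n2-((i+j)\bmod n)\bigr|$ (Doubly Symmetric Hankel, $DH_n$). A word of length $h$ is a sequence of $h$ letters in which the first occurrences of the letters are in alphabetical order; it is pair-matched if each of its letters occurs exactly twice. Catalan words are defined recursively: $aa$ is Catalan, and a pair-matched word of length $2k$, $k>1$, is Catalan if it contains a double letter whose deletion leaves (up to relabelling the letters) a Catalan word of length $2k-2$. A circuit of length $h$ is a map $\pi:\{0,\dots,h\}\to\{1,\dots,n\}$ with $\pi(0)=\pi(h)$. For a link function $L$ let $\Pi_L(w)$ be the set of circuits such that, for all $i,j$, $w[i]=w[j]\Leftrightarrow L(\pi(i-1),\pi(i))=L(\pi(j-1),\pi(j))$, and let $\Pi^*_L(w)$ be defined in the same way with $\Rightarrow$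 in place of $\Leftrightarrow$. For link functions $L_X,L_Y$ and pair-matched words $w,w'$ of length $2k$, write $p_Z(w,w')=p$ if both $n^{-(1+k)}\#(\Pi_{L_X}(w)\cap\Pi_{L_Y}(w'))$ and $n^{-(1+k)}\#(\Pi^*_{L_X}(w)\cap\Pi^*_{L_Y}(w'))$ converge to $p$ as $n\to\infty$. A link function has Property B if the number of occurrences of any one value in any one row of the $n\times n$ array $(L(i,j))$ is bounded uniformly in the value, the row and $n$. Let $L_X\in\{L_T,L_{SC}\}$ and $L_Y\in\{L_H,L_{RC},L_{DH}\}$. Then: (1) $L_X$ and $L_Y$ are compatible: both have Property B, and $p_Z(w,w')$ exists and equals $0$ for all pair-matched words $w\ne w'$ of the same length. (2) For every pair-matched word $w$ of length $2k$, $k\ge1$, $p_Z(w,w)$ exists; it equals $1$ if $w$ is a Catalan word and $0$ otherwise. (3) Let $X_n=(x_{L_X(i,j)})_{1\le i,j\le n}$ and $Y_n=(y_{L_Y(i,j)})_{1\le i,j\le n}$, where $(x_m)_{m\ge0}$ and $(y_m)_{m\ge0}$ are real random sequences, independent of each other, each consisting of independent variables with mean $0$ and variance $1$ that are in addition (A1)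 uniformly bounded, or (A2) identically distributed, or (A3) have uniformly bounded moments of all orders. Then, almost surely, the empirical spectral distribution of $n^{-1/2}X_n\odot Y_n$ ($\odot$ the entrywise product) converges weakly to the semicircular law with density $\frac1{2\pi}\sqrt{4-t^2}$ on $[-2,2]$. -/

import Mathlib

open MeasureTheory ProbabilityTheory Filter Topology
open scoped Matrix ENNReal

namespace SchurHadamard

/-! ### Link functions -/

/-- A symmetric link function: a sequence, indexed by the matrix size `n`, of symmetric functions of
the row and column indices `i, j ∈ {1, …, n}` with values in the non-negative integers.
(Values at indices outside `{1, …, n}` are never used.) -/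
structure Link where
  val : ℕ → ℕ → ℕ → ℕ
  symm : ∀ n i j, val n i j = val n j i

/-- Toeplitz: `L(i,j) = |i - j|`. -/
def toeplitz : Link where
  val _ i j := ((i : ℤ) - (j : ℤ)).natAbs
  symm _ i j := by omega

/-- Hankel: `L(i,j) = i + j`. -/
def hankel : Link where
  val _ i j := i + j
  symm _ i j := by omega

/-- Symmetric circulant: `L(i,j) = n/2 - |n/2 - |i - j||`, that is, the minimum of `|i - j|` and
`n - |i - j|`; see `symCirculant_eq`. -/
def symCirculant : Link where
  val n i j := min ((i : ℤ) - (j : ℤ)).natAbs (n - ((i : ℤ) - (j : ℤ)).natAbs)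
  symm n i j := by omega

/-- Reverse circulant: `L(i,j) = (i + j) mod n`. -/
def revCirculant : Link where
  val n i j := (i + j) % n
  symm n i j := by rw [Nat.add_comm]

/-- Doubly symmetric Hankel: `L(i,j) = n/2 - |n/2 - (i + j) mod n|`, that is, the minimum of
`(i + j) mod n` and `n - (i + j) mod n`; see `doublySymHankel_eq`. -/
def doublySymHankel : Link where
  val n i j := min ((i + j) % n) (n - (i + j) % n)
  symm n i j := by rw [Nat.add_comm]

theorem half_sub_abs_eq {n d : ℕ} (h : d ≤ n) :
    ((min d (n - d) : ℕ) : ℝ) = (n : ℝ) / 2 - |(n : ℝ) / 2 - (d : ℝ)| := by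
  rw [Nat.cast_min, Nat.cast_sub h]
  rcases le_total (d : ℝ) ((n : ℝ) / 2) with h1 | h1
  · rw [abs_of_nonneg (by linarith), min_eq_left (by linarith)]; ring
  · rw [abs_of_nonpos (by linarith), min_eq_right (by linarith)]; ring

theorem symCirculant_eq {n i j : ℕ} (hi : i ∈ Finset.Icc 1 n) (hj : j ∈ Finset.Icc 1 n) :
    (symCirculant.val n i j : ℝ) = (n : ℝ) / 2 - abs ((n : ℝ) / 2 - abs ((i : ℝ) - (j : ℝ))) := by
  rw [Finset.mem_Icc] at hi hj
  have h : ((i : ℤ) - (j : ℤ)).natAbs ≤ n := by omega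
  have e : ((((i : ℤ) - (j : ℤ)).natAbs : ℕ) : ℝ) = |(i : ℝ) - (j : ℝ)| := by
    rw [Nat.cast_natAbs]; push_cast; rfl
  rw [← e]
  exact half_sub_abs_eq h

theorem doublySymHankel_eq {n i j : ℕ} (hi : i ∈ Finset.Icc 1 n) :
    (doublySymHankel.val n i j : ℝ) = (n : ℝ) / 2 - |(n : ℝ) / 2 - (((i + j) % n : ℕ) : ℝ)| := by
  rw [Finset.mem_Icc] at hi
  exact half_sub_abs_eq (Nat.mod_lt _ (by omega)).le

/-- Property B: the number of times any value occurs in any row is uniformly bounded. -/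
def PropertyB (L : Link) : Prop :=
  ∃ Δ : ℕ, ∀ n t : ℕ, ∀ k ∈ Finset.Icc 1 n,
    ((Finset.Icc 1 n).filter (fun l => L.val n k l = t)).card ≤ Δ

/-! ### Words -/

/-- A word of length `h`: a sequence of letters `0, 1, 2, …` (for a, b, c, …) in which the first
occurrences of the letters appear in alphabetical order. Words of length `h` are in bijection with
the partitions of the set of positions. -/
@[ext] structure Word (h : ℕ) where
  letter : Fin h → ℕ
  ordered : ∀ i : Fin h, ∀ m < letter i, ∃ j < i, letter j = m

/-- A word is pair-matched if every letter that occurs in it occurs exactly twice. -/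
def Word.PairMatched {h : ℕ} (w : Word h) : Prop :=
  ∀ i : Fin h, (Finset.univ.filter (fun j => w.letter j = w.letter i)).card = 2

/-- Catalan strings: `aa` is one, and so is any string with a double letter `aa` (not occurring
elsewhere in the string) whose deletion leaves a Catalan string. -/
inductive IsCatalanString : List ℕ → Prop
  | double (a : ℕ) : IsCatalanString [a, a]
  | insert (u v : List ℕ) (a : ℕ) (ha : a ∉ u ++ v) (huv : IsCatalanString (u ++ v)) :
      IsCatalanString (u ++ a :: a :: v)

/-- Catalan words. -/
def Word.IsCatalan {h : ℕ} (w : Word h) : Prop :=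
  IsCatalanString (List.ofFn w.letter)

/-! ### Circuits and word limits -/

/-- Circuits of length `h`: maps `π : {0, …, h} → {1, …, n}` with `π 0 = π h`. The element `a` of
`Fin n` stands for the index `a + 1` of `{1, …, n}`. -/
def circuits (h n : ℕ) : Finset (Fin (h + 1) → Fin n) :=
  Finset.univ.filter (fun π => π 0 = π (Fin.last h))

/-- The `L`-value `L(π(i-1), π(i))` of the `i`-th edge (positions counted from `0` here). -/
def Link.edge (L : Link) {h n : ℕ} (π : Fin (h + 1) → Fin n) (i : Fin h) : ℕ :=
  L.val n ((π i.castSucc : ℕ) + 1) ((π i.succ : ℕ) + 1)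

/-- `Π_L(w)`: the circuits whose `L`-matches are exactly the matches of `w`. -/
def circuitClass (L : Link) {h : ℕ} (w : Word h) (n : ℕ) : Finset (Fin (h + 1) → Fin n) :=
  (circuits h n).filter
    (fun π => ∀ i j, w.letter i = w.letter j ↔ L.edge π i = L.edge π j)

/-- `Π*_L(w)`: the circuits whose `L`-matches include the matches of `w`. -/
def circuitClassStar (L : Link) {h : ℕ} (w : Word h) (n : ℕ) : Finset (Fin (h + 1) → Fin n) :=
  (circuits h n).filter
    (fun π => ∀ i j, w.letter i = w.letter j → L.edge π i = L.edge π j)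

/-- `p_Z(w,w')` exists and equals `p`: both `n^{-(1+k)} #(Π_X(w) ∩ Π_Y(w'))` and
`n^{-(1+k)} #(Π*_X(w) ∩ Π*_Y(w'))` tend to `p`, for words of length `2k`. -/
def HasWordLimit (LX LY : Link) {k : ℕ} (w w' : Word (2 * k)) (p : ℝ) : Prop :=
  Tendsto (fun n : ℕ =>
    ((circuitClass LX w n ∩ circuitClass LY w' n).card : ℝ) / (n : ℝ) ^ (1 + k)) atTop (𝓝 p) ∧
  Tendsto (fun n : ℕ =>
    ((circuitClassStar LX w n ∩ circuitClassStar LY w' n).card : ℝ) / (n : ℝ) ^ (1 + k))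
    atTop (𝓝 p)

/-- Two link functions with Property B are compatible if `p_Z(w,w') = 0` for all pair-matched words
`w ≠ w'` of the same length. -/
def Compatible (LX LY : Link) : Prop :=
  PropertyB LX ∧ PropertyB LY ∧
    ∀ (k : ℕ) (w w' : Word (2 * k)), w.PairMatched → w'.PairMatched → w ≠ w' →
      HasWordLimit LX LY w w' 0

/-- `(L_X, L_Y) ⇝ L_W`: for a pair-matched word `w`, `p_Z(w,w)` is `1` if `w` is Catalan and `0`
otherwise. -/
def LeadsToWigner (LX LY : Link) : Prop :=
  ∀ (k : ℕ), 1 ≤ k → ∀ (w : Word (2 * k)), w.PairMatched →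
    (w.IsCatalan → HasWordLimit LX LY w w 1) ∧ (¬ w.IsCatalan → HasWordLimit LX LY w w 0)

/-! ### Input sequences, patterned matrices and the limiting spectral distribution -/

section Random

variable {Ω : Type*} [MeasurableSpace Ω]

/-- Independent real random variables with mean `0` and variance `1`. -/
structure IsStandardized (P : Measure Ω) (x : ℕ → Ω → ℝ) : Prop where
  measurable : ∀ i, Measurable (x i)
  memLp : ∀ i, MemLp (x i) 2 P
  mean : ∀ i, ∫ ω, x i ω ∂P = 0
  variance : ∀ i, Var[x i; P] = 1
  indep : iIndepFun x P

/-- (A1): independent, mean `0`, variance `1`, uniformly bounded. -/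
def AssumptionA1 (P : Measure Ω) (x : ℕ → Ω → ℝ) : Prop :=
  IsStandardized P x ∧ ∃ C : ℝ, ∀ i, ∀ᵐ ω ∂P, |x i ω| ≤ C

/-- (A2): independent and identically distributed, mean `0`, variance `1`. -/
def AssumptionA2 (P : Measure Ω) (x : ℕ → Ω → ℝ) : Prop :=
  IsStandardized P x ∧ ∀ i, IdentDistrib (x i) (x 0) P P

/-- (A3): independent, mean `0`, variance `1`, uniformly bounded moments of all orders. -/
def AssumptionA3 (P : Measure Ω) (x : ℕ → Ω → ℝ) : Prop :=
  IsStandardized P x ∧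
    ∀ p : ℕ, ∃ C : ℝ, ∀ i, Integrable (fun ω => |x i ω| ^ p) P ∧ ∫ ω, |x i ω| ^ p ∂P ≤ C

/-- The patterned matrix `((x_{L(i,j)}))`, `1 ≤ i, j ≤ n`. -/
def patterned (L : Link) (n : ℕ) (x : ℕ → ℝ) : Matrix (Fin n) (Fin n) ℝ :=
  Matrix.of fun i j => x (L.val n ((i : ℕ) + 1) ((j : ℕ) + 1))

/-- `n^{-1/2} X_n ⊙ Y_n`, for input sequences `x` and `y`. -/
noncomputable def scaledProduct (LX LY : Link) (n : ℕ) (x y : ℕ → ℝ) : Matrix (Fin n) (Fin n) ℝ :=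
  (Real.sqrt n)⁻¹ • (patterned LX n x ⊙ patterned LY n y)

theorem scaledProduct_isHermitian (LX LY : Link) (n : ℕ) (x y : ℕ → ℝ) :
    (scaledProduct LX LY n x y).IsHermitian := by
  ext i j
  simp [scaledProduct, patterned, Matrix.hadamard, LX.symm n ((i : ℕ) + 1),
    LY.symm n ((i : ℕ) + 1)]

/-- The empirical spectral measure of a real symmetric matrix: mass `1/n` at each eigenvalue,
counted with multiplicity. -/
noncomputable def esd {n : ℕ} {A : Matrix (Fin n) (Fin n) ℝ} (hA : A.IsHermitian) : Measure ℝ :=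
  (n : ℝ≥0∞)⁻¹ • ∑ i, Measure.dirac (hA.eigenvalues i)

/-- `ν` is the almost sure limiting spectral distribution of the random symmetric matrices `A n`:
outside a null set, the distribution functions of the empirical spectral measures converge to the
distribution function of `ν` at all continuity points of the latter. -/
def IsLSD (P : Measure Ω) (A : ∀ n : ℕ, Ω → Matrix (Fin n) (Fin n) ℝ)
    (hA : ∀ n ω, (A n ω).IsHermitian) (ν : Measure ℝ) : Prop :=
  ∀ᵐ ω ∂P, ∀ t : ℝ, ContinuousAt (fun s => ν.real (Set.Iic s)) t →
    Tendsto (fun n => (esd (hA n ω)).real (Set.Iic t)) atTop (𝓝 (ν.real (Set.Iic t)))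

end Random

/-- The (standard) semicircular law, with density `√(4 - t²) / (2π)` on `[-2, 2]`
(the square root of a negative number is `0`). -/
noncomputable def semicircleLaw : Measure ℝ :=
  volume.withDensity (fun t => ENNReal.ofReal (Real.sqrt (4 - t ^ 2) / (2 * Real.pi)))

end SchurHadamard

namespace SchurHadamard

/-! ### Counting functions some of whose values are determined by others -/

/-! Apart from symmetry and the bound `2 * n` on the link values, only one property of the links is
used: modulo `n` and up to sign, equal `LX`-values have equal differences `i - j`, and equal
`LY`-values have equal sums `i + j` (`IsDiffLink`, `IsSumLink`).

Word limits. A circuit is given by its base point and its `2k` differences, which the word `w`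
matches in pairs up to sign. If some pair is matched with equal signs, closing the circuit imposes a
relation `2c = 0`. So up to `O(n^k)` circuits all pairs have opposite signs, which leaves `k + 1`
free coordinates. Changing the difference of a pair `a < b` translates the vertices between the two
edges, and the sum at edge `i` changes by 0, 1 or 2 times that amount as `i` lies outside, at an
end, or strictly inside (`sm_sub_eq`). A match of `w'` costs no degree of freedom only if, for every
pair of `w`, its two edges have the same weight. Weight 1 then forces `w' = w`, and weight 2 forces
`w` to be noncrossing, hence Catalan; otherwise a degree of freedom is lost
(`card_circuitClassStar_inter_le_of_not`). Conversely, a Catalan word folds the closed path onto a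
tree with `k + 1` vertices, matched edges being traversed in opposite directions. Every assignment
of indices to the vertices gives a circuit with the required matches for any symmetric link, and by
Property B accidental further matches are rare (`le_card_circuitClass_inter`).

Spectral distribution, bounded inputs. The trace moments are sums over circuits. In expectation only
circuits pair-matched for both links survive, and by the word limits they contribute the number of
Catalan words, a Catalan number, which is the semicircle moment (`card_isCatalan`,
`tendsto_sum_meanWeight`). The fluctuation is split so that one input sequence at a time is centred;
its fourth moment is `O(n^{-2})` (`fourth_moment_le`), so it vanishes almost surely.

General inputs. Standardized truncations replace the inputs by bounded ones. Since `(i, j) ↦ (LX,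
LY)` is at most 16-to-one, the squared Frobenius error is bounded by a product of sums over the two
sequences, controlled by laws of large numbers. A coupling of eigenvalues turns it into closeness of
spectral measures (`exists_coupling`), and the method of moments concludes. -/

theorem card_filter_lt_injOn {α : Type*} {e : α → ℕ} (he : Function.Injective e) (D : Finset α) :
    Set.InjOn (fun x => (D.filter (fun y => e y < e x)).card) (D : Set α) := by
  have key : ∀ x ∈ D, ∀ y, e x < e y →
      (D.filter (fun z => e z < e x)).card < (D.filter (fun z => e z < e y)).card := by
    intro x hx y hxy
    apply Finset.card_lt_card
    rw [Finset.ssubset_iff_of_subset]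
    · exact ⟨x, by simp [hx, hxy], by simp⟩
    · intro z hz
      rw [Finset.mem_filter] at hz ⊢
      exact ⟨hz.1, hz.2.trans hxy⟩
  intro x hx y hy hxy
  rcases lt_trichotomy (e x) (e y) with h | h | h
  · exact absurd hxy (key x hx y h).ne
  · exact he h
  · exact absurd hxy (key y hy x h).ne'

/-- A set of functions on `V`, ranked by `r`, in which the value at each `v ∉ F` has at most `Δ`
possibilities once the values of lower rank are known, has at most `|α| ^ |F| * Δ ^ |Fᶜ|`
elements. -/
theorem card_le_of_determined {V α : Type*} [Fintype V] [DecidableEq V] [Fintype α] [DecidableEq α]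
    (r : V → ℕ) (F : Finset V) (Δ : ℕ) (S : Finset (V → α))
    (hdet : ∀ v ∉ F, ∀ f ∈ S,
      ((S.filter (fun g => ∀ u, r u < r v → g u = f u)).image (fun g => g v)).card ≤ Δ) :
    S.card ≤ Fintype.card α ^ F.card * Δ ^ Fᶜ.card := by
  obtain ⟨e, he⟩ : ∃ e : α → ℕ, Function.Injective e :=
    ⟨fun x => Fintype.equivFin α x, Fin.val_injective.comp (Fintype.equivFin α).injective⟩
  -- The code of `f` records at each `v` the rank of `f v` among the values still possible there. As
  -- `D f v` depends on `f` only through coordinates of lower rank, the code can be decoded by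
  -- induction on `r`.
  let D : (V → α) → V → Finset α := fun f v =>
    if v ∈ F then Finset.univ
    else (S.filter (fun g => ∀ u, r u < r v → g u = f u)).image (fun g => g v)
  have hD : ∀ f ∈ S, ∀ v, f v ∈ D f v := by
    intro f hf v
    by_cases hv : v ∈ F
    · simp [D, hv]
    · simp only [D, hv, if_false, Finset.mem_image, Finset.mem_filter]
      exact ⟨f, ⟨hf, fun _ _ => rfl⟩, rfl⟩
  let c : (V → α) → V → ℕ := fun f v => ((D f v).filter (fun y => e y < e (f v))).card
  let B : V → ℕ := fun v => if v ∈ F then Fintype.card α else Δ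
  have h1 : ∀ f ∈ S, c f ∈ Fintype.piFinset (fun v => Finset.range (B v)) := by
    intro f hf
    rw [Fintype.mem_piFinset]
    intro v
    rw [Finset.mem_range]
    have hlt : c f v < (D f v).card := by
      apply Finset.card_lt_card
      rw [Finset.ssubset_iff_of_subset (Finset.filter_subset _ _)]
      exact ⟨f v, hD f hf v, by simp⟩
    refine hlt.trans_le ?_
    by_cases hv : v ∈ F
    · simp only [B, hv, if_true]
      exact Finset.card_le_univ _
    · simp only [B, D, hv, if_false]
      exact hdet v hv f hf
  have h2 : Set.InjOn c (S : Set (V → α)) := by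
    intro f hf g hg hfg
    have main : ∀ m : ℕ, ∀ v, r v = m → f v = g v := by
      intro m
      induction m using Nat.strong_induction_on with
      | _ m ih =>
        intro v hv
        have hDD : D f v = D g v := by
          by_cases hvF : v ∈ F
          · simp [D, hvF]
          · simp only [D, hvF, if_false]
            congr 1
            apply Finset.filter_congr
            intro k _
            refine forall_congr' fun u => ?_
            refine imp_congr_right fun hu => ?_
            rw [ih (r u) (hv ▸ hu) u rfl]
        have hc := congrFun hfg v
        simp only [c, hDD] at hc
        exact card_filter_lt_injOn he (D g v) (by simpa [hDD] using hD f hf v) (hD g hg v) hc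
    funext v
    exact main _ v rfl
  calc S.card ≤ (Fintype.piFinset (fun v => Finset.range (B v))).card :=
        Finset.card_le_card_of_injOn c h1 h2
    _ = ∏ v, B v := by simp [Fintype.card_piFinset]
    _ = Fintype.card α ^ F.card * Δ ^ Fᶜ.card := by
        rw [← Finset.prod_mul_prod_compl F]
        congr 1
        · rw [Finset.prod_congr rfl (g := fun _ => Fintype.card α), Finset.prod_const]
          intro v hv; simp [B, hv]
        · rw [Finset.prod_congr rfl (g := fun _ => Δ), Finset.prod_const]
          intro v hv; simp at hv; simp [B, hv]

/-- Give `v` rank 1 and every other coordinate rank 0, and leave all coordinates but `v` free. -/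
theorem card_le_of_coordinate {V α : Type*} [Fintype V] [DecidableEq V] [Fintype α] [DecidableEq α]
    (v : V) (Δ : ℕ) (S : Finset (V → α))
    (hdet : ∀ f ∈ S,
      ((S.filter (fun g => ∀ u, u ≠ v → g u = f u)).image (fun g => g v)).card ≤ Δ) :
    S.card ≤ Δ * Fintype.card α ^ (Fintype.card V - 1) := by
  have := card_le_of_determined (fun u => if u = v then 1 else 0) (Finset.univ.erase v) Δ S
    (by
      intro w hw f hf
      have hw' : w = v := by simpa using hw
      subst hw'
      refine le_trans (Finset.card_le_card ?_) (hdet f hf)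
      apply Finset.image_subset_image
      intro g hg
      simp only [Finset.mem_filter] at hg ⊢
      refine ⟨hg.1, fun u hu => hg.2 u ?_⟩
      simp [hu])
  rw [Finset.card_erase_of_mem (Finset.mem_univ _), Finset.card_univ, Finset.compl_erase,
    Finset.compl_univ] at this
  simpa [mul_comm] using this

/-! ### Difference links and sum links -/

/-- Equal link values have equal differences modulo `n`, up to sign. -/
def IsDiffLink (L : Link) : Prop :=
  ∀ n i j i' j' : ℕ, i ∈ Finset.Icc 1 n → j ∈ Finset.Icc 1 n → i' ∈ Finset.Icc 1 n →
    j' ∈ Finset.Icc 1 n → L.val n i j = L.val n i' j' →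
    (i - j : ZMod n) = i' - j' ∨ (i - j : ZMod n) = -(i' - j')

/-- Equal link values have equal sums modulo `n`, up to sign. -/
def IsSumLink (L : Link) : Prop :=
  ∀ n i j i' j' : ℕ, i ∈ Finset.Icc 1 n → j ∈ Finset.Icc 1 n → i' ∈ Finset.Icc 1 n →
    j' ∈ Finset.Icc 1 n → L.val n i j = L.val n i' j' →
    (i + j : ZMod n) = i' + j' ∨ (i + j : ZMod n) = -(i' + j')

theorem isDiffLink_toeplitz : IsDiffLink toeplitz := by
  intro n i j i' j' _ _ _ _ h
  simp only [toeplitz, Int.natAbs_eq_natAbs_iff] at h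
  rcases h with h | h
  · left; exact_mod_cast congrArg (Int.cast : ℤ → ZMod n) h
  · right; exact_mod_cast congrArg (Int.cast : ℤ → ZMod n) h

/-- `min d (n - d)` determines `d = |i - j|` up to `d ↦ n - d`, hence `i - j` up to sign and a shift
by `0` or `±n`. These six cases collapse to two modulo `n`. -/
theorem isDiffLink_symCirculant : IsDiffLink symCirculant := by
  intro n i j i' j' hi hj hi' hj' h
  rw [Finset.mem_Icc] at hi hj hi' hj'
  simp only [symCirculant] at h
  have key : (i : ℤ) - j = i' - j' ∨ (i : ℤ) - j = i' - j' + n ∨ (i : ℤ) - j = i' - j' - n ∨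
      (i : ℤ) - j = -(i' - j') ∨ (i : ℤ) - j = -(i' - j') + n ∨ (i : ℤ) - j = -(i' - j') - n := by
    omega
  rcases key with h | h | h | h | h | h <;>
    have h2 := congrArg (Int.cast : ℤ → ZMod n) h <;> push_cast at h2 <;>
    try simp only [CharP.cast_eq_zero, add_zero, sub_zero] at h2
  · exact Or.inl h2
  · exact Or.inl h2
  · exact Or.inl h2
  · exact Or.inr h2
  · exact Or.inr h2
  · exact Or.inr h2

theorem isSumLink_hankel : IsSumLink hankel := by
  intro n i j i' j' _ _ _ _ h
  left
  exact_mod_cast congrArg (Nat.cast : ℕ → ZMod n) h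

theorem isSumLink_revCirculant : IsSumLink revCirculant := by
  intro n i j i' j' _ _ _ _ h
  left
  have := (ZMod.natCast_eq_natCast_iff' (i + j) (i' + j') n).2 h
  exact_mod_cast this

theorem isSumLink_doublySymHankel : IsSumLink doublySymHankel := by
  intro n i j i' j' hi hj hi' hj' h
  rw [Finset.mem_Icc] at hi hj hi' hj'
  simp only [doublySymHankel] at h
  have h1 : (i + j) % n < n := Nat.mod_lt _ (by omega)
  have h2 : (i' + j') % n < n := Nat.mod_lt _ (by omega)
  have key : (i + j) % n = (i' + j') % n ∨ (i + j) % n + (i' + j') % n = n := by omega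
  have e1 : (i + j : ZMod n) = (((i + j) % n : ℕ) : ZMod n) := by simp
  have e2 : (i' + j' : ZMod n) = (((i' + j') % n : ℕ) : ZMod n) := by simp
  rw [e1, e2]
  rcases key with h | h
  · left; rw [h]
  · right
    rw [eq_neg_iff_add_eq_zero, ← Nat.cast_add, h]
    simp

theorem cast_zmod_injOn (n : ℕ) : Set.InjOn (fun i : ℕ => (i : ZMod n)) (Finset.Icc 1 n) := by
  intro i hi j hj h
  simp only [Finset.coe_Icc, Set.mem_Icc] at hi hj
  have h' := (ZMod.natCast_eq_natCast_iff' i j n).1 h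
  rcases Nat.lt_or_ge i n with h1 | h1 <;> rcases Nat.lt_or_ge j n with h2 | h2
  · rwa [Nat.mod_eq_of_lt h1, Nat.mod_eq_of_lt h2] at h'
  · have : j = n := by omega
    subst this
    rw [Nat.mod_self, Nat.mod_eq_of_lt h1] at h'
    omega
  · have : i = n := by omega
    subst this
    rw [Nat.mod_self, Nat.mod_eq_of_lt h2] at h'
    omega
  · omega

/-- Distinct elements of `{1, …, n}` have distinct residues, so two admissible residues leave at
most two columns. -/
theorem propertyB_of_two_values {L : Link}
    (h : ∀ n k l : ℕ, k ∈ Finset.Icc 1 n → l ∈ Finset.Icc 1 n → ∃ a b : ZMod n,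
      ∀ l' ∈ Finset.Icc 1 n, L.val n k l' = L.val n k l → (l' : ZMod n) = a ∨ (l' : ZMod n) = b) :
    PropertyB L := by
  classical
  refine ⟨2, fun n t k hk => ?_⟩
  by_cases hne : ((Finset.Icc 1 n).filter (fun l => L.val n k l = t)).Nonempty
  · obtain ⟨l, hl⟩ := hne
    rw [Finset.mem_filter] at hl
    obtain ⟨a, b, hab⟩ := h n k l hk hl.1
    refine le_trans (Finset.card_le_card_of_injOn (t := {a, b}) (fun i : ℕ => (i : ZMod n)) ?_ ?_)
      Finset.card_le_two
    · intro l' hl'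
      rw [Finset.mem_coe, Finset.mem_filter] at hl'
      simpa using hab l' hl'.1 (hl'.2.trans hl.2.symm)
    · exact (cast_zmod_injOn n).mono (by intro x hx; simp at hx ⊢; exact hx.1)
  · rw [Finset.not_nonempty_iff_eq_empty.1 hne]; simp

theorem IsDiffLink.propertyB {L : Link} (hL : IsDiffLink L) : PropertyB L := by
  apply propertyB_of_two_values
  intro n k l hk hl
  refine ⟨l, 2 * k - l, fun l' hl' h => ?_⟩
  rcases hL n k l' k l hk hl' hk hl h with h | h
  · left; linear_combination -h
  · right; linear_combination -h

theorem IsSumLink.propertyB {L : Link} (hL : IsSumLink L) : PropertyB L := by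
  apply propertyB_of_two_values
  intro n k l hk hl
  refine ⟨l, -2 * k - l, fun l' hl' h => ?_⟩
  rcases hL n k l' k l hk hl' hk hl h with h | h
  · left; linear_combination h
  · right; linear_combination h

/-- Property B, for indices in `Fin n`. -/
theorem card_fin_val_eq_le {L : Link} {Δ : ℕ}
    (hΔ : ∀ n t : ℕ, ∀ k ∈ Finset.Icc 1 n,
      ((Finset.Icc 1 n).filter (fun l => L.val n k l = t)).card ≤ Δ) {n : ℕ} (a : Fin n) (t : ℕ) :
    (Finset.univ.filter (fun b : Fin n => L.val n (a + 1) (b + 1) = t)).card ≤ Δ := by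
  refine le_trans (Finset.card_le_card_of_injOn (fun b : Fin n => (b : ℕ) + 1) ?_ ?_)
    (hΔ n t (a + 1) (by simp))
  · intro b hb
    have := b.isLt
    simpa using hb
  · intro b _ c _ h
    simp at h
    exact Fin.ext h

/-! ### Circuits whose differences are matched in pairs -/

/-- The index `π t ∈ {1, …, n}` modulo `n`. -/
def res {h n : ℕ} (π : Fin (h + 1) → Fin n) (t : Fin (h + 1)) : ZMod n := ((π t : ℕ) + 1 : ℕ)

/-- The `i`-th difference of a circuit, modulo `n`. -/
def dif {h n : ℕ} (π : Fin (h + 1) → Fin n) (i : Fin h) : ZMod n := res π i.castSucc - res π i.succ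

/-- The `i`-th sum of a circuit, modulo `n`. -/
def sm {h n : ℕ} (π : Fin (h + 1) → Fin n) (i : Fin h) : ZMod n := res π i.castSucc + res π i.succ

/-- The base point of a circuit, and its differences at the edges `i` with `i < p i`. -/
def coords {h n : ℕ} (p : Fin h → Fin h) (π : Fin (h + 1) → Fin n) :
    Option {i : Fin h // i < p i} → ZMod n
  | none => res π 0
  | some i => dif π i

theorem eq_of_res_eq {h n : ℕ} {π π' : Fin (h + 1) → Fin n} (H : ∀ t, res π t = res π' t) :
    π = π' := by
  funext t
  have := cast_zmod_injOn n (x₁ := (π t : ℕ) + 1) (by simp) (x₂ := (π' t : ℕ) + 1) (by simp) (H t)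
  exact Fin.ext (by omega)

/-- Telescoping. Two circuits are compared, rather than one parametrized, because the counts below
fix all coordinates but one and ask how far that one can vary. -/
theorem res_sub_eq_sum {h n : ℕ} (π π' : Fin (h + 1) → Fin n) (t : Fin (h + 1)) :
    res π t - res π' t = res π 0 - res π' 0 -
      ∑ i : Fin h, if i.castSucc < t then dif π i - dif π' i else 0 := by
  induction t using Fin.induction with
  | zero => simp
  | succ i ih =>
    have : ∀ j : Fin h, (if j.castSucc < i.succ then dif π j - dif π' j else 0) =
        (if j.castSucc < i.castSucc then dif π j - dif π' j else 0) +
          (if j = i then dif π j - dif π' j else 0) := by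
      intro j
      rcases lt_trichotomy j i with h | h | h
      · have h1 : j.castSucc < i.succ := by
          simp only [Fin.lt_def, Fin.val_castSucc, Fin.val_succ] at h ⊢; omega
        have h2 : j.castSucc < i.castSucc := by simpa using h
        simp [h1, h2, h.ne]
      · subst h; simp
      · have h1 : ¬ j.castSucc < i.succ := by
          simp only [Fin.lt_def, Fin.val_castSucc, Fin.val_succ] at h ⊢; omega
        have h2 : ¬ j.castSucc < i.castSucc := by
          simp only [Fin.lt_def, Fin.val_castSucc] at h ⊢; omega
        simp [h1, h2, h.ne']
    simp only [this, Finset.sum_add_distrib, Finset.sum_ite_eq', Finset.mem_univ, if_true]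
    rw [← sub_sub, ← ih]
    simp only [dif]
    ring

/-- Twice the average of the indicator function of `(a, b]` at the endpoints of the edge `i`. -/
def edgeWeight {h : ℕ} (a b i : Fin h) : ℤ :=
  (if a < i ∧ i ≤ b then 1 else 0) + (if a ≤ i ∧ i < b then 1 else 0)

/-! ### Circuits that agree in all coordinates but one -/

section Involution

variable {h n : ℕ} {p : Fin h → Fin h}

theorem card_lt_involution {k : ℕ} {p : Fin (2 * k) → Fin (2 * k)} (hne : ∀ i, p i ≠ i)
    (hpp : ∀ i, p (p i) = i) : Fintype.card {i : Fin (2 * k) // i < p i} = k := by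
  rw [Fintype.card_subtype]
  have h1 : (Finset.univ.filter (fun i => ¬ i < p i)) =
      (Finset.univ.filter (fun i => i < p i)).image p := by
    ext i
    simp only [Finset.mem_filter, Finset.mem_univ, true_and, Finset.mem_image]
    constructor
    · intro hi
      exact ⟨p i, by rw [hpp]; exact lt_of_le_of_ne (not_lt.1 hi) (hne i), hpp i⟩
    · rintro ⟨j, hj, rfl⟩
      rw [hpp]; exact hj.le.not_gt
  have h2 := Finset.card_filter_add_card_filter_not (s := (Finset.univ : Finset (Fin (2 * k))))
    (fun i => i < p i)
  rw [h1, Finset.card_image_of_injective _ (Function.Involutive.injective hpp),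
    Finset.card_univ, Fintype.card_fin] at h2
  omega

variable (hpp : ∀ i, p (p i) = i) {ε : Fin h → Bool}
include hpp

/-- The circuits with `d_i = - d_{p i}` where `ε i` and `d_i = d_{p i}` elsewhere. -/
theorem coords_injOn {π π' : Fin (h + 1) → Fin n} (hne : ∀ i, p i ≠ i)
    (hπ : ∀ i, dif π i = if ε i then - dif π (p i) else dif π (p i))
    (hπ' : ∀ i, dif π' i = if ε i then - dif π' (p i) else dif π' (p i))
    (H : coords p π = coords p π') : π = π' := by
  have hd : ∀ i, dif π i = dif π' i := by
    intro i
    by_cases hi : i < p i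
    · exact congrFun H (some ⟨i, hi⟩)
    · have h1 : p i < p (p i) := by rw [hpp]; exact lt_of_le_of_ne (not_lt.1 hi) (hne i)
      have := congrFun H (some ⟨p i, h1⟩)
      simp only [coords] at this
      rw [hπ, hπ', this]
  apply eq_of_res_eq
  intro t
  have h0 : res π 0 = res π' 0 := congrFun H none
  have := res_sub_eq_sum π π' t
  simp only [hd, h0, sub_self, ite_self, Finset.sum_const_zero] at this
  exact sub_eq_zero.1 this

/-- Each coordinate governs one pair of edges: a change of the coordinate `a` shows at `a` and, with
the sign prescribed by `ε`, at `p a`, and nowhere else. -/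
theorem dif_sub_eq_of_coords {π π' : Fin (h + 1) → Fin n} (hne : ∀ i, p i ≠ i)
    (hπ : ∀ i, dif π i = if ε i then - dif π (p i) else dif π (p i))
    (hπ' : ∀ i, dif π' i = if ε i then - dif π' (p i) else dif π' (p i))
    {a : {i : Fin h // i < p i}} (H : ∀ u, u ≠ some a → coords p π u = coords p π' u) (i : Fin h) :
    dif π i - dif π' i = (if i = a then dif π a - dif π' a else 0) +
      (if i = p a then (if ε (p a) then -(dif π a - dif π' a) else dif π a - dif π' a) else 0) := by
  have hzero : ∀ i, i < p i → i ≠ a → dif π i - dif π' i = 0 := by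
    intro i hi hia
    have := H (some ⟨i, hi⟩) (by simpa [Subtype.ext_iff] using hia)
    simp only [coords] at this
    rw [this, sub_self]
  by_cases h1 : i = a
  · subst h1; simp [(hne a).symm]
  by_cases h2 : i = p a
  · rw [h2, hπ, hπ', hpp]
    simp only [hne, if_false, if_true]
    split_ifs <;> ring
  · simp only [h1, h2, if_false, add_zero]
    by_cases hi : i < p i
    · exact hzero i hi h1
    · have h3 : p i < p (p i) := by rw [hpp]; exact lt_of_le_of_ne (not_lt.1 hi) (hne i)
      have h4 := hzero (p i) h3 (fun e => h2 (by rw [← e, hpp]))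
      rw [hπ, hπ']
      split_ifs
      · linear_combination -h4
      · exact h4

/-- Both edges of the pair change by the same amount `c`, while the differences of a closed circuit
sum to zero; hence `2c = 0`. For opposite signs the two changes cancel and closing gives no
constraint. -/
theorem two_mul_eq_zero_of_closed {π π' : Fin (h + 1) → Fin n} (hne : ∀ i, p i ≠ i)
    (hπ : ∀ i, dif π i = if ε i then - dif π (p i) else dif π (p i))
    (hπ' : ∀ i, dif π' i = if ε i then - dif π' (p i) else dif π' (p i))
    (hc : π 0 = π (Fin.last h)) (hc' : π' 0 = π' (Fin.last h))
    {a : {i : Fin h // i < p i}} (ha : ε (p a) = false)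
    (H : ∀ u, u ≠ some a → coords p π u = coords p π' u) :
    2 * (dif π a - dif π' a) = 0 := by
  have h1 := res_sub_eq_sum π π' (Fin.last h)
  have e1 : res π (Fin.last h) = res π 0 := by simp only [res, hc]
  have e2 : res π' (Fin.last h) = res π' 0 := by simp only [res, hc']
  have h2 := dif_sub_eq_of_coords hpp hne hπ hπ' H
  generalize dif π a - dif π' a = c at h2 ⊢
  simp only [Fin.castSucc_lt_last, if_true, h2, ha, Finset.sum_add_distrib, Finset.sum_ite_eq',
    Finset.mem_univ, e1, e2, Bool.false_eq_true, if_false] at h1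
  linear_combination h1

/-- With opposite signs the changes at `a` and `p a` cancel beyond `p a`, so exactly the vertices
after the edge `a` and up to the start of the edge `p a` move, all by the same amount. `edgeWeight`
counts the endpoints of the edge `i` that move. -/
theorem sm_sub_eq {π π' : Fin (h + 1) → Fin n} (hne : ∀ i, p i ≠ i)
    (hπ : ∀ i, dif π i = - dif π (p i)) (hπ' : ∀ i, dif π' i = - dif π' (p i))
    {a : {i : Fin h // i < p i}} (H : ∀ u, u ≠ some a → coords p π u = coords p π' u) (i : Fin h) :
    sm π i - sm π' i = - edgeWeight a.1 (p a) i * (dif π a - dif π' a) := by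
  have hr : ∀ t, res π t - res π' t =
      - (if a.1.castSucc < t ∧ t ≤ (p a).castSucc then 1 else 0) * (dif π a - dif π' a) := by
    intro t
    rw [res_sub_eq_sum]
    have h0 : res π 0 = res π' 0 := H none (by simp)
    have hs := dif_sub_eq_of_coords (ε := fun _ => true) hpp hne (by simpa using hπ)
      (by simpa using hπ') H
    generalize dif π a - dif π' a = c at hs ⊢
    simp only [if_true] at hs
    simp only [hs, h0, sub_self]
    have : ∀ x : Fin h, (if x.castSucc < t then ((if x = a then c else 0) +
      (if x = p a then -c else 0)) else 0)
      = (if x = a then (if a.1.castSucc < t then c else 0) else 0) +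
        (if x = p a then (if (p a).castSucc < t then - c else 0) else 0) := by
      intro x
      by_cases h1 : x = a
      · subst h1; simp [(hne a).symm]
      · by_cases h2 : x = p a
        · subst h2; simp [hne a]
        · simp [h1, h2]
    simp only [this, Finset.sum_add_distrib, Finset.sum_ite_eq', Finset.mem_univ, if_true]
    have hlt : a.1.castSucc < (p a).castSucc := by simpa using a.2
    by_cases h1 : a.1.castSucc < t
    · by_cases h2 : (p a).castSucc < t
      · simp [h1, h2, h2.not_ge]
      · simp [h1, h2, not_lt.1 h2]
    · have h2 : ¬ (p a).castSucc < t := fun hh => h1 (hlt.trans hh)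
      simp [h1, h2]
  have e : sm π i - sm π' i = (res π i.castSucc - res π' i.castSucc) +
      (res π i.succ - res π' i.succ) := by simp only [sm]; ring
  rw [e, hr, hr, edgeWeight]
  have c1 : (a.1.castSucc < i.castSucc ∧ i.castSucc ≤ (p a).castSucc) ↔ (a.1 < i ∧ i ≤ p a) := by
    simp
  have c2 : (a.1.castSucc < i.succ ∧ i.succ ≤ (p a).castSucc) ↔ (a.1 ≤ i ∧ i < p a) := by
    simp only [Fin.lt_def, Fin.le_def, Fin.val_castSucc, Fin.val_succ]; omega
  simp only [c1, c2]
  push_cast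
  ring

end Involution

/-! ### Degrees of freedom of matched circuits -/

section Count

variable {k n : ℕ} {p : Fin (2 * k) → Fin (2 * k)}

/-- After translation this is the 4-torsion of a cyclic group. The coefficients of the relations met
below (`±1`, `±2`, `4`) all divide 4, so this one bound serves them all. -/
theorem card_filter_nsmul_sub_le [NeZero n] (c : ZMod n) :
    (Finset.univ.filter (fun x : ZMod n => 4 * (x - c) = 0)).card ≤ 4 := by
  refine le_trans (Finset.card_le_card_of_injOn
    (t := Finset.univ.filter (fun x : ZMod n => 4 • x = 0)) (fun x => x - c) ?_ ?_)
    (IsAddCyclic.card_nsmul_eq_zero_le (by norm_num))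
  · intro x hx
    simpa using hx
  · intro x _ y _ h
    simpa using h

theorem card_le_of_coords_injOn [NeZero n] (hne : ∀ i, p i ≠ i) (hpp : ∀ i, p (p i) = i)
    (S : Finset (Fin (2 * k + 1) → Fin n))
    (hinj : Set.InjOn (coords p) (S : Set (Fin (2 * k + 1) → Fin n))) :
    S.card ≤ n ^ (k + 1) := by
  refine (Finset.card_le_card_of_injOn (t := Finset.univ) (coords p) (by simp) hinj).trans ?_
  rw [Finset.card_univ, Fintype.card_fun, ZMod.card, Fintype.card_option,
    card_lt_involution hne hpp]

/-- One of the `k + 1` coordinates is confined to 4 values once the others are known, so one factor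
`n` becomes 4. -/
theorem card_le_of_coords_torsion [NeZero n] (hne : ∀ i, p i ≠ i) (hpp : ∀ i, p (p i) = i)
    (S : Finset (Fin (2 * k + 1) → Fin n))
    (hinj : Set.InjOn (coords p) (S : Set (Fin (2 * k + 1) → Fin n)))
    (v : Option {i // i < p i})
    (H : ∀ π ∈ S, ∀ π' ∈ S, (∀ u, u ≠ v → coords p π u = coords p π' u) →
      4 * (coords p π v - coords p π' v) = 0) :
    S.card ≤ 4 * n ^ k := by
  have := card_le_of_coordinate v 4 (S.image (coords p)) (by
    intro f hf
    refine le_trans (Finset.card_le_card ?_) (card_filter_nsmul_sub_le (f v))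
    intro x hx
    simp only [Finset.mem_image, Finset.mem_filter] at hx hf
    obtain ⟨g, ⟨⟨π, hπ, rfl⟩, hg⟩, rfl⟩ := hx
    obtain ⟨π', hπ', rfl⟩ := hf
    simpa using H π hπ π' hπ' hg)
  rwa [Finset.card_image_of_injOn hinj, ZMod.card, Fintype.card_option,
    card_lt_involution hne hpp, Nat.add_sub_cancel] at this

/-- The closed circuits whose differences are matched by `p`, up to sign. -/
noncomputable def matchedDif (p : Fin (2 * k) → Fin (2 * k)) (n : ℕ) :
    Finset (Fin (2 * k + 1) → Fin n) :=
  (circuits (2 * k) n).filter (fun π => ∀ i, dif π i = dif π (p i) ∨ dif π i = - dif π (p i))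

/-- Those whose differences are matched with opposite signs throughout. -/
noncomputable def oppositeDif (p : Fin (2 * k) → Fin (2 * k)) (n : ℕ) :
    Finset (Fin (2 * k + 1) → Fin n) :=
  (matchedDif p n).filter (fun π => ∀ i, dif π i = - dif π (p i))

theorem card_matchedDif_sdiff_le [NeZero n] (hne : ∀ i, p i ≠ i) (hpp : ∀ i, p (p i) = i) :
    (matchedDif p n \ oppositeDif p n).card ≤ 2 ^ (2 * k) * (4 * n ^ k) := by
  classical
  -- Sort the circuits by the set of edges matched with opposite sign; an edge where both signs hold
  -- counts as opposite. There are `2 ^ (2 * k)` patterns, and in a nonempty class some edge is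
  -- matched with equal sign only.
  let σ : (Fin (2 * k + 1) → Fin n) → Fin (2 * k) → Bool := fun π i => dif π i = - dif π (p i)
  rw [Finset.card_eq_sum_card_fiberwise (f := σ) (t := Finset.univ) (by simp)]
  refine le_trans (Finset.sum_le_card_nsmul _ _ (4 * n ^ k) fun ε _ => ?_) (by simp)
  have hmem : ∀ π ∈ (matchedDif p n \ oppositeDif p n).filter (fun π => σ π = ε),
      (∀ i, dif π i = if ε i then - dif π (p i) else dif π (p i)) ∧ π 0 = π (Fin.last _) ∧
      ∃ i, ε i = false := by
    intro π hπ
    simp only [Finset.mem_filter, Finset.mem_sdiff, matchedDif, oppositeDif, circuits,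
      Finset.mem_univ, true_and, not_and, not_forall] at hπ
    obtain ⟨⟨⟨hc, hm⟩, hno⟩, rfl⟩ := hπ
    refine ⟨fun i => ?_, hc, ?_⟩
    · by_cases h : dif π i = - dif π (p i)
      · simp only [σ, ← h, decide_true, if_true]
      · simpa [σ, h] using (hm i).resolve_right h
    · obtain ⟨i, hi⟩ := hno ⟨hc, hm⟩
      exact ⟨i, by simpa [σ] using hi⟩
  rcases Finset.eq_empty_or_nonempty ((matchedDif p n \ oppositeDif p n).filter
    (fun π => σ π = ε)) with he | ⟨π₀, hπ₀⟩
  · rw [he]; simp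
  obtain ⟨i, hi⟩ := (hmem π₀ hπ₀).2.2
  have hpi : ε (p i) = false := by
    have h1 : σ π₀ = ε := (Finset.mem_filter.1 hπ₀).2
    rw [← h1] at hi ⊢
    simp only [σ, decide_eq_false_iff_not, hpp] at hi ⊢
    intro h
    exact hi (by rw [h, neg_neg])
  -- `ε` is false at both edges of the pair, so the smaller of the two can serve as the coordinate.
  obtain ⟨a, ha⟩ : ∃ a : {i // i < p i}, ε (p a) = false := by
    rcases lt_or_gt_of_ne (hne i) with h | h
    · exact ⟨⟨p i, by rwa [hpp]⟩, by simpa [hpp] using hi⟩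
    · exact ⟨⟨i, h⟩, hpi⟩
  refine card_le_of_coords_torsion hne hpp _ ?_ (some a) ?_
  · intro π hπ π' hπ' H
    exact coords_injOn hpp hne (hmem π hπ).1 (hmem π' hπ').1 H
  · intro π hπ π' hπ' H
    have := two_mul_eq_zero_of_closed hpp hne (hmem π hπ).1 (hmem π' hπ').1 (hmem π hπ).2.1
      (hmem π' hπ').2.1 ha H
    simp only [coords]
    linear_combination 2 * this

theorem coords_injOn_oppositeDif (hne : ∀ i, p i ≠ i) (hpp : ∀ i, p (p i) = i) :
    Set.InjOn (coords p) (oppositeDif p n : Set (Fin (2 * k + 1) → Fin n)) := by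
  intro π hπ π' hπ' H
  simp only [oppositeDif, Finset.coe_filter] at hπ hπ'
  exact coords_injOn (ε := fun _ => true) hpp hne (by simpa using hπ.2) (by simpa using hπ'.2) H

theorem card_matchedDif_le [NeZero n] (hne : ∀ i, p i ≠ i) (hpp : ∀ i, p (p i) = i) :
    (matchedDif p n).card ≤ n ^ (k + 1) + 2 ^ (2 * k) * (4 * n ^ k) := by
  classical
  rw [← Finset.card_sdiff_add_card_eq_card (Finset.filter_subset _ _ :
    oppositeDif p n ⊆ matchedDif p n), add_comm]
  exact add_le_add (card_le_of_coords_injOn hne hpp _ (coords_injOn_oppositeDif hne hpp))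
    (card_matchedDif_sdiff_le hne hpp)

/-- Three negligible sets. Equal-sign matches give `2 ^ (2 * k)` classes. If the two sums are equal,
varying the coordinate `a` by `c` gives `(weight t - weight t') * c = 0`. If they are opposite,
varying the base point translates all four vertices involved by the same `c`, so `4c = 0`. -/
theorem card_filter_sm_le [NeZero n] (hne : ∀ i, p i ≠ i) (hpp : ∀ i, p (p i) = i)
    {t t' : Fin (2 * k)} {a : {i // i < p i}}
    (hw : edgeWeight a.1 (p a) t ≠ edgeWeight a.1 (p a) t') :
    ((matchedDif p n).filter (fun π => sm π t = sm π t' ∨ sm π t = - sm π t')).card ≤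
      (2 ^ (2 * k) + 2) * (4 * n ^ k) := by
  classical
  have hsub : (matchedDif p n).filter (fun π => sm π t = sm π t' ∨ sm π t = - sm π t') ⊆
      (matchedDif p n \ oppositeDif p n) ∪
      ((oppositeDif p n).filter (fun π => sm π t = sm π t') ∪
        (oppositeDif p n).filter (fun π => sm π t = - sm π t')) := by
    intro π hπ
    simp only [Finset.mem_filter, Finset.mem_union, Finset.mem_sdiff] at hπ ⊢
    tauto
  have hI := coords_injOn_oppositeDif (n := n) hne hpp
  have hopp : ∀ π ∈ oppositeDif p n, ∀ i, dif π i = - dif π (p i) := fun π hπ =>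
    (Finset.mem_filter.1 hπ).2
  have h1 : ((oppositeDif p n).filter (fun π => sm π t = sm π t')).card ≤ 4 * n ^ k := by
    refine card_le_of_coords_torsion hne hpp _
      (hI.mono (Finset.coe_subset.2 (Finset.filter_subset _ _))) (some a) ?_
    intro π hπ π' hπ' H
    rw [Finset.mem_filter] at hπ hπ'
    have e1 := sm_sub_eq hpp hne (hopp π hπ.1) (hopp π' hπ'.1) H t
    have e2 := sm_sub_eq hpp hne (hopp π hπ.1) (hopp π' hπ'.1) H t'
    rw [hπ.2, hπ'.2] at e1
    have e3 := e1.symm.trans e2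
    -- The weights are distinct elements of `{0, 1, 2}`, so their difference is `±1` or `±2` and
    -- divides 4.
    obtain ⟨c, hc⟩ : ∃ c : ℤ, c * (edgeWeight a.1 (p a) t - edgeWeight a.1 (p a) t') = 4 := by
      unfold edgeWeight at hw ⊢
      split_ifs at hw ⊢ <;> first
        | exact absurd rfl hw
        | (refine ⟨4, ?_⟩; decide)
        | (refine ⟨-4, ?_⟩; decide)
        | (refine ⟨2, ?_⟩; decide)
        | (refine ⟨-2, ?_⟩; decide)
    have hc' := congrArg (Int.cast : ℤ → ZMod n) hc
    push_cast at hc'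
    simp only [coords]
    rw [← hc']
    linear_combination (-c : ZMod n) * e3
  have h2 : ((oppositeDif p n).filter (fun π => sm π t = - sm π t')).card ≤ 4 * n ^ k := by
    refine card_le_of_coords_torsion hne hpp _
      (hI.mono (Finset.coe_subset.2 (Finset.filter_subset _ _))) none ?_
    intro π hπ π' hπ' H
    rw [Finset.mem_filter] at hπ hπ'
    have hd : ∀ i, dif π i - dif π' i = 0 := by
      intro i
      by_cases hi : i < p i
      · exact sub_eq_zero.2 (H (some ⟨i, hi⟩) (by simp))
      · have h1 : p i < p (p i) := by rw [hpp]; exact lt_of_le_of_ne (not_lt.1 hi) (hne i)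
        have := H (some ⟨p i, h1⟩) (by simp)
        simp only [coords] at this
        rw [hopp π hπ.1, hopp π' hπ'.1, this, sub_self]
    have hr : ∀ s, res π s - res π' s = res π 0 - res π' 0 := by
      intro s
      rw [res_sub_eq_sum]
      simp [hd]
    have h3 := hπ.2
    have h4 := hπ'.2
    simp only [sm] at h3 h4
    simp only [coords]
    linear_combination h3 - h4 - hr t.castSucc - hr t.succ - hr t'.castSucc - hr t'.succ
  have h3 := card_matchedDif_sdiff_le (n := n) hne hpp
  have h4 := Finset.card_le_card hsub
  have h5 := Finset.card_union_le (matchedDif p n \ oppositeDif p n)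
    ((oppositeDif p n).filter (fun π => sm π t = sm π t') ∪
        (oppositeDif p n).filter (fun π => sm π t = - sm π t'))
  have h6 := Finset.card_union_le ((oppositeDif p n).filter (fun π => sm π t = sm π t'))
    ((oppositeDif p n).filter (fun π => sm π t = - sm π t'))
  nlinarith

end Count

/-! ### Pair-matched words and Catalan strings -/

/-- At a first disagreement the larger letter forces, by the alphabetical order, an earlier
occurrence of the smaller one; the common pattern then makes the two letters equal. -/
theorem Word.eq_of_pattern {h : ℕ} {w w' : Word h}
    (H : ∀ i j, w.letter i = w.letter j ↔ w'.letter i = w'.letter j) : w = w' := by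
  have main : ∀ m : ℕ, ∀ i : Fin h, (i : ℕ) = m → w.letter i = w'.letter i := by
    intro m
    induction m using Nat.strong_induction_on with
    | _ m ih =>
      intro i hi
      have ih' : ∀ j < i, w.letter j = w'.letter j := fun j hj => ih j (by omega) j rfl
      rcases lt_trichotomy (w.letter i) (w'.letter i) with hlt | he | hlt
      · obtain ⟨j, hj, hw⟩ := w'.ordered i _ hlt
        have h1 : w.letter j = w.letter i := (ih' j hj).trans hw
        have h2 := (H j i).1 h1
        omega
      · exact he
      · obtain ⟨j, hj, hw⟩ := w.ordered i _ hlt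
        have h1 : w'.letter j = w'.letter i := (ih' j hj).symm.trans hw
        have h2 := (H j i).2 h1
        omega
  ext i
  exact main _ i rfl

theorem Word.PairMatched.exists_partner {h : ℕ} {w : Word h} (hw : w.PairMatched) :
    ∃ p : Fin h → Fin h, (∀ i, p i ≠ i) ∧ (∀ i, p (p i) = i) ∧
      ∀ i j, w.letter j = w.letter i ↔ j = i ∨ j = p i := by
  have key : ∀ i, ∃ q, q ≠ i ∧ ∀ j, w.letter j = w.letter i ↔ j = i ∨ j = q := by
    intro i
    obtain ⟨a, b, hab, hs⟩ := Finset.card_eq_two.1 (hw i)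
    have hmem : ∀ j, w.letter j = w.letter i ↔ j = a ∨ j = b := by
      intro j
      have := Finset.ext_iff.1 hs j
      simpa using this
    rcases (hmem i).1 rfl with rfl | rfl
    · exact ⟨b, hab.symm, hmem⟩
    · exact ⟨a, hab, fun j => by rw [hmem]; tauto⟩
  choose p hp hpp using key
  refine ⟨p, hp, fun i => ?_, hpp⟩
  have h1 : w.letter (p i) = w.letter i := (hpp i (p i)).2 (Or.inr rfl)
  have h2 : w.letter i = w.letter (p i) := h1.symm
  rcases (hpp (p i) i).1 h2 with h3 | h3
  · exact absurd h3.symm (hp i)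
  · exact h3.symm

/-- Each letter of `l` occurs twice, and letters between two equal letters do not occur
elsewhere. -/
def IsNoncrossing (l : List ℕ) : Prop :=
  (∀ c ∈ l, l.count c = 2) ∧
    ∀ u q v c, l = u ++ c :: (q ++ c :: v) → ∀ d ∈ q, d ∉ u ∧ d ∉ v

theorem IsCatalanString.append {l : List ℕ} (hl : IsCatalanString l) {r : List ℕ}
    (hr : IsCatalanString r) (hd : ∀ a ∈ l, a ∉ r) : IsCatalanString (l ++ r) := by
  induction hl with
  | double a => exact IsCatalanString.insert [] r a (by simpa using hd a (by simp)) hr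
  | insert u v a ha huv ih =>
    have h1 := ih (fun b hb => hd b (by simp at hb ⊢; tauto))
    rw [List.append_assoc] at h1
    have h2 := IsCatalanString.insert u (v ++ r) a (by
      have := hd a (by simp)
      simp at ha ⊢; tauto) h1
    simpa using h2

theorem IsCatalanString.nest {l : List ℕ} (hl : IsCatalanString l) {a : ℕ} (ha : a ∉ l) :
    IsCatalanString (a :: (l ++ [a])) := by
  induction hl with
  | double b =>
    have := IsCatalanString.insert [a] [a] b (by simp at ha ⊢; exact fun h => ha h.symm)
      (IsCatalanString.double a)
    simpa using this
  | insert u v b hb huv ih =>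
    simp at ha
    have h1 := ih (by simp; tauto)
    have h2 := IsCatalanString.insert (a :: u) (v ++ [a]) b (by
      simp at hb ⊢
      have := ha.2.1
      tauto) (by simpa using h1)
    simpa using h2

theorem IsNoncrossing.exists_eq {a : ℕ} {l : List ℕ} (hl : IsNoncrossing (a :: l)) :
    ∃ q r, l = q ++ a :: r ∧ a ∉ q ∧ a ∉ r ∧ (∀ d ∈ q, d ∉ r) ∧ IsNoncrossing q ∧
      IsNoncrossing r := by
  have h1 : l.count a = 1 := by
    have := hl.1 a (by simp)
    simpa using this
  obtain ⟨q, r, rfl⟩ := List.append_of_mem (List.count_pos_iff.1 (by omega : 0 < l.count a))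
  have h2 : q.count a = 0 ∧ r.count a = 0 := by
    simp [List.count_append] at h1
    omega
  rw [List.count_eq_zero, List.count_eq_zero] at h2
  have hqr : ∀ d ∈ q, d ∉ r := fun d hd => (hl.2 [] q r a rfl d hd).2
  refine ⟨q, r, rfl, h2.1, h2.2, hqr, ⟨fun c hc => ?_, ?_⟩, ⟨fun c hc => ?_, ?_⟩⟩
  · have := hl.1 c (by simp [hc])
    have hca : a ≠ c := fun h => h2.1 (h ▸ hc)
    have hcr : r.count c = 0 := List.count_eq_zero.2 (hqr c hc)
    simpa [List.count_cons, List.count_append, hca, hcr] using this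
  · rintro u q' v c rfl d hd
    have := hl.2 (a :: u) q' (v ++ a :: r) c (by simp) d hd
    simp at this ⊢; tauto
  · have := hl.1 c (by simp [hc])
    have hca : a ≠ c := fun h => h2.2 (h ▸ hc)
    have hcq : q.count c = 0 := List.count_eq_zero.2 (fun h => hqr c h hc)
    simpa [List.count_cons, List.count_append, hca, hcq] using this
  · rintro u q' v c rfl d hd
    have := hl.2 (a :: (q ++ a :: u)) q' v c (by simp) d hd
    simp at this ⊢; tauto

/-- Strong induction on the length: the two occurrences of the first letter split the string as `a q
a r` with `q` and `r` noncrossing and without common letters. Nesting `q` and appending `r` preserve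
Catalan strings. -/
theorem IsNoncrossing.isCatalanString : ∀ (m : ℕ) (l : List ℕ), l.length = m → l ≠ [] →
    IsNoncrossing l → IsCatalanString l := by
  intro m
  induction m using Nat.strong_induction_on with
  | _ m ih =>
    intro l hm hne hl
    obtain _ | ⟨a, l⟩ := l
    · exact absurd rfl hne
    obtain ⟨q, r, rfl, hq, hr, hqr, hnq, hnr⟩ := hl.exists_eq
    simp at hm
    have h1 : IsCatalanString (a :: (q ++ [a])) := by
      rcases eq_or_ne q [] with rfl | hq0
      · exact IsCatalanString.double a
      · exact (ih q.length (by omega) q rfl hq0 hnq).nest hq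
    rcases eq_or_ne r [] with rfl | hr0
    · exact h1
    · have h2 := h1.append (ih r.length (by omega) r rfl hr0 hnr) (by
        intro b hb
        simp at hb
        rcases hb with rfl | hb | rfl
        · exact hr
        · exact hqr b hb
        · exact hr)
      simpa using h2

theorem Word.PairMatched.isNoncrossing {h : ℕ} {w : Word h} (hw : w.PairMatched)
    (H : ∀ i j x y : Fin h, i < x → x < j → (y < i ∨ j < y) → w.letter i = w.letter j →
      w.letter x ≠ w.letter y) : IsNoncrossing (List.ofFn w.letter) := by
  constructor
  · intro c hc
    obtain ⟨i, rfl⟩ := (List.mem_ofFn' _ _).1 hc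
    rw [← hw i, List.ofFn_eq_map, List.count_eq_countP, List.countP_map, Finset.card_def,
      Finset.filter_val, Finset.val_univ_fin, Multiset.filter_coe, Multiset.coe_card,
      ← List.countP_eq_length_filter]
    exact List.countP_congr (by simp)
  · intro u q v c hl d hd
    have hlen := congrArg List.length hl
    simp at hlen
    have hget : ∀ m (hm : m < h), (u ++ c :: (q ++ c :: v))[m]? = some (w.letter ⟨m, hm⟩) := by
      intro m hm
      rw [← hl]
      simp [hm]
    obtain ⟨x, hx, hxd⟩ := List.mem_iff_getElem.1 hd
    have ei := hget u.length (by omega)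
    have ej := hget (u.length + 1 + q.length) (by omega)
    have ex := hget (u.length + 1 + x) (by omega)
    have e1 : u.length + 1 + q.length - u.length = q.length + 1 := by omega
    have e2 : u.length + 1 + x - u.length = x + 1 := by omega
    rw [List.getElem?_append_right (by omega)] at ei ej ex
    simp [e1] at ei ej
    rw [e2, List.getElem?_cons_succ, List.getElem?_append_left hx,
      List.getElem?_eq_getElem hx] at ex
    simp [hxd] at ex
    constructor
    · intro hdu
      obtain ⟨y, hy, hyd⟩ := List.mem_iff_getElem.1 hdu
      have ey := hget y (by omega)
      rw [List.getElem?_append_left hy, List.getElem?_eq_getElem hy, hyd] at ey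
      simp at ey
      exact H ⟨u.length, by omega⟩ ⟨u.length + 1 + q.length, by omega⟩ ⟨u.length + 1 + x, by omega⟩
        ⟨y, by omega⟩ (by simp [Fin.lt_def]; omega) (by simp [Fin.lt_def]; omega)
        (Or.inl (by simp [Fin.lt_def]; omega)) (ei.symm.trans ej) (ex.symm.trans ey)
    · intro hdv
      obtain ⟨y, hy, hyd⟩ := List.mem_iff_getElem.1 hdv
      have ey := hget (u.length + 1 + q.length + 1 + y) (by omega)
      have e3 : u.length + 1 + q.length + 1 + y - u.length = q.length + 1 + y + 1 := by omega
      have e4 : q.length + 1 + y - q.length = y + 1 := by omega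
      rw [List.getElem?_append_right (by omega), e3, List.getElem?_cons_succ,
        List.getElem?_append_right (by omega), e4, List.getElem?_cons_succ,
        List.getElem?_eq_getElem hy, hyd] at ey
      simp at ey
      exact H ⟨u.length, by omega⟩ ⟨u.length + 1 + q.length, by omega⟩ ⟨u.length + 1 + x, by omega⟩
        ⟨_, by omega⟩ (by simp [Fin.lt_def]; omega) (by simp [Fin.lt_def]; omega)
        (Or.inr (by simp [Fin.lt_def]; omega)) (ei.symm.trans ej) (ex.symm.trans ey)

/-! ### Upper bounds for the number of circuits -/

variable {k n : ℕ} {LX LY : Link} {w w' : Word (2 * k)}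

theorem circuitClassStar_subset_matchedDif (hX : IsDiffLink LX) {p : Fin (2 * k) → Fin (2 * k)}
    (hp : ∀ i j, w.letter j = w.letter i ↔ j = i ∨ j = p i) :
    circuitClassStar LX w n ⊆ matchedDif p n := by
  intro π hπ
  simp only [circuitClassStar, Finset.mem_filter] at hπ
  simp only [matchedDif, Finset.mem_filter]
  refine ⟨hπ.1, fun i => ?_⟩
  have := hπ.2 i (p i) ((hp i (p i)).2 (Or.inr rfl)).symm
  have h := hX n _ _ _ _ (by simp) (by simp) (by simp) (by simp) this
  simpa [dif, res] using h

theorem card_circuitClassStar_inter_le [NeZero n] (hX : IsDiffLink LX) (hw : w.PairMatched) :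
    (circuitClassStar LX w n ∩ circuitClassStar LY w' n).card ≤
      n ^ (k + 1) + 2 ^ (2 * k) * (4 * n ^ k) := by
  obtain ⟨p, hne, hpp, hp⟩ := hw.exists_partner
  exact (Finset.card_le_card (Finset.inter_subset_left.trans
    (circuitClassStar_subset_matchedDif hX hp))).trans (card_matchedDif_le hne hpp)

theorem edgeWeight_eq_one {h : ℕ} {a b i : Fin h} (hab : a < b) :
    edgeWeight a b i = 1 ↔ i = a ∨ i = b := by
  simp only [edgeWeight, Fin.lt_def, Fin.le_def, Fin.ext_iff] at *
  split_ifs <;> simp <;> omega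

theorem edgeWeight_eq_two {h : ℕ} {a b i : Fin h} :
    edgeWeight a b i = 2 ↔ a < i ∧ i < b := by
  simp only [edgeWeight, Fin.lt_def, Fin.le_def] at *
  split_ifs <;> simp <;> omega

/-- If for every pair of `w` the edge weight is constant along the matches of `w'`, then the edges
of weight 1 show that the partners agree, and the edges of weight 2 that no pair crosses another, so
`w = w'` is Catalan. Otherwise some match of `w'` joins edges of different weights and
`card_filter_sm_le` applies. The proviso `1 ≤ k` is there because the empty word is not Catalan. -/
theorem card_circuitClassStar_inter_le_of_not [NeZero n] (hX : IsDiffLink LX) (hY : IsSumLink LY)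
    (hw : w.PairMatched) (hw' : w'.PairMatched) (H : ¬ (w = w' ∧ (1 ≤ k → w.IsCatalan))) :
    (circuitClassStar LX w n ∩ circuitClassStar LY w' n).card ≤
      (2 ^ (2 * k) + 2) * (4 * n ^ k) := by
  obtain ⟨p, hne, hpp, hp⟩ := hw.exists_partner
  obtain ⟨p', hne', hpp', hp'⟩ := hw'.exists_partner
  by_cases hgood : ∀ (t t' : Fin (2 * k)) (a : {i // i < p i}), w'.letter t = w'.letter t' →
      edgeWeight a.1 (p a) t = edgeWeight a.1 (p a) t'
  · exfalso
    apply H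
    -- Only `a` and `p a` have weight 1 for the pair of `a`, so the partner of `a` in `w'`, being
    -- different from `a`, is `p a`.
    have hfirst : ∀ a, a < p a → p' a = p a := by
      intro a ha
      have h1 := hgood a (p' a) ⟨a, ha⟩ ((hp' a (p' a)).2 (Or.inr rfl)).symm
      rw [(edgeWeight_eq_one ha).2 (Or.inl rfl)] at h1
      exact ((edgeWeight_eq_one ha).1 h1.symm).resolve_left (hne' a)
    have hall : ∀ a, p' a = p a := by
      intro a
      rcases lt_or_gt_of_ne (hne a) with h | h
      · have := hfirst (p a) (by rwa [hpp])
        rw [hpp] at this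
        rw [← this, hpp', this]
      · exact hfirst a h
    have hww : w = w' := Word.eq_of_pattern fun i j => by rw [hp, hp', hall]
    refine ⟨hww, fun hk => ?_⟩
    refine IsNoncrossing.isCatalanString _ _ rfl (by simp; omega) (hw.isNoncrossing ?_)
    intro i j x y hix hxj hy hij hxy
    have hj : j = p i := ((hp i j).1 hij.symm).resolve_left (by
      rintro rfl; exact absurd (hix.trans hxj) (lt_irrefl _))
    subst hj
    have h1 := hgood x y ⟨i, hix.trans hxj⟩ (by rw [← hww]; exact hxy)
    rw [edgeWeight_eq_two.2 ⟨hix, hxj⟩] at h1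
    have h2 := edgeWeight_eq_two.1 h1.symm
    rcases hy with hy | hy
    · exact absurd hy h2.1.not_gt
    · exact absurd hy h2.2.not_gt
  · push Not at hgood
    obtain ⟨t, t', a, htt, hne2⟩ := hgood
    refine (Finset.card_le_card ?_).trans (card_filter_sm_le (n := n) hne hpp hne2)
    intro π hπ
    rw [Finset.mem_inter] at hπ
    rw [Finset.mem_filter]
    refine ⟨circuitClassStar_subset_matchedDif hX hp hπ.1, ?_⟩
    have := (Finset.mem_filter.1 hπ.2).2 t t' htt
    have h := hY n _ _ _ _ (by simp) (by simp) (by simp) (by simp) this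
    simpa [sm, res] using h

/-! ### Circuits on trees -/

/-- `τ` maps the closed path of edges `0, …, l.length - 1` onto a tree with vertices
`0, …, l.length / 2`, in which the two edges with the same letter are traversed in opposite
directions and edges with different letters are different. -/
structure IsTreeLabelling (l : List ℕ) (τ : ℕ → ℕ) : Prop where
  closed : τ 0 = τ l.length
  le : ∀ t ≤ l.length, 2 * τ t ≤ l.length
  surj : ∀ v, 2 * v ≤ l.length → ∃ t ≤ l.length, τ t = v
  opposite : ∀ i j, i < j → j < l.length → l[i]? = l[j]? → τ i = τ (j + 1) ∧ τ (i + 1) = τ j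
  ne : ∀ i < l.length, τ i ≠ τ (i + 1)
  inj : ∀ i < l.length, ∀ j < l.length, (τ i = τ j ∨ τ i = τ (j + 1)) →
    (τ (i + 1) = τ j ∨ τ (i + 1) = τ (j + 1)) → l[i]? = l[j]?

/-- Inserting `aa` after `u` grafts a new leaf, numbered `m + 1`, onto the vertex reached after `u`:
the path steps to the leaf and back, and then continues as before with times shifted by 2. -/
theorem IsCatalanString.exists_treeLabelling {l : List ℕ} (hl : IsCatalanString l) :
    Even l.length ∧ ∃ τ, IsTreeLabelling l τ := by
  induction hl with
  | double a =>
    refine ⟨by simp, fun t => if t = 1 then 1 else 0, ?_⟩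
    constructor
    · simp
    · intro t _; split_ifs <;> simp
    · intro v hv
      simp at hv
      have : v = 0 ∨ v = 1 := by omega
      rcases this with rfl | rfl
      · exact ⟨0, by simp, by simp⟩
      · exact ⟨1, by simp, by simp⟩
    · intro i j hij hj _
      simp at hj
      have : i = 0 ∧ j = 1 := by omega
      obtain ⟨rfl, rfl⟩ := this
      simp
    · intro i hi
      simp at hi
      have : i = 0 ∨ i = 1 := by omega
      rcases this with rfl | rfl <;> simp
    · intro i hi j hj _ _
      simp at hi hj
      have h1 : i = 0 ∨ i = 1 := by omega
      have h2 : j = 0 ∨ j = 1 := by omega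
      rcases h1 with rfl | rfl <;> rcases h2 with rfl | rfl <;> simp
  | insert u v a ha huv ih =>
    obtain ⟨⟨m, hm⟩, τ, hτ⟩ := ih
    have hlen : (u ++ a :: a :: v).length = (u ++ v).length + 2 := by simp; omega
    have hul : u.length ≤ (u ++ v).length := by simp
    refine ⟨⟨m + 1, by omega⟩, fun t => if t ≤ u.length then τ t else
      if t = u.length + 1 then m + 1 else τ (t - 2), ?_⟩
    set τ' : ℕ → ℕ := fun t => if t ≤ u.length then τ t else
      if t = u.length + 1 then m + 1 else τ (t - 2) with hτ'
    have hlow : ∀ t, t ≤ u.length → τ' t = τ t := fun t ht => by simp [hτ', ht]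
    have hmid : τ' (u.length + 1) = m + 1 := by simp [hτ']
    have hh : ∀ t, u.length ≤ t → τ' (t + 2) = τ t := fun t ht => by
      have h1 : ¬ t + 2 ≤ u.length := by omega
      have h2 : ¬ t + 2 = u.length + 1 := by omega
      simp [hτ', h1, h2]
    have hold : ∀ s, (u ++ v)[s]? ≠ some a := fun s hs => ha (List.mem_of_getElem? hs)
    -- An edge of the new path is an old edge, possibly shifted by 2, or one of the two traversals
    -- of the edge to the leaf. The properties of individual edges are checked on these cases.
    have hedge : ∀ i < (u ++ a :: a :: v).length,
        (∃ s < (u ++ v).length, (i = s ∧ i < u.length ∨ i = s + 2 ∧ u.length ≤ s) ∧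
          (u ++ a :: a :: v)[i]? = (u ++ v)[s]? ∧ τ' i = τ s ∧ τ' (i + 1) = τ (s + 1)) ∨
        (i = u.length ∧ (u ++ a :: a :: v)[i]? = some a ∧ τ' i = τ u.length ∧
          τ' (i + 1) = m + 1) ∨
        (i = u.length + 1 ∧ (u ++ a :: a :: v)[i]? = some a ∧ τ' i = m + 1 ∧
          τ' (i + 1) = τ u.length) := by
      intro i hi
      rcases lt_trichotomy i u.length with h | h | h
      · left
        refine ⟨i, by omega, Or.inl ⟨rfl, h⟩, ?_, hlow i h.le, hlow _ h⟩
        rw [List.getElem?_append_left h, List.getElem?_append_left h]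
      · right; left
        subst h
        exact ⟨rfl, by simp, hlow _ le_rfl, hmid⟩
      · rcases Nat.lt_or_ge i (u.length + 2) with h2 | h2
        · right; right
          obtain rfl : i = u.length + 1 := by omega
          refine ⟨rfl, ?_, hmid, hh _ le_rfl⟩
          rw [List.getElem?_append_right (by omega)]
          simp
        · left
          obtain ⟨s, rfl⟩ : ∃ s, i = s + 2 := ⟨i - 2, by omega⟩
          obtain ⟨r, rfl⟩ : ∃ r, s = u.length + r := Nat.exists_eq_add_of_le (by omega)
          refine ⟨u.length + r, by omega, Or.inr ⟨rfl, by omega⟩, ?_, hh _ (by omega),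
            hh (u.length + r + 1) (by omega)⟩
          rw [List.getElem?_append_right (by omega), List.getElem?_append_right (by omega)]
          have : u.length + r + 2 - u.length = r + 2 := by omega
          rw [this]; simp
    have hub : ∀ t ≤ (u ++ v).length, τ t ≠ m + 1 := fun t ht h => by
      have := hτ.le t ht; omega
    have hu := hub u.length hul
    constructor
    · rw [hlen, hh _ hul, hlow 0 (by omega)]
      exact hτ.closed
    · intro t ht
      rcases Nat.lt_or_ge u.length t with h | h
      · rcases Nat.lt_or_ge t (u.length + 2) with h2 | h2
        · obtain rfl : t = u.length + 1 := by omega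
          rw [hmid]; omega
        · obtain ⟨s, rfl⟩ : ∃ s, t = s + 2 := ⟨t - 2, by omega⟩
          rw [hh s (by omega)]
          have := hτ.le s (by omega)
          omega
      · rw [hlow t h]
        have := hτ.le t (by omega)
        omega
    · intro x hx
      rcases Nat.lt_or_ge m x with h | h
      · exact ⟨u.length + 1, by omega, by rw [hmid]; omega⟩
      · obtain ⟨t, ht, rfl⟩ := hτ.surj x (by omega)
        rcases Nat.lt_or_ge u.length t with h | h
        · exact ⟨t + 2, by omega, hh t h.le⟩
        · exact ⟨t, by omega, hlow t h⟩
    · intro i j hij hj he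
      rcases hedge i (by omega) with ⟨s, hs, hsi, e1, e2, e3⟩ | ⟨hi, e1, e2, e3⟩ | ⟨hi, e1, e2, e3⟩
      all_goals rcases hedge j hj with ⟨r, hr, hrj, f1, f2, f3⟩ | ⟨hj', f1, f2, f3⟩ |
        ⟨hj', f1, f2, f3⟩
      all_goals rw [e1, f1] at he; rw [e2, e3, f2, f3]
      · exact hτ.opposite s r (by omega) hr he
      · exact absurd he (hold _)
      · exact absurd he (hold _)
      · exact absurd he.symm (hold _)
      · omega
      · exact ⟨rfl, rfl⟩
      · exact absurd he.symm (hold _)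
      · omega
      · omega
    · intro i hi
      rcases hedge i hi with ⟨s, hs, hsi, e1, e2, e3⟩ | ⟨hi, e1, e2, e3⟩ | ⟨hi, e1, e2, e3⟩
      · rw [e2, e3]; exact hτ.ne s hs
      · rw [e2, e3]; exact hu
      · rw [e2, e3]; exact hu.symm
    · intro i hi j hj
      rcases hedge i hi with ⟨s, hs, hsi, e1, e2, e3⟩ | ⟨hi, e1, e2, e3⟩ | ⟨hi, e1, e2, e3⟩
      all_goals rcases hedge j hj with ⟨r, hr, hrj, f1, f2, f3⟩ | ⟨hj', f1, f2, f3⟩ |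
        ⟨hj', f1, f2, f3⟩
      all_goals rw [e1, f1, e2, e3, f2, f3]; intro h1 h2
      · exact hτ.inj s hs r hr h1 h2
      all_goals first
        | rfl
        | exfalso
      · have := hub s hs.le
        have := hub (s + 1) hs
        have := hτ.ne s hs
        omega
      · have := hub s hs.le
        have := hub (s + 1) hs
        have := hτ.ne s hs
        omega
      · have := hub r hr.le
        have := hub (r + 1) hr
        omega
      · have := hub r hr.le
        have := hub (r + 1) hr
        omega

theorem Word.IsCatalan.exists_treeLabelling {k : ℕ} {w : Word (2 * k)} (hw : w.IsCatalan) :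
    ∃ τ : Fin (2 * k + 1) → Fin (k + 1), τ 0 = τ (Fin.last _) ∧ Function.Surjective τ ∧
      (∀ i j : Fin (2 * k), i ≠ j → w.letter i = w.letter j →
        τ i.castSucc = τ j.succ ∧ τ i.succ = τ j.castSucc) ∧
      (∀ i : Fin (2 * k), τ i.castSucc ≠ τ i.succ) ∧
      ∀ i j : Fin (2 * k), (τ i.castSucc = τ j.castSucc ∨ τ i.castSucc = τ j.succ) →
        (τ i.succ = τ j.castSucc ∨ τ i.succ = τ j.succ) → w.letter i = w.letter j := by
  obtain ⟨-, τ, hτ⟩ := IsCatalanString.exists_treeLabelling hw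
  have hlen : (List.ofFn w.letter).length = 2 * k := by simp
  have hget : ∀ i : Fin (2 * k), (List.ofFn w.letter)[(i : ℕ)]? = some (w.letter i) := by
    intro i; simp
  obtain ⟨h1, h2, h3, h4, h5, h6⟩ := hτ
  rw [hlen] at h1 h2 h3 h4 h5 h6
  refine ⟨fun t => ⟨τ t, by have := h2 t (by omega); omega⟩, by simpa using h1, ?_, ?_, ?_, ?_⟩
  · intro v
    obtain ⟨t, ht, hv⟩ := h3 v (by omega)
    exact ⟨⟨t, by omega⟩, Fin.ext hv⟩
  · intro i j hij hw
    simp only [Fin.ext_iff, Fin.val_castSucc, Fin.val_succ]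
    rcases lt_or_gt_of_ne hij with h | h
    · exact h4 i j h j.isLt (by rw [hget, hget, hw])
    · have := h4 j i h i.isLt (by rw [hget, hget, hw])
      exact ⟨this.2.symm, this.1.symm⟩
  · intro i
    simpa [Fin.ext_iff] using h5 i i.isLt
  · intro i j ha hb
    simp only [Fin.ext_iff, Fin.val_castSucc, Fin.val_succ] at ha hb
    have := h6 i i.isLt j j.isLt ha hb
    rw [hget, hget] at this
    simpa using this

/-- One endpoint of the edge `i` is a tree vertex that is not on the edge `j`. With all other
vertices fixed, its index must produce a prescribed value in a prescribed row, and Property B leaves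
at most `Δ` choices. -/
theorem card_edge_eq_le {h m n : ℕ} {L : Link} {Δ : ℕ}
    (hΔ : ∀ n t : ℕ, ∀ k ∈ Finset.Icc 1 n,
      ((Finset.Icc 1 n).filter (fun l => L.val n k l = t)).card ≤ Δ)
    (τ : Fin (h + 1) → Fin (m + 1)) {i j : Fin h} (hne : τ i.castSucc ≠ τ i.succ)
    (H : ¬ ((τ i.castSucc = τ j.castSucc ∨ τ i.castSucc = τ j.succ) ∧
      (τ i.succ = τ j.castSucc ∨ τ i.succ = τ j.succ))) :
    (Finset.univ.filter (fun g : Fin (m + 1) → Fin n =>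
      L.edge (g ∘ τ) i = L.edge (g ∘ τ) j)).card ≤ Δ * n ^ m := by
  have key : ∀ a b, a ≠ b → a ≠ τ j.castSucc → a ≠ τ j.succ →
      (∀ g : Fin (m + 1) → Fin n, L.edge (g ∘ τ) i = L.val n (g b + 1) (g a + 1)) →
      (Finset.univ.filter (fun g : Fin (m + 1) → Fin n =>
        L.edge (g ∘ τ) i = L.edge (g ∘ τ) j)).card ≤ Δ * n ^ m := by
    intro a b hab hc hd hL
    have := card_le_of_coordinate a Δ (Finset.univ.filter (fun g : Fin (m + 1) → Fin n =>
      L.edge (g ∘ τ) i = L.edge (g ∘ τ) j)) (by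
      intro f hf
      refine (Finset.card_le_card ?_).trans
        (card_fin_val_eq_le hΔ (f b) (L.edge (f ∘ τ) j))
      intro x hx
      simp only [Finset.mem_image, Finset.mem_filter, Finset.mem_univ, true_and] at hx ⊢
      obtain ⟨g, ⟨hg1, hg2⟩, rfl⟩ := hx
      rw [hL, hg2 b hab.symm] at hg1
      rw [hg1]
      simp [Link.edge, hg2 _ hc.symm, hg2 _ hd.symm])
    simpa using this
  by_cases h1 : τ i.castSucc = τ j.castSucc ∨ τ i.castSucc = τ j.succ
  · have h2 : ¬ (τ i.succ = τ j.castSucc ∨ τ i.succ = τ j.succ) := fun h => H ⟨h1, h⟩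
    push Not at h2
    exact key (τ i.succ) (τ i.castSucc) hne.symm h2.1 h2.2 (fun g => rfl)
  · push Not at h1
    exact key (τ i.castSucc) (τ i.succ) hne h1.1 h1.2 (fun g => L.symm _ _ _)

/-- All `n ^ (k + 1)` assignments of indices to the tree vertices give circuits with the matches of
`w` for both links, since matched edges are reversals of each other and links are symmetric.
Discarding, for each link and each pair of edges with different letters, the assignments that match
them costs `O(n ^ k)`; the remaining circuits have exactly the pattern `w`. -/
theorem le_card_circuitClass_inter {k : ℕ} {w : Word (2 * k)} (hw : w.IsCatalan) {LX LY : Link}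
    (hX : PropertyB LX) (hY : PropertyB LY) :
    ∃ K : ℕ, ∀ n, n ^ (k + 1) ≤ (circuitClass LX w n ∩ circuitClass LY w n).card + K * n ^ k := by
  classical
  obtain ⟨ΔX, hΔX⟩ := hX
  obtain ⟨ΔY, hΔY⟩ := hY
  obtain ⟨τ, hτ0, hτs, hτo, hτn, hτi⟩ := hw.exists_treeLabelling
  refine ⟨(2 * k) * (2 * k) * (ΔX + ΔY), fun n => ?_⟩
  let B : Link → Fin (2 * k) × Fin (2 * k) → Finset (Fin (k + 1) → Fin n) := fun L q =>
    if w.letter q.1 = w.letter q.2 then ∅ else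
      Finset.univ.filter (fun g => L.edge (g ∘ τ) q.1 = L.edge (g ∘ τ) q.2)
  have hB : ∀ L Δ, (∀ n t : ℕ, ∀ k ∈ Finset.Icc 1 n,
      ((Finset.Icc 1 n).filter (fun l => L.val n k l = t)).card ≤ Δ) → ∀ q,
      (B L q).card ≤ Δ * n ^ k := by
    intro L Δ hΔ q
    simp only [B]
    split_ifs with h
    · simp
    · exact card_edge_eq_le hΔ τ (hτn _) fun H => h (hτi _ _ H.1 H.2)
  let Bad := Finset.univ.biUnion (fun q => B LX q ∪ B LY q)
  have hBad : Bad.card ≤ (2 * k) * (2 * k) * (ΔX + ΔY) * n ^ k := by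
    refine Finset.card_biUnion_le.trans ?_
    refine (Finset.sum_le_card_nsmul _ _ ((ΔX + ΔY) * n ^ k) fun q _ => ?_).trans ?_
    · refine (Finset.card_union_le _ _).trans ?_
      rw [add_mul]
      exact add_le_add (hB _ _ hΔX q) (hB _ _ hΔY q)
    · simp [mul_assoc]
  have hgood : ∀ L, (∀ q, B L q ⊆ Bad) → ∀ g, g ∉ Bad → g ∘ τ ∈ circuitClass L w n := by
    intro L hL g hg
    simp only [circuitClass, circuits, Finset.mem_filter, Finset.mem_univ, true_and]
    refine ⟨by simp [hτ0], fun i j => ⟨fun h => ?_, fun h => ?_⟩⟩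
    · by_cases hij : i = j
      · rw [hij]
      · obtain ⟨h1, h2⟩ := hτo i j hij h
        simp only [Link.edge, Function.comp, h1, h2]
        exact L.symm _ _ _
    · by_contra hne
      apply hg
      apply hL (i, j)
      simp only [B, hne, if_false, Finset.mem_filter, Finset.mem_univ, true_and]
      exact h
  have hcard : (Finset.univ \ Bad).card ≤ (circuitClass LX w n ∩ circuitClass LY w n).card := by
    refine Finset.card_le_card_of_injOn (fun g => g ∘ τ) ?_ ?_
    · intro g hg
      have hg' : g ∉ Bad := by simpa using hg
      rw [Finset.mem_coe, Finset.mem_inter]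
      constructor
      · refine hgood LX (fun q => ?_) g hg'
        exact Finset.subset_union_left.trans
          (Finset.subset_biUnion_of_mem (fun q => B LX q ∪ B LY q) (Finset.mem_univ q))
      · refine hgood LY (fun q => ?_) g hg'
        exact Finset.subset_union_right.trans
          (Finset.subset_biUnion_of_mem (fun q => B LX q ∪ B LY q) (Finset.mem_univ q))
    · intro g _ g' _ hgg
      exact hτs.injective_comp_right hgg
  have htot : (Finset.univ : Finset (Fin (k + 1) → Fin n)).card = n ^ (k + 1) := by simp
  rw [← htot, ← Finset.card_sdiff_add_card_eq_card (Finset.subset_univ Bad)]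
  exact add_le_add hcard hBad

/-! ### Word limits -/

theorem tendsto_div_of_abs_sub_le {k : ℕ} {f : ℕ → ℕ} {p K : ℝ}
    (h : ∀ n : ℕ, 1 ≤ n → |(f n : ℝ) - p * (n : ℝ) ^ (k + 1)| ≤ K * (n : ℝ) ^ k) :
    Tendsto (fun n : ℕ => (f n : ℝ) / (n : ℝ) ^ (1 + k)) atTop (𝓝 p) := by
  rw [tendsto_iff_norm_sub_tendsto_zero]
  refine squeeze_zero' (Eventually.of_forall fun _ => norm_nonneg _) ?_
    (tendsto_const_div_atTop_nhds_zero_nat K)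
  filter_upwards [eventually_ge_atTop 1] with n hn
  have hn' : (0 : ℝ) < n := by exact_mod_cast hn
  have e : (f n : ℝ) / (n : ℝ) ^ (1 + k) - p =
      ((f n : ℝ) - p * (n : ℝ) ^ (k + 1)) / (n : ℝ) ^ (k + 1) := by
    rw [add_comm 1 k]; field_simp
  rw [e, Real.norm_eq_abs, abs_div, abs_of_pos (pow_pos hn' (k + 1)),
    div_le_div_iff₀ (pow_pos hn' _) hn']
  calc _ ≤ K * (n : ℝ) ^ k * n := mul_le_mul_of_nonneg_right (h n hn) hn'.le
    _ = K * (n : ℝ) ^ (k + 1) := by ring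

theorem circuitClass_subset {L : Link} {h n : ℕ} {w : Word h} :
    circuitClass L w n ⊆ circuitClassStar L w n := by
  intro π hπ
  simp only [circuitClass, circuitClassStar, Finset.mem_filter] at hπ ⊢
  exact ⟨hπ.1, fun i j => (hπ.2 i j).1⟩

theorem hasWordLimit_zero {k : ℕ} {w w' : Word (2 * k)} {LX LY : Link} (hX : IsDiffLink LX)
    (hY : IsSumLink LY) (hw : w.PairMatched) (hw' : w'.PairMatched)
    (H : ¬ (w = w' ∧ (1 ≤ k → w.IsCatalan))) : HasWordLimit LX LY w w' 0 := by
  have key : ∀ f : ℕ → ℕ,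
      (∀ n, f n ≤ (circuitClassStar LX w n ∩ circuitClassStar LY w' n).card) →
      Tendsto (fun n : ℕ => (f n : ℝ) / (n : ℝ) ^ (1 + k)) atTop (𝓝 0) := by
    intro f hf
    refine tendsto_div_of_abs_sub_le (K := (2 ^ (2 * k) + 2) * 4) fun n hn => ?_
    have : NeZero n := ⟨by omega⟩
    have := (hf n).trans (card_circuitClassStar_inter_le_of_not (n := n) hX hY hw hw' H)
    have h2 : (f n : ℝ) ≤ (2 ^ (2 * k) + 2) * (4 * (n : ℝ) ^ k) := by exact_mod_cast this
    rw [zero_mul, sub_zero, abs_of_nonneg (by positivity)]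
    linarith
  exact ⟨key _ fun n => Finset.card_le_card
    (Finset.inter_subset_inter circuitClass_subset circuitClass_subset), key _ fun n => le_rfl⟩

/-- The upper bound comes from the matched differences alone and the lower bound from the tree
circuits. Both cardinalities lie between the two, so one squeeze serves for both. -/
theorem hasWordLimit_one {k : ℕ} {w : Word (2 * k)} {LX LY : Link} (hX : IsDiffLink LX)
    (hY : IsSumLink LY) (hw : w.PairMatched) (H : w.IsCatalan) : HasWordLimit LX LY w w 1 := by
  obtain ⟨K, hK⟩ := le_card_circuitClass_inter H hX.propertyB hY.propertyB
  have key : ∀ f : ℕ → ℕ,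
      (∀ n, f n ≤ (circuitClassStar LX w n ∩ circuitClassStar LY w n).card) →
      (∀ n, (circuitClass LX w n ∩ circuitClass LY w n).card ≤ f n) →
      Tendsto (fun n : ℕ => (f n : ℝ) / (n : ℝ) ^ (1 + k)) atTop (𝓝 1) := by
    intro f hf hf'
    refine tendsto_div_of_abs_sub_le (K := K + 2 ^ (2 * k) * 4) fun n hn => ?_
    have : NeZero n := ⟨by omega⟩
    have h1 := (hf n).trans (card_circuitClassStar_inter_le (n := n) hX hw)
    have h2 : (f n : ℝ) ≤ (n : ℝ) ^ (k + 1) + 2 ^ (2 * k) * (4 * (n : ℝ) ^ k) := by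
      exact_mod_cast h1
    have h3 := (hK n).trans (Nat.add_le_add_right (hf' n) _)
    have h4 : (n : ℝ) ^ (k + 1) ≤ f n + K * (n : ℝ) ^ k := by exact_mod_cast h3
    have h5 : 0 ≤ (n : ℝ) ^ k := by positivity
    have h6 : 0 ≤ (K : ℝ) * (n : ℝ) ^ k := by positivity
    have h7 : 0 ≤ (2 : ℝ) ^ (2 * k) * (4 * (n : ℝ) ^ k) := by positivity
    rw [abs_le]
    constructor <;> linarith
  have hsub : ∀ n, (circuitClass LX w n ∩ circuitClass LY w n).card ≤
      (circuitClassStar LX w n ∩ circuitClassStar LY w n).card := fun n => Finset.card_le_card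
    (Finset.inter_subset_inter circuitClass_subset circuitClass_subset)
  exact ⟨key _ hsub fun _ => le_rfl, key _ (fun _ => le_rfl) hsub⟩

theorem compatible_of_diff_sum {LX LY : Link} (hX : IsDiffLink LX) (hY : IsSumLink LY) :
    Compatible LX LY :=
  ⟨hX.propertyB, hY.propertyB, fun _ _ _ hw hw' hne =>
    hasWordLimit_zero hX hY hw hw' fun h => hne h.1⟩

theorem leadsToWigner_of_diff_sum {LX LY : Link} (hX : IsDiffLink LX) (hY : IsSumLink LY) :
    LeadsToWigner LX LY := fun _ hk _ hw =>
  ⟨fun hc => hasWordLimit_one hX hY hw hc,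
    fun hc => hasWordLimit_zero hX hY hw hw fun h => hc (h.2 hk)⟩

/-! ### Catalan words and binary trees -/

theorem IsCatalanString.count_eq_two {l : List ℕ} (hl : IsCatalanString l) :
    ∀ c ∈ l, l.count c = 2 := by
  induction hl with
  | double a => simp
  | insert u v a ha huv ih =>
    intro c hc
    by_cases hca : c = a
    · subst hca
      have h1 : (u ++ v).count c = 0 := List.count_eq_zero.2 ha
      simp [List.count_append] at h1 ⊢
      omega
    · have h1 := ih c (by simp at hc ⊢; tauto)
      have h2 : a ≠ c := fun h => hca h.symm
      simpa [List.count_append, List.count_cons, h2] using h1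

theorem Word.IsCatalan.pairMatched {h : ℕ} {w : Word h} (hw : w.IsCatalan) : w.PairMatched := by
  intro i
  have := hw.count_eq_two (w.letter i) (by simp)
  rw [← this, List.ofFn_eq_map, List.count_eq_countP, List.countP_map, Finset.card_def,
    Finset.filter_val, Finset.val_univ_fin, Multiset.filter_coe, Multiset.coe_card,
    ← List.countP_eq_length_filter]
  exact List.countP_congr (by simp)

theorem IsCatalanString.insert' {u v : List ℕ} {a : ℕ} (ha : a ∉ u ++ v)
    (h : u ++ v = [] ∨ IsCatalanString (u ++ v)) : IsCatalanString (u ++ a :: a :: v) := by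
  rcases h with h | h
  · obtain ⟨rfl, rfl⟩ := List.append_eq_nil_iff.1 h
    exact IsCatalanString.double a
  · exact IsCatalanString.insert u v a ha h

/-- The first-return decomposition, which matches the recursive structure of binary trees. A double
letter inserted at the front yields an empty `q`; inserted elsewhere it falls into `q` or into `r`.
-/
theorem IsCatalanString.exists_decomposition {l : List ℕ} (hl : IsCatalanString l) :
    ∃ b q r, l = b :: (q ++ b :: r) ∧ (q = [] ∨ IsCatalanString q) ∧
      (r = [] ∨ IsCatalanString r) ∧ b ∉ q ∧ b ∉ r ∧ ∀ c ∈ q, c ∉ r := by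
  induction hl with
  | double a => exact ⟨a, [], [], by simp⟩
  | insert u v a ha huv ih =>
    obtain ⟨b, q, r, he, hq, hr, hbq, hbr, hqr⟩ := ih
    obtain _ | ⟨c, u⟩ := u
    · exact ⟨a, [], v, by simp, Or.inl rfl, Or.inr (by simpa using huv), by simp,
        by simpa using ha, by simp⟩
    · rw [List.cons_append, List.cons.injEq] at he
      obtain ⟨rfl, he⟩ := he
      have ha' : a ≠ c ∧ a ∉ q ∧ a ∉ r := by
        rw [List.cons_append, he] at ha
        simp at ha; tauto
      -- The point of insertion lies within or at the end of `q` (including the subcase `x = []`),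
      -- or after the second `c`.
      rcases List.append_eq_append_iff.1 he with ⟨x, rfl, rfl⟩ | ⟨x, rfl, hx⟩
      · refine ⟨c, u ++ a :: a :: x, r, by simp, Or.inr (IsCatalanString.insert' ha'.2.1 hq), hr,
          ?_, hbr, ?_⟩
        · simp at hbq ⊢
          exact ⟨hbq.1, fun h => ha'.1 h.symm, hbq.2⟩
        · intro d hd
          simp at hd
          rcases hd with hd | rfl | hd
          · exact hqr d (by simp [hd])
          · exact ha'.2.2
          · exact hqr d (by simp [hd])
      · obtain _ | ⟨y, x⟩ := x
        · simp at hx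
          subst hx
          refine ⟨c, q ++ a :: a :: [], r, by simp,
            Or.inr (IsCatalanString.insert' (by simpa using ha'.2.1) (by simpa using hq)), hr, ?_,
            hbr, ?_⟩
          · simp
            exact ⟨hbq, fun h => ha'.1 h.symm⟩
          · intro d hd
            simp at hd
            rcases hd with hd | rfl
            · exact hqr d hd
            · exact ha'.2.2
        · simp at hx
          obtain ⟨rfl, rfl⟩ := hx
          refine ⟨c, q, x ++ a :: a :: v, by simp, hq,
            Or.inr (IsCatalanString.insert' ha'.2.2 hr), hbq, ?_, ?_⟩
          · simp at hbr ⊢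
            exact ⟨hbr.1, fun h => ha'.1 h.symm, hbr.2⟩
          · intro d hd hd'
            simp at hd'
            rcases hd' with hd' | rfl | hd'
            · exact hqr d hd (by simp [hd'])
            · exact ha'.2.1 hd
            · exact hqr d hd (by simp [hd'])

/-- The Catalan string with letters `m, m + 1, …` coded by a binary tree. -/
def treeString : BinaryTree Unit → ℕ → List ℕ
  | .nil, _ => []
  | .node _ a b, m => m :: (treeString a (m + 1) ++ m :: treeString b (m + 1 + a.numNodes))

theorem length_treeString (t : BinaryTree Unit) :
    ∀ m, (treeString t m).length = 2 * t.numNodes := by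
  induction t with
  | nil => simp [treeString, BinaryTree.numNodes]
  | node u a b iha ihb =>
    intro m
    simp [treeString, BinaryTree.numNodes, iha, ihb]
    omega

theorem mem_treeString (t : BinaryTree Unit) :
    ∀ m c, c ∈ treeString t m ↔ m ≤ c ∧ c < m + t.numNodes := by
  induction t with
  | nil => intro m c; simp [treeString, BinaryTree.numNodes]
  | node u a b iha ihb =>
    intro m c
    simp [treeString, BinaryTree.numNodes, iha, ihb]
    omega

theorem isCatalanString_treeString (t : BinaryTree Unit) :
    ∀ m, treeString t m = [] ∨ IsCatalanString (treeString t m) := by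
  induction t with
  | nil => intro m; exact Or.inl rfl
  | node u a b iha ihb =>
    intro m
    right
    have ha : m ∉ treeString a (m + 1) := by rw [mem_treeString]; omega
    have h1 : IsCatalanString (m :: (treeString a (m + 1) ++ [m])) := by
      rcases iha (m + 1) with h | h
      · rw [h]; exact IsCatalanString.double m
      · exact h.nest ha
    simp only [treeString]
    rcases ihb (m + 1 + a.numNodes) with h | h
    · rw [h]; exact h1
    · have := h1.append h (by
        intro c hc
        simp [mem_treeString] at hc ⊢
        omega)
      simpa using this

/-- The letter `m` does not occur in the string of the left subtree, so its second occurrence marks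
where that string ends. -/
theorem treeString_injective (t : BinaryTree Unit) :
    ∀ t' m, treeString t m = treeString t' m → t = t' := by
  induction t with
  | nil =>
    intro t' m h
    cases t' with
    | nil => rfl
    | node _ _ _ => simp [treeString] at h
  | node u a b iha ihb =>
    intro t' m h
    cases t' with
    | nil => simp [treeString] at h
    | node u' a' b' =>
      simp only [treeString, List.cons.injEq, true_and] at h
      have ha : m ∉ treeString a (m + 1) := by rw [mem_treeString]; omega
      have ha' : m ∉ treeString a' (m + 1) := by rw [mem_treeString]; omega
      have h1 : treeString a (m + 1) = treeString a' (m + 1) := by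
        rcases List.append_eq_append_iff.1 h with ⟨x, e1, e2⟩ | ⟨x, e1, e2⟩
        · obtain _ | ⟨y, x⟩ := x
          · simpa using e1.symm
          · simp at e2
            exact absurd (by rw [e1, ← e2.1]; simp) ha'
        · obtain _ | ⟨y, x⟩ := x
          · simpa using e1
          · simp at e2
            exact absurd (by rw [e1, ← e2.1]; simp) ha
      rw [h1] at h
      have h2 := iha a' (m + 1) h1
      subst h2
      simp at h
      rw [ihb b' _ h]

/-- Letters of `l` that are at least `M` first occur in increasing order, without gaps. -/
def IsOrderedFrom (M : ℕ) (l : List ℕ) : Prop :=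
  ∀ p c s, l = p ++ c :: s → ∀ b < c, b < M ∨ b ∈ p

theorem IsOrderedFrom.cons {M c : ℕ} {l : List ℕ} (hl : IsOrderedFrom M l) (hc : c ≤ M) :
    IsOrderedFrom M (c :: l) := by
  intro p d s h b hb
  obtain _ | ⟨e, p⟩ := p
  · simp at h; omega
  · simp at h
    rcases hl p d s h.2 b hb with h1 | h1 <;> simp [h1]

theorem IsOrderedFrom.cons_self {M : ℕ} {l : List ℕ} (hl : IsOrderedFrom (M + 1) l) :
    IsOrderedFrom M (M :: l) := by
  intro p d s h b hb
  obtain _ | ⟨e, p⟩ := p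
  · simp at h; omega
  · simp at h
    rcases hl p d s h.2 b hb with h1 | h1
    · simp [← h.1]; omega
    · simp [h1]

theorem IsOrderedFrom.append {M M' : ℕ} {l r : List ℕ} (hl : IsOrderedFrom M l)
    (hr : IsOrderedFrom M' r) (h : ∀ b < M', b < M ∨ b ∈ l) : IsOrderedFrom M (l ++ r) := by
  intro p c s he b hb
  rcases List.append_eq_append_iff.1 he with ⟨x, rfl, rfl⟩ | ⟨x, rfl, hx⟩
  · rcases hr x c s rfl b hb with h1 | h1
    · rcases h b h1 with h2 | h2 <;> simp [h2]
    · simp [h1]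
  · obtain _ | ⟨y, x⟩ := x
    · simp at hx
      rcases hr [] c s (by simp [hx]) b hb with h1 | h1
      · simpa using h b h1
      · simp at h1
    · simp at hx
      exact hl p c x (by rw [hx.1]) b hb

theorem isOrderedFrom_treeString (t : BinaryTree Unit) :
    ∀ m, IsOrderedFrom m (treeString t m) := by
  induction t with
  | nil => intro m p c s h; simp [treeString] at h
  | node u a b iha ihb =>
    intro m
    refine IsOrderedFrom.cons_self ((iha (m + 1)).append ((ihb _).cons (by omega)) ?_)
    intro c hc
    rw [mem_treeString]
    omega

/-- The alphabetical order forces the first letter to be `m`. By induction the letters of `q` then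
fill an interval starting at `m + 1`, so those of `r` start right after it, as the coding by trees
requires. -/
theorem exists_treeString : ∀ (N : ℕ) (l : List ℕ), l.length = N →
    (l = [] ∨ IsCatalanString l) → ∀ m, (∀ c ∈ l, m ≤ c) → IsOrderedFrom m l →
    ∃ t, l = treeString t m := by
  intro N
  induction N using Nat.strong_induction_on with
  | _ N ih =>
    intro l hN hl m hm ho
    rcases hl with rfl | hl
    · exact ⟨.nil, rfl⟩
    obtain ⟨a, q, r, rfl, hq, hr, haq, har, hqr⟩ := hl.exists_decomposition
    have ham : a = m := by
      have h1 := hm a (by simp)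
      by_contra hne
      have := ho [] a _ rfl m (by omega)
      simp at this
    subst ham
    simp at hN
    obtain ⟨t, ht⟩ := ih q.length (by omega) q rfl hq (a + 1)
      (fun c hc => by
        have h1 := hm c (by simp [hc])
        have h2 : c ≠ a := fun h => haq (h ▸ hc)
        omega)
      (fun p c s h b hb => by
        have := ho (a :: p) c (s ++ a :: r) (by simp [h]) b hb
        simp at this
        rcases this with h1 | h1 | h1
        · omega
        · exact Or.inl (by omega)
        · exact Or.inr h1)
    have hmem : ∀ c, c ∈ q ↔ a + 1 ≤ c ∧ c < a + 1 + t.numNodes := by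
      intro c; rw [ht, mem_treeString]
    obtain ⟨t', ht'⟩ := ih r.length (by omega) r rfl hr (a + 1 + t.numNodes)
      (fun c hc => by
        have h1 := hm c (by simp [hc])
        have h2 : c ≠ a := fun h => har (h ▸ hc)
        have h3 : c ∉ q := fun h => hqr c h hc
        rw [hmem] at h3
        omega)
      (fun p c s h b hb => by
        have := ho (a :: (q ++ a :: p)) c s (by simp [h]) b hb
        simp [hmem] at this
        rcases this with h1 | h1 | h1 | h1 | h1
        · exact Or.inl (by omega)
        · exact Or.inl (by omega)
        · exact Or.inl (by omega)
        · exact Or.inl (by omega)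
        · exact Or.inr h1)
    exact ⟨.node () t t', by rw [treeString, ← ht, ← ht']⟩

/-- The word spelled by a list. -/
def wordOfList {h : ℕ} (l : List ℕ) (hl : l.length = h) (ho : IsOrderedFrom 0 l) : Word h where
  letter i := l[(i : ℕ)]
  ordered i m hm := by
    have h1 := ho (l.take i) l[(i : ℕ)] (l.drop (i + 1)) (by simp) m hm
    rcases h1 with h1 | h1
    · omega
    · obtain ⟨j, hj, he⟩ := List.mem_iff_getElem.1 h1
      simp at hj
      refine ⟨⟨j, by omega⟩, ?_, ?_⟩
      · rw [Fin.lt_def]; simp; omega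
      · simpa using he

theorem ofFn_wordOfList {h : ℕ} (l : List ℕ) (hl : l.length = h) (ho : IsOrderedFrom 0 l) :
    List.ofFn (wordOfList l hl ho).letter = l := by
  subst hl
  simp [wordOfList]

theorem Word.isOrderedFrom {h : ℕ} (w : Word h) : IsOrderedFrom 0 (List.ofFn w.letter) := by
  intro p c s he b hb
  right
  have hlen := congrArg List.length he
  simp at hlen
  have hget : ∀ m (hm : m < h), (p ++ c :: s)[m]? = some (w.letter ⟨m, hm⟩) := by
    intro m hm
    rw [← he]
    simp [hm]
  have h1 := hget p.length (by omega)
  simp at h1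
  obtain ⟨j, hj, hb'⟩ := w.ordered ⟨p.length, by omega⟩ b (by omega)
  have hj' : (j : ℕ) < p.length := hj
  have h2 := hget j j.isLt
  rw [List.getElem?_append_left hj', hb'] at h2
  exact List.mem_of_getElem? h2

/-- Catalan words correspond to binary trees with `k` nodes through `treeString`. The case `k = 0`
is excluded because the empty tree codes the empty string, which is not Catalan. -/
theorem card_isCatalan {k : ℕ} (hk : 1 ≤ k) :
    Nat.card {w : Word (2 * k) // w.IsCatalan} = catalan k := by
  rw [← BinaryTree.treesOfNumNodesEq_card_eq_catalan, ← Nat.card_eq_finsetCard]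
  symm
  have hlen : ∀ t : BinaryTree.treesOfNumNodesEq k, (treeString t.1 0).length = 2 * k := fun t => by
    rw [length_treeString, BinaryTree.mem_treesOfNumNodesEq.1 t.2]
  refine Nat.card_eq_of_bijective (fun t => ⟨wordOfList (treeString t.1 0) (hlen t)
    (isOrderedFrom_treeString t.1 0), ?_⟩) ⟨?_, ?_⟩
  · rw [Word.IsCatalan, ofFn_wordOfList]
    refine (isCatalanString_treeString t.1 0).resolve_left fun h => ?_
    have := hlen t
    rw [h] at this
    simp at this
    omega
  · intro t t' h
    have h1 := congrArg (fun w => List.ofFn w.1.letter) h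
    simp only [ofFn_wordOfList] at h1
    exact Subtype.ext (treeString_injective _ _ _ h1)
  · rintro ⟨w, hw⟩
    obtain ⟨t, ht⟩ := exists_treeString _ _ rfl (Or.inr hw) 0 (by simp) w.isOrderedFrom
    have hk' : t.numNodes = k := by
      have := congrArg List.length ht
      rw [length_treeString] at this
      simp at this
      omega
    refine ⟨⟨t, BinaryTree.mem_treesOfNumNodesEq.2 hk'⟩, Subtype.ext ?_⟩
    ext i
    have h1 := ofFn_wordOfList (treeString t 0) (by rw [length_treeString, hk'])
      (isOrderedFrom_treeString t 0)
    replace h1 := h1.trans ht.symm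
    exact congrFun (List.ofFn_injective h1) i

/-- Every function has a word with the same coincidences. -/
theorem exists_word {h : ℕ} (e : Fin h → ℕ) :
    ∃ w : Word h, ∀ i j, w.letter i = w.letter j ↔ e i = e j := by
  induction h with
  | zero => exact ⟨⟨Fin.elim0, fun i => i.elim0⟩, fun i => i.elim0⟩
  | succ h ih =>
    obtain ⟨w, hw⟩ := ih (e ∘ Fin.castSucc)
    by_cases hex : ∃ i : Fin h, e i.castSucc = e (Fin.last h)
    · obtain ⟨i₀, hi₀⟩ := hex
      refine ⟨⟨Fin.snoc (α := fun _ => ℕ) w.letter (w.letter i₀), ?_⟩, ?_⟩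
      · intro i
        refine Fin.lastCases ?_ (fun i => ?_) i
        · intro m hm
          rw [Fin.snoc_last] at hm
          obtain ⟨j, -, hj⟩ := w.ordered i₀ m hm
          exact ⟨j.castSucc, Fin.castSucc_lt_last j, by rw [Fin.snoc_castSucc]; exact hj⟩
        · intro m hm
          rw [Fin.snoc_castSucc] at hm
          obtain ⟨j, hj', hj⟩ := w.ordered i m hm
          exact ⟨j.castSucc, by simpa using hj', by rw [Fin.snoc_castSucc]; exact hj⟩
      · intro i j
        refine Fin.lastCases ?_ (fun i => ?_) i <;> refine Fin.lastCases ?_ (fun j => ?_) j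
        · simp
        · simp only [Fin.snoc_last, Fin.snoc_castSucc]
          rw [hw, ← hi₀]; rfl
        · simp only [Fin.snoc_last, Fin.snoc_castSucc]
          rw [hw, ← hi₀]; rfl
        · simp only [Fin.snoc_castSucc]
          rw [hw]; rfl
    · push Not at hex
      have hfresh : ∃ m, ∀ i, w.letter i ≠ m := by
        obtain ⟨m, hm⟩ := Infinite.exists_notMem_finset (Finset.univ.image w.letter)
        exact ⟨m, by simpa using hm⟩
      classical
      -- A new letter has to be the least unused one, so that all smaller letters have already
      -- occurred.
      refine ⟨⟨Fin.snoc (α := fun _ => ℕ) w.letter (Nat.find hfresh), ?_⟩, ?_⟩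
      · intro i
        refine Fin.lastCases ?_ (fun i => ?_) i
        · intro m hm
          rw [Fin.snoc_last] at hm
          have := Nat.find_min hfresh hm
          push Not at this
          obtain ⟨j, hj⟩ := this
          exact ⟨j.castSucc, Fin.castSucc_lt_last j, by rw [Fin.snoc_castSucc]; exact hj⟩
        · intro m hm
          rw [Fin.snoc_castSucc] at hm
          obtain ⟨j, hj', hj⟩ := w.ordered i m hm
          exact ⟨j.castSucc, by simpa using hj', by rw [Fin.snoc_castSucc]; exact hj⟩
      · have hspec := Nat.find_spec hfresh
        intro i j
        refine Fin.lastCases ?_ (fun i => ?_) i <;> refine Fin.lastCases ?_ (fun j => ?_) j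
        · simp
        · simp only [Fin.snoc_last, Fin.snoc_castSucc]
          exact iff_of_false (hspec j).symm (hex j).symm
        · simp only [Fin.snoc_last, Fin.snoc_castSucc]
          exact iff_of_false (hspec i) (hex i)
        · simp only [Fin.snoc_castSucc]
          rw [hw]; rfl

instance finite_word (h : ℕ) : Finite (Word h) := by
  let f : Word h → Set (Fin h × Fin h) := fun w => {q | w.letter q.1 = w.letter q.2}
  refine Finite.of_injective f fun w w' hww => Word.eq_of_pattern fun i j => ?_
  have := Set.ext_iff.1 hww (i, j)
  exact this

/-! ### The semicircular law -/

theorem integral_sin_pow_eq_zero (k : ℕ) :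
    ∫ x in (-(Real.pi / 2))..(Real.pi / 2), Real.sin x ^ (2 * k + 1) = 0 := by
  induction k with
  | zero => simp [integral_sin]
  | succ k ih =>
    rw [show 2 * (k + 1) + 1 = 2 * k + 1 + 2 by ring, integral_sin_pow, ih]
    simp

theorem integral_sin_pow_eq_centralBinom (k : ℕ) :
    ∫ x in (-(Real.pi / 2))..(Real.pi / 2), Real.sin x ^ (2 * k) =
      Real.pi * k.centralBinom / 4 ^ k := by
  induction k with
  | zero => simp
  | succ k ih =>
    rw [show 2 * (k + 1) = 2 * k + 2 by ring, integral_sin_pow, ih]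
    have h := Nat.succ_mul_centralBinom_succ k
    have h' : ((k : ℝ) + 1) * (k + 1).centralBinom = 2 * (2 * k + 1) * k.centralBinom := by
      exact_mod_cast h
    simp only [Real.cos_neg, Real.cos_pi_div_two, mul_zero, sub_zero, zero_div, zero_add]
    have hk : (k : ℝ) + 1 ≠ 0 := by positivity
    push_cast
    field_simp
    linear_combination (-2 * 4 ^ k) * h'

/-- Substitute `x = 2 sin θ`: the root becomes `2 cos θ`, a second cosine comes from `dx`, and `cos²
= 1 - sin²`. -/
theorem intervalIntegral_semicircle (n : ℕ) :
    ∫ x in (-2 : ℝ)..2, x ^ n * (Real.sqrt (4 - x ^ 2) / (2 * Real.pi)) =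
      2 ^ n * (2 / Real.pi) * ((∫ x in (-(Real.pi / 2))..(Real.pi / 2), Real.sin x ^ n) -
        ∫ x in (-(Real.pi / 2))..(Real.pi / 2), Real.sin x ^ (n + 2)) := by
  have h := intervalIntegral.integral_comp_mul_deriv (a := -(Real.pi / 2)) (b := Real.pi / 2)
    (f := fun x => 2 * Real.sin x) (f' := fun x => 2 * Real.cos x)
    (g := fun x : ℝ => x ^ n * (Real.sqrt (4 - x ^ 2) / (2 * Real.pi)))
    (fun x _ => (Real.hasDerivAt_sin x).const_mul 2) (by fun_prop) (by fun_prop)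
  simp only [Real.sin_neg, Real.sin_pi_div_two, mul_neg, mul_one] at h
  rw [← h, ← intervalIntegral.integral_sub (by apply Continuous.intervalIntegrable; fun_prop)
    (by apply Continuous.intervalIntegrable; fun_prop), ← intervalIntegral.integral_const_mul]
  apply intervalIntegral.integral_congr
  intro x hx
  rw [Set.uIcc_of_le (by linarith [Real.pi_pos])] at hx
  have hc : 0 ≤ Real.cos x := Real.cos_nonneg_of_mem_Icc hx
  have hs : Real.sqrt (4 - (2 * Real.sin x) ^ 2) = 2 * Real.cos x := by
    rw [Real.sqrt_eq_iff_mul_self_eq (by nlinarith [Real.sin_sq_le_one x]) (by positivity)]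
    nlinarith [Real.sin_sq_add_cos_sq x]
  have hp := Real.pi_ne_zero
  simp only [Function.comp, hs]
  field_simp
  have : Real.cos x ^ 2 = 1 - Real.sin x ^ 2 := by linarith [Real.sin_sq_add_cos_sq x]
  rw [pow_add, this, mul_pow]
  ring

/-- The moments of the standard semicircular law. -/
def semicircleMoment (h : ℕ) : ℝ := if Even h then (catalan (h / 2) : ℝ) else 0

theorem intervalIntegral_semicircle_eq_moment (n : ℕ) :
    ∫ x in (-2 : ℝ)..2, x ^ n * (Real.sqrt (4 - x ^ 2) / (2 * Real.pi)) = semicircleMoment n := by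
  rw [intervalIntegral_semicircle]
  rcases Nat.even_or_odd' n with ⟨k, rfl | rfl⟩
  · rw [show 2 * k + 2 = 2 * (k + 1) by ring, integral_sin_pow_eq_centralBinom,
      integral_sin_pow_eq_centralBinom, semicircleMoment, if_pos (by simp),
      Nat.mul_div_cancel_left _ (by norm_num)]
    have h' : ((k : ℝ) + 1) * (k + 1).centralBinom = 2 * (2 * k + 1) * k.centralBinom := by
      exact_mod_cast Nat.succ_mul_centralBinom_succ k
    have h2 : ((k : ℝ) + 1) * catalan k = k.centralBinom := by
      exact_mod_cast succ_mul_catalan_eq_centralBinom k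
    have hp := Real.pi_ne_zero
    have hk : (k : ℝ) + 1 ≠ 0 := by positivity
    rw [pow_mul, pow_succ]
    norm_num
    field_simp
    have h3 : (catalan k : ℝ) = k.centralBinom / (k + 1) := by
      rw [eq_div_iff hk]; linarith
    have h4 : ((k + 1).centralBinom : ℝ) = 2 * (2 * k + 1) * k.centralBinom / (k + 1) := by
      rw [eq_div_iff hk]; linarith
    rw [h3, h4]
    field_simp
    ring
  · rw [show 2 * k + 1 + 2 = 2 * (k + 1) + 1 by ring, integral_sin_pow_eq_zero,
      integral_sin_pow_eq_zero, semicircleMoment, if_neg (by simp)]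
    simp

theorem integral_semicircleLaw (f : ℝ → ℝ) :
    ∫ x, f x ∂semicircleLaw =
      ∫ x in (-2 : ℝ)..2, f x * (Real.sqrt (4 - x ^ 2) / (2 * Real.pi)) := by
  have hm : Measurable fun x : ℝ => Real.sqrt (4 - x ^ 2) / (2 * Real.pi) := by fun_prop
  have hnn : ∀ x : ℝ, 0 ≤ Real.sqrt (4 - x ^ 2) / (2 * Real.pi) := fun x => by positivity
  rw [semicircleLaw, integral_withDensity_eq_integral_toReal_smul (by fun_prop)
    (Eventually.of_forall fun x => ENNReal.ofReal_lt_top)]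
  rw [intervalIntegral.integral_of_le (by norm_num), ← integral_Icc_eq_integral_Ioc,
    ← integral_indicator measurableSet_Icc]
  congr 1
  funext x
  rw [ENNReal.toReal_ofReal (hnn x), smul_eq_mul, mul_comm]
  by_cases hx : x ∈ Set.Icc (-2 : ℝ) 2
  · rw [Set.indicator_of_mem hx]
  · rw [Set.indicator_of_notMem hx]
    have : Real.sqrt (4 - x ^ 2) = 0 := by
      apply Real.sqrt_eq_zero_of_nonpos
      rw [Set.mem_Icc, not_and_or, not_le, not_le] at hx
      rcases hx with h | h <;> nlinarith
    simp [this]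

theorem integral_pow_semicircleLaw (n : ℕ) :
    ∫ x, x ^ n ∂semicircleLaw = semicircleMoment n := by
  rw [integral_semicircleLaw, intervalIntegral_semicircle_eq_moment]

/-- The total mass is the zeroth moment, `catalan 0 = 1`. -/
instance isProbabilityMeasure_semicircleLaw : IsProbabilityMeasure semicircleLaw := by
  constructor
  have h := integral_pow_semicircleLaw 0
  simp only [pow_zero, integral_const, smul_eq_mul, mul_one, semicircleMoment] at h
  simp [Measure.real] at h
  rw [ENNReal.toReal_eq_one_iff] at h
  exact h

theorem ae_semicircleLaw : ∀ᵐ x ∂semicircleLaw, |x| ≤ 2 := by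
  rw [semicircleLaw, ae_withDensity_iff (by fun_prop)]
  refine Eventually.of_forall fun x hx => ?_
  by_contra hx2
  apply hx
  rw [not_le] at hx2
  have : Real.sqrt (4 - x ^ 2) = 0 := by
    apply Real.sqrt_eq_zero_of_nonpos
    rw [← sq_abs]
    nlinarith
  simp [this]

theorem semicircleLaw_singleton (t : ℝ) : semicircleLaw {t} = 0 :=
  withDensity_absolutelyContinuous _ _ (by simp)

theorem integrable_semicircleLaw {f : ℝ → ℝ} (hf : Continuous f) : Integrable f semicircleLaw := by
  obtain ⟨C, hC⟩ := (isCompact_Icc (a := (-2 : ℝ)) (b := 2)).exists_bound_of_continuousOn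
    hf.continuousOn
  refine Integrable.of_bound hf.aestronglyMeasurable C ?_
  filter_upwards [ae_semicircleLaw] with x hx
  exact hC x (abs_le.1 hx)

theorem semicircleMoment_two_mul_le (R : ℕ) : semicircleMoment (2 * R) ≤ 4 ^ R := by
  rw [← integral_pow_semicircleLaw]
  calc ∫ x, x ^ (2 * R) ∂semicircleLaw ≤ ∫ x, (4 : ℝ) ^ R ∂semicircleLaw := by
        refine integral_mono_ae (integrable_semicircleLaw (by fun_prop)) (by simp) ?_
        filter_upwards [ae_semicircleLaw] with x hx
        rw [pow_mul]
        apply pow_le_pow_left₀ (sq_nonneg x)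
        rw [← sq_abs]
        nlinarith [abs_nonneg x]
    _ = 4 ^ R := by simp

/-! ### Empirical spectral measures -/

section Spectral

variable {n : ℕ} {A B : Matrix (Fin n) (Fin n) ℝ}

theorem exists_orthogonal_diagonalization (hA : A.IsHermitian) :
    ∃ U : Matrix (Fin n) (Fin n) ℝ, Uᵀ * U = 1 ∧ U * Uᵀ = 1 ∧
      A = U * Matrix.diagonal hA.eigenvalues * Uᵀ := by
  have h1 : (hA.eigenvectorUnitary : Matrix (Fin n) (Fin n) ℝ)ᵀ * hA.eigenvectorUnitary = 1 := by
    have := Unitary.coe_star_mul_self hA.eigenvectorUnitary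
    rwa [Matrix.star_eq_conjTranspose, Matrix.conjTranspose_eq_transpose_of_trivial] at this
  refine ⟨hA.eigenvectorUnitary, h1, mul_eq_one_comm.1 h1, ?_⟩
  have := hA.spectral_theorem
  rw [Unitary.conjStarAlgAut_apply, Matrix.star_eq_conjTranspose,
    Matrix.conjTranspose_eq_transpose_of_trivial] at this
  exact this

theorem trace_pow_eq_sum_eigenvalues (hA : A.IsHermitian) (h : ℕ) :
    (A ^ h).trace = ∑ i, hA.eigenvalues i ^ h := by
  obtain ⟨U, h1, -, h3⟩ := exists_orthogonal_diagonalization hA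
  generalize hA.eigenvalues = d at h3 ⊢
  have hp : A ^ h = U * Matrix.diagonal (d ^ h) * Uᵀ ∨ h = 0 := by
    induction h with
    | zero => exact Or.inr rfl
    | succ m ih =>
      left
      rcases ih with ih | rfl
      · rw [pow_succ, ih, pow_succ]
        conv_lhs => rw [h3]
        calc _ = U * Matrix.diagonal (d ^ m) * (Uᵀ * U) * Matrix.diagonal d * Uᵀ := by
              simp only [Matrix.mul_assoc]
          _ = _ := by
            rw [h1, Matrix.mul_one, Matrix.mul_assoc U, Matrix.diagonal_mul_diagonal]; rfl
      · simpa using h3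
  rcases hp with hp | rfl
  · rw [hp, Matrix.trace_mul_comm, ← Matrix.mul_assoc, h1, Matrix.one_mul, Matrix.trace_diagonal]
    rfl
  · simp

/-- With orthogonal eigenbases `U` and `V`, the squares of the entries of the orthogonal matrix `Uᵀ
V` form a doubly stochastic matrix. Expanding `tr (A - B)²` in these bases gives the identity. It
serves as a Hoffman–Wielandt estimate that needs no ordering of the eigenvalues. -/
theorem exists_coupling (hA : A.IsHermitian) (hB : B.IsHermitian) :
    ∃ s : Fin n → Fin n → ℝ, (∀ i j, 0 ≤ s i j) ∧ (∀ i, ∑ j, s i j = 1) ∧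
      (∀ j, ∑ i, s i j = 1) ∧
      ∑ i, ∑ j, (A i j - B i j) ^ 2 =
        ∑ i, ∑ j, s i j * (hA.eigenvalues i - hB.eigenvalues j) ^ 2 := by
  obtain ⟨U, hU1, hU2, hU⟩ := exists_orthogonal_diagonalization hA
  obtain ⟨V, hV1, hV2, hV⟩ := exists_orthogonal_diagonalization hB
  set D := Matrix.diagonal hA.eigenvalues with hD
  set E := Matrix.diagonal hB.eigenvalues with hE
  set O := Uᵀ * V with hO
  have hOO : O * Oᵀ = 1 := by
    rw [hO, Matrix.transpose_mul, Matrix.transpose_transpose]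
    calc _ = Uᵀ * (V * Vᵀ) * U := by simp only [Matrix.mul_assoc]
      _ = 1 := by rw [hV2, Matrix.mul_one, hU1]
  have hOO' : Oᵀ * O = 1 := mul_eq_one_comm.1 hOO
  have hr : ∀ i, ∑ j, O i j ^ 2 = 1 := by
    intro i
    have := congrFun (congrFun hOO i) i
    simpa [Matrix.mul_apply, sq] using this
  have hc : ∀ j, ∑ i, O i j ^ 2 = 1 := by
    intro j
    have := congrFun (congrFun hOO' j) j
    simpa [Matrix.mul_apply, sq] using this
  refine ⟨fun i j => O i j ^ 2, fun i j => sq_nonneg _, hr, hc, ?_⟩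
  have hfrob : ∑ i, ∑ j, (A i j - B i j) ^ 2 = ((A - B) * (A - B)).trace := by
    simp only [Matrix.trace, Matrix.diag, Matrix.mul_apply]
    refine Finset.sum_congr rfl fun i _ => Finset.sum_congr rfl fun j _ => ?_
    have : (A - B) j i = (A - B) i j := by
      have := (hA.sub hB).apply i j
      simpa using this
    rw [this, Matrix.sub_apply]; ring
  have hAA : (A * A).trace = ∑ i, hA.eigenvalues i ^ 2 := by
    rw [← sq, trace_pow_eq_sum_eigenvalues hA]
  have hBB : (B * B).trace = ∑ i, hB.eigenvalues i ^ 2 := by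
    rw [← sq, trace_pow_eq_sum_eigenvalues hB]
  have hAB : (A * B).trace = ∑ i, ∑ j, hA.eigenvalues i * hB.eigenvalues j * O i j ^ 2 := by
    have h1 : (A * B).trace = (D * O * E * Oᵀ).trace := by
      rw [hO, Matrix.transpose_mul, Matrix.transpose_transpose, hU, hV]
      calc _ = (U * (D * Uᵀ * V * E * Vᵀ)).trace := by simp only [Matrix.mul_assoc]
        _ = ((D * Uᵀ * V * E * Vᵀ) * U).trace := Matrix.trace_mul_comm _ _
        _ = _ := by simp only [Matrix.mul_assoc]
    rw [h1]
    simp only [Matrix.trace, Matrix.diag]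
    refine Finset.sum_congr rfl fun i _ => ?_
    rw [Matrix.mul_apply]
    refine Finset.sum_congr rfl fun j _ => ?_
    rw [hE, Matrix.mul_diagonal, hD, Matrix.diagonal_mul, Matrix.transpose_apply]
    ring
  rw [hfrob, Matrix.sub_mul, Matrix.mul_sub, Matrix.mul_sub, Matrix.trace_sub, Matrix.trace_sub,
    Matrix.trace_sub, Matrix.trace_mul_comm B A, hAA, hBB, hAB]
  have e : ∀ i j, O i j ^ 2 * (hA.eigenvalues i - hB.eigenvalues j) ^ 2 =
      hA.eigenvalues i ^ 2 * O i j ^ 2 - 2 * (hA.eigenvalues i * hB.eigenvalues j * O i j ^ 2) +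
        O i j ^ 2 * hB.eigenvalues j ^ 2 := fun i j => by ring
  simp only [e, Finset.sum_add_distrib, Finset.sum_sub_distrib, ← Finset.mul_sum, hr, mul_one]
  rw [Finset.sum_comm (f := fun i j => O i j ^ 2 * hB.eigenvalues j ^ 2)]
  simp only [← Finset.sum_mul, hc, one_mul]
  ring

theorem integrable_esd [NeZero n] (hA : A.IsHermitian) {f : ℝ → ℝ} : Integrable f (esd hA) := by
  unfold esd
  refine Integrable.smul_measure ?_ (by simp [NeZero.ne n])
  rw [integrable_finsetSum_measure]
  intro i _
  exact integrable_dirac (by simp)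

theorem integral_esd [NeZero n] (hA : A.IsHermitian) (f : ℝ → ℝ) :
    ∫ x, f x ∂(esd hA) = (n : ℝ)⁻¹ * ∑ i, f (hA.eigenvalues i) := by
  unfold esd
  rw [integral_smul_measure, integral_finsetSum_measure]
  · simp
  · intro i _
    exact integrable_dirac (by simp)

instance isProbabilityMeasure_esd [NeZero n] (hA : A.IsHermitian) :
    IsProbabilityMeasure (esd hA) := by
  constructor
  unfold esd
  simp only [Measure.smul_apply, Measure.coe_finsetSum, Finset.sum_apply, measure_univ,
    Finset.sum_const, Finset.card_univ, Fintype.card_fin, smul_eq_mul, nsmul_eq_mul, mul_one]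
  exact ENNReal.inv_mul_cancel (by simp [NeZero.ne n]) (by simp)

/-- Average the Lipschitz bound over the coupling, using `|r| ≤ δ + r² / δ` to pass from distances
to squared distances. -/
theorem abs_integral_esd_sub_le [NeZero n] (hA : A.IsHermitian) (hB : B.IsHermitian) {f : ℝ → ℝ}
    {L δ : ℝ} (hL : 0 ≤ L) (hf : ∀ x y, |f x - f y| ≤ L * |x - y|) (hδ : 0 < δ)
    (hAB : ∑ i, ∑ j, (A i j - B i j) ^ 2 ≤ δ ^ 2 * n) :
    |∫ x, f x ∂(esd hA) - ∫ x, f x ∂(esd hB)| ≤ 2 * L * δ := by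
  obtain ⟨s, hs0, hsr, hsc, hs⟩ := exists_coupling hA hB
  have hn : (0 : ℝ) < n := by exact_mod_cast Nat.pos_of_ne_zero (NeZero.ne n)
  rw [integral_esd, integral_esd, ← mul_sub]
  have e1 : ∑ i, f (hA.eigenvalues i) = ∑ i, ∑ j, s i j * f (hA.eigenvalues i) := by
    simp only [← Finset.sum_mul, hsr, one_mul]
  have e2 : ∑ j, f (hB.eigenvalues j) = ∑ i, ∑ j, s i j * f (hB.eigenvalues j) := by
    rw [Finset.sum_comm]
    simp only [← Finset.sum_mul, hsc, one_mul]
  have key : |∑ i, f (hA.eigenvalues i) - ∑ j, f (hB.eigenvalues j)| ≤ L * (2 * δ * n) := by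
    rw [e1, e2, ← Finset.sum_sub_distrib]
    simp only [← Finset.sum_sub_distrib, ← mul_sub]
    calc _ ≤ ∑ i, ∑ j, s i j * (L * (δ + (hA.eigenvalues i - hB.eigenvalues j) ^ 2 / δ)) := by
          refine (Finset.abs_sum_le_sum_abs _ _).trans (Finset.sum_le_sum fun i _ => ?_)
          refine (Finset.abs_sum_le_sum_abs _ _).trans (Finset.sum_le_sum fun j _ => ?_)
          rw [abs_mul, abs_of_nonneg (hs0 i j)]
          refine mul_le_mul_of_nonneg_left ((hf _ _).trans (mul_le_mul_of_nonneg_left ?_ hL))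
            (hs0 i j)
          rw [← sub_le_iff_le_add', le_div_iff₀ hδ, ← sq_abs (hA.eigenvalues i - hB.eigenvalues j)]
          nlinarith [sq_nonneg (|hA.eigenvalues i - hB.eigenvalues j| - δ),
            abs_nonneg (hA.eigenvalues i - hB.eigenvalues j)]
      _ = L * (δ * n + (∑ i, ∑ j, (A i j - B i j) ^ 2) / δ) := by
          rw [hs]
          have e : ∀ i j, s i j * (L * (δ + (hA.eigenvalues i - hB.eigenvalues j) ^ 2 / δ)) =
              L * (s i j * δ + s i j * (hA.eigenvalues i - hB.eigenvalues j) ^ 2 / δ) :=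
            fun i j => by ring
          simp only [e, ← Finset.mul_sum, Finset.sum_add_distrib, ← Finset.sum_mul, hsr,
            ← Finset.sum_div]
          simp [mul_comm]
      _ ≤ L * (2 * δ * n) := by
          refine mul_le_mul_of_nonneg_left ?_ hL
          have : (∑ i, ∑ j, (A i j - B i j) ^ 2) / δ ≤ δ * n := by
            rw [div_le_iff₀ hδ]; linarith
          linarith
  rw [abs_mul, abs_of_pos (inv_pos.2 hn), inv_mul_le_iff₀ hn]
  linarith

end Spectral

/-! ### The method of moments -/

/-- On `[-3, 3]` a polynomial `p` approximates `f` uniformly. Outside, `|f - p|` is at most `c * (x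
/ 3) ^ (2 * R)`, whose integral tends to at most `c * (4 / 9) ^ R` because the semicircle law lives
on `[-2, 2]`. This is small for large `R`, so no tightness has to be assumed. -/
theorem tendsto_integral_of_moments {μ : ℕ → Measure ℝ} [∀ n, IsProbabilityMeasure (μ n)]
    (hint : ∀ n h, Integrable (fun x : ℝ => x ^ h) (μ n))
    (hμ : ∀ h, Tendsto (fun n => ∫ x, x ^ h ∂(μ n)) atTop (𝓝 (semicircleMoment h)))
    {f : ℝ → ℝ} (hf : Continuous f) {M : ℝ} (hM : ∀ x, |f x| ≤ M) :
    Tendsto (fun n => ∫ x, f x ∂(μ n)) atTop (𝓝 (∫ x, f x ∂semicircleLaw)) := by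
  rw [Metric.tendsto_atTop']
  intro ε hε
  -- The errors add up to less than `6η`: `3η` from replacing `f` by `p` under `μ n`, `2η` under the
  -- limit law, and `η` from the convergence of the integrals of `p`.
  set η := ε / 7 with hη
  have hη0 : 0 < η := by positivity
  obtain ⟨p, hp⟩ := exists_polynomial_near_of_continuousOn (-3) 3 f hf.continuousOn η hη0
  set c := M + ∑ i ∈ Finset.range (p.natDegree + 1), |p.coeff i| * 3 ^ i with hc
  have hM0 : 0 ≤ M := (abs_nonneg _).trans (hM 0)
  have hc0 : 0 ≤ c := by positivity
  have hbound : ∀ R, p.natDegree ≤ R → ∀ x, |f x - p.eval x| ≤ η + c * (x ^ (2 * R) / 9 ^ R) := by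
    intro R hR x
    have hnn : 0 ≤ c * (x ^ (2 * R) / 9 ^ R) := by
      rw [pow_mul]; positivity
    rcases le_or_gt |x| 3 with hx | hx
    · have := hp x (abs_le.1 hx)
      rw [abs_sub_comm] at this
      linarith
    · have hu : 1 ≤ |x| / 3 := by rw [le_div_iff₀ (by norm_num)]; linarith
      have hpow : x ^ (2 * R) / 9 ^ R = (|x| / 3) ^ (2 * R) := by
        rw [div_pow, pow_mul |x|, sq_abs, ← pow_mul, pow_mul 3]; norm_num
      have h1 : |p.eval x| ≤ (∑ i ∈ Finset.range (p.natDegree + 1), |p.coeff i| * 3 ^ i) *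
          (|x| / 3) ^ (2 * R) := by
        rw [Polynomial.eval_eq_sum_range, Finset.sum_mul]
        refine (Finset.abs_sum_le_sum_abs _ _).trans (Finset.sum_le_sum fun i hi => ?_)
        rw [Finset.mem_range] at hi
        rw [abs_mul, abs_pow, mul_assoc]
        refine mul_le_mul_of_nonneg_left ?_ (abs_nonneg _)
        calc |x| ^ i = 3 ^ i * (|x| / 3) ^ i := by rw [← mul_pow]; congr 1; ring
          _ ≤ 3 ^ i * (|x| / 3) ^ (2 * R) := by
            refine mul_le_mul_of_nonneg_left (pow_le_pow_right₀ hu (by omega)) (by positivity)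
      have h2 : M ≤ M * (|x| / 3) ^ (2 * R) := le_mul_of_one_le_right hM0 (one_le_pow₀ hu)
      rw [hpow]
      calc |f x - p.eval x| ≤ |f x| + |p.eval x| := abs_sub _ _
        _ ≤ c * (|x| / 3) ^ (2 * R) := by rw [hc, add_mul]; linarith [hM x]
        _ ≤ _ := by linarith
  obtain ⟨R₀, hR₀⟩ : ∃ R₀ : ℕ, ∀ R ≥ R₀, c * (4 / 9 : ℝ) ^ R < η := by
    have : Tendsto (fun R : ℕ => c * (4 / 9 : ℝ) ^ R) atTop (𝓝 (c * 0)) :=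
      (tendsto_pow_atTop_nhds_zero_of_lt_one (by norm_num) (by norm_num)).const_mul c
    rw [mul_zero] at this
    exact eventually_atTop.1 (this.eventually_lt_const hη0)
  set R := max R₀ p.natDegree
  have hR1 := hR₀ R (le_max_left _ _)
  have hR2 := hbound R (le_max_right _ _)
  have hcompare : ∀ ν : Measure ℝ, IsProbabilityMeasure ν →
      (∀ h, Integrable (fun x : ℝ => x ^ h) ν) →
      |∫ x, f x ∂ν - ∫ x, p.eval x ∂ν| ≤ η + c * ((∫ x, x ^ (2 * R) ∂ν) / 9 ^ R) := by
    intro ν _ hν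
    have hfi : Integrable f ν := Integrable.of_bound hf.aestronglyMeasurable M
      (Eventually.of_forall fun x => hM x)
    have hpi : Integrable (fun x => p.eval x) ν := by
      simp only [Polynomial.eval_eq_sum_range]
      exact integrable_finsetSum _ fun i _ => (hν i).const_mul _
    have hbi : Integrable (fun x : ℝ => η + c * (x ^ (2 * R) / 9 ^ R)) ν :=
      (integrable_const _).add (((hν _).div_const _).const_mul _)
    rw [← integral_sub hfi hpi]
    refine (abs_integral_le_integral_abs).trans ((integral_mono (hfi.sub hpi).abs hbi hR2).trans ?_)
    rw [integral_add (integrable_const _) (((hν _).div_const _).const_mul _), integral_const_mul,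
      integral_const, probReal_univ, one_smul, integral_div]
  have hpoly : Tendsto (fun n => ∫ x, p.eval x ∂(μ n)) atTop
      (𝓝 (∫ x, p.eval x ∂semicircleLaw)) := by
    simp only [Polynomial.eval_eq_sum_range]
    rw [integral_finsetSum _ fun i _ =>
      (integrable_semicircleLaw (by fun_prop : Continuous fun x : ℝ => p.coeff i * x ^ i))]
    have : ∀ n, ∫ x, ∑ i ∈ Finset.range (p.natDegree + 1), p.coeff i * x ^ i ∂(μ n) =
        ∑ i ∈ Finset.range (p.natDegree + 1), p.coeff i * ∫ x, x ^ i ∂(μ n) := by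
      intro n
      rw [integral_finsetSum _ fun i _ => (hint n i).const_mul _]
      simp only [integral_const_mul]
    simp only [this, integral_const_mul, integral_pow_semicircleLaw]
    exact tendsto_finsetSum _ fun i _ => (hμ i).const_mul _
  have hmom : ∀ᶠ n in atTop, c * ((∫ x, x ^ (2 * R) ∂(μ n)) / 9 ^ R) < 2 * η := by
    have h1 : Tendsto (fun n => c * ((∫ x, x ^ (2 * R) ∂(μ n)) / 9 ^ R)) atTop
        (𝓝 (c * (semicircleMoment (2 * R) / 9 ^ R))) := ((hμ _).div_const _).const_mul _
    refine h1.eventually_lt_const ?_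
    have : c * (semicircleMoment (2 * R) / 9 ^ R) ≤ c * (4 / 9 : ℝ) ^ R := by
      refine mul_le_mul_of_nonneg_left ?_ hc0
      rw [div_pow]
      exact div_le_div_of_nonneg_right (semicircleMoment_two_mul_le R) (by positivity)
    linarith
  have hν := hcompare semicircleLaw inferInstance fun h => integrable_semicircleLaw (by fun_prop)
  have hν2 : c * ((∫ x, x ^ (2 * R) ∂semicircleLaw) / 9 ^ R) ≤ c * (4 / 9 : ℝ) ^ R := by
    refine mul_le_mul_of_nonneg_left ?_ hc0
    rw [div_pow, integral_pow_semicircleLaw]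
    exact div_le_div_of_nonneg_right (semicircleMoment_two_mul_le R) (by positivity)
  have hev : ∀ᶠ n in atTop, dist (∫ x, f x ∂(μ n)) (∫ x, f x ∂semicircleLaw) < ε := by
    filter_upwards [hmom, (Metric.tendsto_nhds.1 hpoly) η hη0] with n h1 h2
    have h3 := hcompare (μ n) inferInstance (hint n)
    rw [Real.dist_eq] at h2 ⊢
    rw [abs_le] at h3 hν
    rw [abs_lt] at h2 ⊢
    constructor <;> linarith [h3.1, h3.2, hν.1, hν.2, h2.1, h2.2]
  obtain ⟨N, hN⟩ := eventually_atTop.1 hev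
  exact ⟨N, fun n hn => hN n hn.le⟩

/-- Hermitian matrices that are approximated, in normalized Frobenius norm, by matrices with
semicircular limiting moments have the semicircular limiting spectral distribution. -/
theorem tendsto_esd_of_approx {A : ∀ n : ℕ, Matrix (Fin n) (Fin n) ℝ}
    (hA : ∀ n, (A n).IsHermitian)
    (H : ∀ δ : ℝ, 0 < δ → ∃ B : ∀ n : ℕ, Matrix (Fin n) (Fin n) ℝ, (∀ n, (B n).IsHermitian) ∧
      (∀ h : ℕ, Tendsto (fun n : ℕ => (n : ℝ)⁻¹ * (B n ^ h).trace) atTop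
        (𝓝 (semicircleMoment h))) ∧
      ∀ᶠ n : ℕ in atTop, ∑ i, ∑ j, (A n i j - B n i j) ^ 2 ≤ δ ^ 2 * n) (t : ℝ) :
    Tendsto (fun n => (esd (hA n)).real (Set.Iic t)) atTop
      (𝓝 (semicircleLaw.real (Set.Iic t))) := by
  -- The empirical measure of the matrix of size 0 is zero, not a probability measure; the shift
  -- avoids it.
  rw [← tendsto_add_atTop_iff_nat 1]
  let μ : ℕ → ProbabilityMeasure ℝ := fun n => ⟨esd (hA (n + 1)), inferInstance⟩
  let ν : ProbabilityMeasure ℝ := ⟨semicircleLaw, inferInstance⟩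
  have hweak : Tendsto μ atTop (𝓝 ν) := by
    rw [tendsto_iff_forall_lipschitz_integral_tendsto]
    rintro f ⟨C, hC⟩ ⟨L, hL⟩
    have hLf : ∀ x y, |f x - f y| ≤ L * |x - y| := fun x y => by
      simpa [Real.dist_eq] using hL.dist_le_mul x y
    have hM : ∀ x, |f x| ≤ |f 0| + C := fun x => by
      have h1 := hC x 0
      rw [Real.dist_eq] at h1
      linarith [abs_sub_abs_le_abs_sub (f x) (f 0)]
    rw [Metric.tendsto_nhds]
    intro ε hε
    set δ := ε / (4 * (L + 1)) with hδ
    have hδ0 : 0 < δ := by positivity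
    obtain ⟨B, hB, hBm, hBA⟩ := H δ hδ0
    have hBf := tendsto_integral_of_moments (μ := fun n => esd (hB (n + 1)))
      (fun n h => integrable_esd _) (fun h => by
        have := (tendsto_add_atTop_iff_nat 1).2 (hBm h)
        refine this.congr fun n => ?_
        rw [integral_esd, trace_pow_eq_sum_eigenvalues (hB (n + 1))]) hL.continuous hM
    filter_upwards [(tendsto_add_atTop_nat 1).eventually hBA, Metric.tendsto_nhds.1 hBf (ε / 2)
      (by positivity)] with n h1 h2
    have h3 := abs_integral_esd_sub_le (hA (n + 1)) (hB (n + 1)) L.2 hLf hδ0 h1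
    have h4 : 2 * (L : ℝ) * δ < ε / 2 := by
      rw [hδ, mul_div_assoc', div_lt_iff₀ (by positivity)]
      have := L.2
      nlinarith
    calc dist (∫ x, f x ∂(esd (hA (n + 1)))) (∫ x, f x ∂semicircleLaw)
        ≤ dist (∫ x, f x ∂(esd (hA (n + 1)))) (∫ x, f x ∂(esd (hB (n + 1)))) +
          dist (∫ x, f x ∂(esd (hB (n + 1)))) (∫ x, f x ∂semicircleLaw) := dist_triangle _ _ _
      _ < ε := by
        rw [Real.dist_eq]
        have := h3.trans_lt h4
        linarith
  have hfr : (ν : Measure ℝ) (frontier (Set.Iic t)) = 0 := by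
    rw [frontier_Iic]; exact semicircleLaw_singleton t
  have := ProbabilityMeasure.tendsto_measure_of_null_frontier_of_tendsto' hweak hfr
  exact (ENNReal.tendsto_toReal (measure_ne_top _ _)).comp this

/-! ### Counting tuples of circuits -/

section Tuples

variable {m h n : ℕ}

/-- The tuples of `m` circuits whose edges with equal labels have equal `L`-values. -/
def labelledTuples {Λ : Type*} [DecidableEq Λ] (L : Link) (lab : Fin m × Fin h → Λ) (n : ℕ) :
    Finset (Fin m → Fin (h + 1) → Fin n) :=
  (Fintype.piFinset fun _ => circuits h n).filter fun q =>
    ∀ a b, lab a = lab b → L.edge (q a.1) a.2 = L.edge (q b.1) b.2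

/-- The position of a vertex on the closed path that starts after the edge `e`. -/
def vertexPos (e : Fin h) (t : Fin (h + 1)) : ℕ :=
  if (t : ℕ) ≤ e then t + (h - e) else t - e - 1

theorem vertexPos_le (e : Fin h) (t : Fin (h + 1)) : vertexPos e t ≤ h := by
  unfold vertexPos; split_ifs <;> omega

theorem vertexPos_castSucc_lt {e i : Fin h} (hi : i ≠ e) :
    vertexPos e i.castSucc < vertexPos e i.succ := by
  have : (i : ℕ) ≠ e := fun hh => hi (Fin.ext hh)
  simp only [vertexPos, Fin.val_castSucc, Fin.val_succ]
  split_ifs <;> omega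

theorem vertexPos_succ_injective {e i j : Fin h}
    (hij : vertexPos e i.succ = vertexPos e j.succ) : i = j := by
  simp only [vertexPos, Fin.val_succ] at hij
  apply Fin.ext
  split_ifs at hij <;> omega

/-- The time at which the edge `i` is completed, on the closed path that ends with the edge `e`. -/
def edgePos (e i : Fin h) : ℕ := if i = e then h + 1 else vertexPos e i.succ

theorem edgePos_le (e i : Fin h) : edgePos e i ≤ h + 1 := by
  unfold edgePos
  split_ifs
  · exact le_rfl
  · exact (vertexPos_le _ _).trans (Nat.le_succ _)

theorem edgePos_injective {e i j : Fin h} (hij : edgePos e i = edgePos e j) : i = j := by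
  unfold edgePos at hij
  have h1 := vertexPos_le e i.succ
  have h2 := vertexPos_le e j.succ
  split_ifs at hij with h3 h4 h5
  · rw [h3, h4]
  · omega
  · omega
  · exact vertexPos_succ_injective hij

theorem lex_lt {a b x y N : ℕ} (hx : x < N) (hab : a < b) : a * N + x < b * N + y := by
  have : (a + 1) * N ≤ b * N := Nat.mul_le_mul_right _ hab
  rw [add_mul, one_mul] at this
  omega

variable {Λ : Type*} [DecidableEq Λ]

/-- The circuits whose closing edge has a label that occurs nowhere else, up to that circuit. -/
def savers (lab : Fin m × Fin h → Λ) (e : Fin m → Fin h) (ρ : Fin m → ℕ) : Finset (Fin m) :=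
  Finset.univ.filter fun c => ∀ b : Fin m × Fin h, b ≠ (c, e c) → ρ b.1 ≤ ρ c →
    lab b ≠ lab (c, e c)

/-- Reveal the circuits in the order of `ρ`, each along the closed path that starts after its edge
`e c`. Free choices are the `m` starting vertices and one vertex for each label first met at a
non-closing edge; every other vertex has at most `Δ` choices, or equals a known one. When a closing
edge is reached both its ends are known, so a label first met there needs no free vertex: this is
the gain counted by `savers`. -/
theorem card_labelledTuples_le {L : Link} {Δ : ℕ}
    (hΔ : ∀ n t : ℕ, ∀ k ∈ Finset.Icc 1 n,
      ((Finset.Icc 1 n).filter (fun l => L.val n k l = t)).card ≤ Δ)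
    (lab : Fin m × Fin h → Λ) (e : Fin m → Fin h) {ρ : Fin m → ℕ} (hρ : Function.Injective ρ)
    [NeZero n] {N : ℕ}
    (hN : m + (Finset.univ.image lab).card ≤ N + (savers lab e ρ).card) :
    (labelledTuples L lab n).card ≤ (Δ + 1) ^ (m * (h + 1)) * n ^ N := by
  classical
  -- Lexicographic time: first the circuit, then the position in it. The factor `h + 2` exceeds
  -- every position, closing edges at `h + 1` included.
  let T : Fin m × Fin h → ℕ := fun a => ρ a.1 * (h + 2) + edgePos (e a.1) a.2
  have hT : Function.Injective T := by
    rintro ⟨c, i⟩ ⟨c', i'⟩ hh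
    have hcc : c = c' := by
      by_contra hne
      rcases lt_or_gt_of_ne (fun hr => hne (hρ hr)) with hlt | hlt
      · exact absurd hh (lex_lt (Nat.lt_succ_of_le (edgePos_le _ _)) hlt).ne
      · exact absurd hh (lex_lt (Nat.lt_succ_of_le (edgePos_le _ _)) hlt).ne'
    subst hcc
    have : edgePos (e c) i = edgePos (e c) i' := by simpa [T] using hh
    rw [edgePos_injective this]
  let r : Fin m × Fin (h + 1) → ℕ := fun v => ρ v.1 * (h + 2) + vertexPos (e v.1) v.2
  let Fi : Finset (Fin m × Fin h) := Finset.univ.filter fun a =>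
    a.2 ≠ e a.1 ∧ ∀ b, lab b = lab a → T a ≤ T b
  let F : Finset (Fin m × Fin (h + 1)) :=
    (Finset.univ.image fun c => (c, (e c).succ)) ∪ Fi.image fun a => (a.1, a.2.succ)
  have hFi : Fi.card + (savers lab e ρ).card ≤ (Finset.univ.image lab).card := by
    have h1 : Set.InjOn lab (Fi : Set (Fin m × Fin h)) := by
      intro a ha b hb hab
      simp only [Fi, Finset.coe_filter, Finset.mem_univ, true_and] at ha hb
      exact hT (le_antisymm (ha.2 b hab.symm) (hb.2 a hab))
    have h2 : Set.InjOn (fun c => lab (c, e c)) (savers lab e ρ : Set (Fin m)) := by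
      intro c hc c' hc' hcc
      simp only [savers, Finset.coe_filter, Finset.mem_univ, true_and] at hc hc'
      by_contra hne
      rcases le_total (ρ c) (ρ c') with hle | hle
      · exact hc' (c, e c) (fun hh => hne (by simpa using congrArg Prod.fst hh)) hle hcc
      · exact hc (c', e c') (fun hh => hne (by simpa using (congrArg Prod.fst hh).symm)) hle
          hcc.symm
    rw [← Finset.card_image_of_injOn h1, ← Finset.card_image_of_injOn h2,
      ← Finset.card_union_of_disjoint]
    · apply Finset.card_le_card
      intro x hx
      simp only [Finset.mem_union, Finset.mem_image, Finset.mem_univ, true_and] at hx ⊢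
      rcases hx with ⟨a, -, rfl⟩ | ⟨c, -, rfl⟩
      · exact ⟨a, rfl⟩
      · exact ⟨_, rfl⟩
    · rw [Finset.disjoint_left]
      intro x hx hx'
      simp only [Finset.mem_image] at hx hx'
      obtain ⟨a, ha, rfl⟩ := hx
      obtain ⟨c, hc, hca⟩ := hx'
      simp only [Fi, savers, Finset.mem_filter, Finset.mem_univ, true_and] at ha hc
      rcases Nat.lt_or_ge (ρ c) (ρ a.1) with hlt | hge
      · have h3 := ha.2 (c, e c) hca
        have h4 : T (c, e c) < T a := lex_lt (Nat.lt_succ_of_le (edgePos_le _ _)) hlt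
        omega
      · refine hc a ?_ hge hca.symm
        rintro rfl
        exact ha.1 rfl
  have hF : F.card ≤ N := by
    have h1 : F.card ≤ m + Fi.card := by
      refine (Finset.card_union_le _ _).trans (add_le_add ?_ Finset.card_image_le)
      exact Finset.card_image_le.trans (by simp)
    omega
  let S : Finset (Fin m × Fin (h + 1) → Fin n) :=
    (labelledTuples L lab n).image fun q v => q v.1 v.2
  have hS : (labelledTuples L lab n).card = S.card := by
    refine (Finset.card_image_of_injective _ ?_).symm
    intro q q' hq
    funext c t
    exact congrFun hq (c, t)
  have hmem : ∀ f ∈ S, (∀ c, f (c, 0) = f (c, Fin.last h)) ∧ ∀ a b : Fin m × Fin h,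
      lab a = lab b → L.val n (f (a.1, a.2.castSucc) + 1) (f (a.1, a.2.succ) + 1) =
        L.val n (f (b.1, b.2.castSucc) + 1) (f (b.1, b.2.succ) + 1) := by
    intro f hf
    simp only [S, Finset.mem_image, labelledTuples, Finset.mem_filter, Fintype.mem_piFinset,
      circuits, Finset.mem_univ, true_and] at hf
    obtain ⟨q, ⟨hc, hl⟩, rfl⟩ := hf
    exact ⟨hc, hl⟩
  rw [hS]
  -- `Δ + 1` rather than `Δ`: it covers the single choice at vertex 0, and being at least 1 it lets
  -- the exponent be enlarged at the end.
  have main := card_le_of_determined r F (Δ + 1) S (by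
    rintro ⟨c, t⟩ hv f hf
    obtain ⟨hf1, hf2⟩ := hmem f hf
    -- Vertex 0 comes immediately after vertex `h` on the rotated path and is equal to it.
    rcases Fin.eq_zero_or_eq_succ t with rfl | ⟨i, rfl⟩
    · refine le_trans (Finset.card_le_card (t := {f (c, Fin.last h)}) ?_) (by simp)
      intro y hy
      simp only [Finset.mem_image, Finset.mem_filter] at hy
      obtain ⟨g, ⟨hg, hgf⟩, rfl⟩ := hy
      rw [Finset.mem_singleton, (hmem g hg).1 c]
      apply hgf
      have := (e c).isLt
      have h1 : ¬ h ≤ e c := by omega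
      simp only [r, vertexPos, Fin.val_last, Fin.val_zero, h1, if_false, Nat.zero_le, if_true]
      omega
    · have hie : i ≠ e c := by
        rintro rfl
        exact hv (by simp [F])
      have hnf : ∃ b, lab b = lab (c, i) ∧ T b < T (c, i) := by
        by_contra hcon
        push Not at hcon
        apply hv
        simp only [F, Finset.mem_union, Finset.mem_image]
        refine Or.inr ⟨(c, i), ?_, rfl⟩
        simp only [Fi, Finset.mem_filter, Finset.mem_univ, true_and]
        exact ⟨hie, hcon⟩
      obtain ⟨b, hbl, hbT⟩ := hnf
      have hTv : T (c, i) = r (c, i.succ) := by simp [T, r, edgePos, hie]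
      have hb2 : r (b.1, b.2.castSucc) < r (c, i.succ) ∧ r (b.1, b.2.succ) < r (c, i.succ) := by
        rw [← hTv]
        by_cases hbe : b.2 = e b.1
        · have hlt : ρ b.1 < ρ c := by
            by_contra hge
            rcases eq_or_lt_of_le (not_lt.1 hge) with he | hlt
            · have hcb := hρ he
              have h1 := vertexPos_le (e c) i.succ
              simp only [T, edgePos, hbe, hie, if_true, if_false, ← hcb] at hbT
              omega
            · have : T (c, i) < T b := lex_lt (Nat.lt_succ_of_le (edgePos_le _ _)) hlt
              omega
          exact ⟨lex_lt (Nat.lt_succ_of_le ((vertexPos_le _ _).trans (Nat.le_succ _))) hlt,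
            lex_lt (Nat.lt_succ_of_le ((vertexPos_le _ _).trans (Nat.le_succ _))) hlt⟩
        · have h1 : T b = r (b.1, b.2.succ) := by simp [T, r, edgePos, hbe]
          have h2 : r (b.1, b.2.castSucc) < r (b.1, b.2.succ) := by
            have := vertexPos_castSucc_lt hbe
            simp only [r]
            omega
          omega
      refine le_trans (Finset.card_le_card ?_) ((card_fin_val_eq_le hΔ (f (c, i.castSucc))
        (L.val n (f (b.1, b.2.castSucc) + 1) (f (b.1, b.2.succ) + 1))).trans (Nat.le_succ _))
      intro y hy
      simp only [Finset.mem_image, Finset.mem_filter] at hy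
      obtain ⟨g, ⟨hg, hgf⟩, rfl⟩ := hy
      simp only [Finset.mem_filter, Finset.mem_univ, true_and]
      have h1 := (hmem g hg).2 (c, i) b hbl.symm
      have h2 : r (c, i.castSucc) < r (c, i.succ) := by
        have := vertexPos_castSucc_lt hie
        simp only [r]
        omega
      rwa [hgf _ h2, hgf _ hb2.1, hgf _ hb2.2] at h1)
  rw [Fintype.card_fin] at main
  refine main.trans ?_
  rw [mul_comm]
  refine Nat.mul_le_mul (Nat.pow_le_pow_right (by omega) ?_)
    (Nat.pow_le_pow_right (Nat.pos_of_ne_zero (NeZero.ne n)) hF)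
  exact (Finset.card_le_univ _).trans (by simp)

/-- The tuples of circuits whose patterns of coincidences of `L`-values have the property `Good`
are few if those with any given such pattern are few. -/
theorem card_le_of_patterns {L : Link} {Good : (Fin m × Fin h → Fin m × Fin h) → Prop} {X : ℕ}
    (hX : ∀ lab, Good lab → (labelledTuples L lab n).card ≤ X)
    (G : Finset (Fin m → Fin (h + 1) → Fin n))
    (hG : ∀ q ∈ G, (∀ c, q c ∈ circuits h n) ∧ ∀ lab : Fin m × Fin h → Fin m × Fin h,
      (∀ a b, lab a = lab b ↔ L.edge (q a.1) a.2 = L.edge (q b.1) b.2) → Good lab) :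
    G.card ≤ (m * h) ^ (m * h) * X := by
  classical
  have hex : ∀ E : Fin m × Fin h → ℕ, ∃ lab : Fin m × Fin h → Fin m × Fin h,
      ∀ a b, lab a = lab b ↔ E a = E b := by
    intro E
    -- The label of an edge is a chosen edge with the same `L`-value. Labels are thus edges, and
    -- there are only `(m * h) ^ (m * h)` labellings.
    let s : ℕ → Fin m × Fin h → Fin m × Fin h := fun t a =>
      if hh : ∃ b, E b = t then hh.choose else a
    refine ⟨fun a => s (E a) a, fun a b => ?_⟩
    have hs : ∀ a, E (s (E a) a) = E a := fun a => by
      have hh : ∃ b, E b = E a := ⟨a, rfl⟩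
      simp only [s, hh, dif_pos]
      exact hh.choose_spec
    constructor
    · intro hab
      have hab' : s (E a) a = s (E b) b := hab
      rw [← hs a, ← hs b, hab']
    · intro hab
      have hh : ∃ c, E c = E b := ⟨b, rfl⟩
      simp only [s, hab, hh, dif_pos]
  have hsub : G ⊆ (Finset.univ.filter Good).biUnion fun lab => labelledTuples L lab n := by
    intro q hq
    obtain ⟨hq1, hq2⟩ := hG q hq
    obtain ⟨lab, hlab⟩ := hex fun a => L.edge (q a.1) a.2
    simp only [Finset.mem_biUnion, Finset.mem_filter, Finset.mem_univ, true_and]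
    refine ⟨lab, hq2 lab hlab, ?_⟩
    simp only [labelledTuples, Finset.mem_filter, Fintype.mem_piFinset]
    exact ⟨hq1, fun a b hab => (hlab a b).1 hab⟩
  refine (Finset.card_le_card hsub).trans (Finset.card_biUnion_le.trans ?_)
  refine (Finset.sum_le_card_nsmul _ _ X fun lab hlab => hX lab (by simpa using hlab)).trans ?_
  rw [smul_eq_mul]
  refine Nat.mul_le_mul_right _ ((Finset.card_le_univ _).trans ?_)
  simp

/-- Each label occurs twice, and each circuit shares a label with another one. -/
def IsJointlyCrossMatched (lab : Fin m × Fin h → Λ) : Prop :=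
  (∀ a, ∃ b, b ≠ a ∧ lab b = lab a) ∧
    ∀ c, ∃ i, ∃ b : Fin m × Fin h, b.1 ≠ c ∧ lab b = lab (c, i)

/-- Here `NS` consists of circuits that save neither in the increasing nor in the decreasing order.
If the label closes such a circuit, it occurs in at least two circuits; let `c0` and `c1` be the
first and the last. Each circuit that contains the label contributes at least 1, and `c0` or `c1`,
if in `NS` and closed by this label, contributes 2, because the earlier (or later) occurrence can
only be in the same circuit. If no circuit of `NS` is closed by it, the label still occurs twice. -/
theorem two_add_card_le_card_fiber {lab : Fin m × Fin h → Λ} {e : Fin m → Fin h}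
    (hm : ∀ a, ∃ b, b ≠ a ∧ lab b = lab a)
    (hc : ∀ c, ∃ b : Fin m × Fin h, b.1 ≠ c ∧ lab b = lab (c, e c)) {NS : Finset (Fin m)}
    (hNS : ∀ c ∈ NS, (∃ b, b ≠ (c, e c) ∧ b.1 ≤ c ∧ lab b = lab (c, e c)) ∧
      ∃ b, b ≠ (c, e c) ∧ c ≤ b.1 ∧ lab b = lab (c, e c)) (a₀ : Fin m × Fin h) :
    2 + (NS.filter fun c => lab (c, e c) = lab a₀).card ≤
      (Finset.univ.filter fun a => lab a = lab a₀).card := by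
  set γ := lab a₀
  rcases Finset.eq_empty_or_nonempty (NS.filter fun c => lab (c, e c) = γ) with he | ⟨c, hcNS⟩
  · rw [he, Finset.card_empty, add_zero]
    obtain ⟨b, hb, hbl⟩ := hm a₀
    rw [← Finset.card_pair hb]
    apply Finset.card_le_card
    intro x hx
    simp only [Finset.mem_insert, Finset.mem_singleton] at hx
    rcases hx with rfl | rfl
    · simpa using hbl
    · simp [γ]
  · rw [Finset.mem_filter] at hcNS
    let C : Finset (Fin m) := Finset.univ.filter fun c => ∃ i, lab (c, i) = γ
    have hcC : c ∈ C := by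
      simp only [C, Finset.mem_filter, Finset.mem_univ, true_and]
      exact ⟨_, hcNS.2⟩
    have hCne : C.Nonempty := ⟨c, hcC⟩
    set c0 := C.min' hCne with hc0
    set c1 := C.max' hCne with hc1
    have hne : c0 ≠ c1 := by
      obtain ⟨b, hbc, hbl⟩ := hc c
      have hbC : b.1 ∈ C := by
        simp only [C, Finset.mem_filter, Finset.mem_univ, true_and]
        exact ⟨b.2, hbl.trans hcNS.2⟩
      have h1 := C.min'_le _ hcC
      have h2 := C.min'_le _ hbC
      have h3 := C.le_max' _ hcC
      have h4 := C.le_max' _ hbC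
      intro hh
      apply hbc
      rw [← hc0] at h1 h2
      rw [← hc1] at h3 h4
      rw [← hh] at h3 h4
      exact (le_antisymm h4 h2).trans (le_antisymm h1 h3)
    have hfib : (Finset.univ.filter fun a : Fin m × Fin h => lab a = γ).card =
        ∑ c, (Finset.univ.filter fun i => lab (c, i) = γ).card := by
      simp only [Finset.card_filter]
      rw [Fintype.sum_prod_type]
    have hsum : 2 + (NS.filter fun c => lab (c, e c) = γ).card =
        ∑ c, ((if c = c0 then 1 else 0) + (if c = c1 then 1 else 0) +
          if c ∈ NS ∧ lab (c, e c) = γ then 1 else 0) := by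
      rw [Finset.sum_add_distrib, Finset.sum_add_distrib, Finset.sum_ite_eq', Finset.sum_ite_eq',
        ← Finset.card_filter]
      simp only [Finset.mem_univ, if_true]
      congr 2
      ext x; simp
    rw [hfib, hsum]
    refine Finset.sum_le_sum fun x _ => ?_
    have hmemC : x ∈ C → 1 ≤ (Finset.univ.filter fun i => lab (x, i) = γ).card := by
      intro hx
      simp only [C, Finset.mem_filter, Finset.mem_univ, true_and] at hx
      obtain ⟨i, hi⟩ := hx
      exact Finset.card_pos.2 ⟨i, by simpa using hi⟩
    have htwo : x ∈ NS → lab (x, e x) = γ → x = c0 ∨ x = c1 →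
        2 ≤ (Finset.univ.filter fun i => lab (x, i) = γ).card := by
      intro hx hxl hx01
      have hex : ∃ i, i ≠ e x ∧ lab (x, i) = γ := by
        rcases hx01 with rfl | rfl
        · obtain ⟨⟨b, hb1, hb2, hb3⟩, -⟩ := hNS _ hx
          have hbC : b.1 ∈ C := by
            simp only [C, Finset.mem_filter, Finset.mem_univ, true_and]
            exact ⟨b.2, hb3.trans hxl⟩
          have hbx : b.1 = c0 := le_antisymm hb2 (C.min'_le _ hbC)
          refine ⟨b.2, fun hh => hb1 (Prod.ext hbx hh), ?_⟩
          rw [← hbx]; exact hb3.trans hxl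
        · obtain ⟨-, ⟨b, hb1, hb2, hb3⟩⟩ := hNS _ hx
          have hbC : b.1 ∈ C := by
            simp only [C, Finset.mem_filter, Finset.mem_univ, true_and]
            exact ⟨b.2, hb3.trans hxl⟩
          have hbx : b.1 = c1 := le_antisymm (C.le_max' _ hbC) hb2
          refine ⟨b.2, fun hh => hb1 (Prod.ext hbx hh), ?_⟩
          rw [← hbx]; exact hb3.trans hxl
      obtain ⟨i, hi, hil⟩ := hex
      rw [← Finset.card_pair hi]
      apply Finset.card_le_card
      intro y hy
      simp only [Finset.mem_insert, Finset.mem_singleton] at hy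
      rcases hy with rfl | rfl
      · simpa using hil
      · simpa using hxl
    by_cases hx0 : x = c0
    · have hx1 : x ≠ c1 := fun hh => hne (hx0.symm.trans hh)
      have hxC : x ∈ C := hx0 ▸ C.min'_mem hCne
      rw [if_pos hx0, if_neg hx1]
      split_ifs with hh
      · exact htwo hh.1 hh.2 (Or.inl hx0)
      · exact hmemC hxC
    · rw [if_neg hx0]
      by_cases hx1 : x = c1
      · have hxC : x ∈ C := hx1 ▸ C.max'_mem hCne
        rw [if_pos hx1]
        split_ifs with hh
        · exact htwo hh.1 hh.2 (Or.inr hx1)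
        · exact hmemC hxC
      · rw [if_neg hx1]
        split_ifs with hh
        · refine hmemC ?_
          simp only [C, Finset.mem_filter, Finset.mem_univ, true_and]
          exact ⟨_, hh.2⟩
        · simp

/-- Either the increasing or the decreasing order of the circuits saves enough. Summing the fibre
bound over labels gives `2 * #labels + #NS ≤ 2 * m * h`, and `NS` contains every circuit that saves
in neither order. If both orders failed, adding the two failures would contradict this. -/
theorem IsJointlyCrossMatched.card_labelledTuples_le {L : Link} {Δ : ℕ}
    (hΔ : ∀ n t : ℕ, ∀ k ∈ Finset.Icc 1 n,
      ((Finset.Icc 1 n).filter (fun l => L.val n k l = t)).card ≤ Δ)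
    {lab : Fin (2 * m) × Fin h → Λ} (H : IsJointlyCrossMatched lab) [NeZero n] :
    (labelledTuples L lab n).card ≤
      (Δ + 1) ^ (2 * m * (h + 1)) * n ^ (m * (h + 1)) := by
  classical
  obtain ⟨hm, hc⟩ := H
  choose e he using hc
  set s1 := savers lab e (fun c => (c : ℕ)) with hs1
  set s2 := savers lab e (fun c => 2 * m - c) with hs2
  set NS : Finset (Fin (2 * m)) := (s1 ∪ s2)ᶜ with hNSdef
  have hNS : ∀ c ∈ NS, (∃ b, b ≠ (c, e c) ∧ b.1 ≤ c ∧ lab b = lab (c, e c)) ∧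
      ∃ b, b ≠ (c, e c) ∧ c ≤ b.1 ∧ lab b = lab (c, e c) := by
    intro c hc
    simp only [hNSdef, hs1, hs2, savers, Finset.mem_compl, Finset.mem_union, Finset.mem_filter,
      Finset.mem_univ, true_and, not_or] at hc
    push Not at hc
    obtain ⟨⟨b, hb1, hb2, hb3⟩, ⟨b', hb1', hb2', hb3'⟩⟩ := hc
    refine ⟨⟨b, hb1, hb2, hb3⟩, ⟨b', hb1', ?_, hb3'⟩⟩
    rw [Fin.le_def]; omega
  have h1 : 2 * (Finset.univ.image lab).card + NS.card ≤ 2 * m * h := by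
    have e1 : (Finset.univ : Finset (Fin (2 * m) × Fin h)).card = 2 * m * h := by simp
    rw [← e1, Finset.card_eq_sum_card_image lab Finset.univ]
    have e2 : NS.card = ∑ γ ∈ Finset.univ.image lab, (NS.filter fun c => lab (c, e c) = γ).card :=
      Finset.card_eq_sum_card_fiberwise (by intro c _; simp)
    rw [e2, mul_comm, ← smul_eq_mul, ← Finset.sum_const, ← Finset.sum_add_distrib]
    refine Finset.sum_le_sum fun γ hγ => ?_
    obtain ⟨a, -, rfl⟩ := Finset.mem_image.1 hγ
    exact two_add_card_le_card_fiber hm he hNS a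
  have h2 : 2 * m ≤ s1.card + s2.card + NS.card := by
    have e1 : (s1 ∪ s2).card + NS.card = Fintype.card (Fin (2 * m)) :=
      Finset.card_add_card_compl _
    have e2 := Finset.card_union_le s1 s2
    rw [Fintype.card_fin] at e1
    omega
  have h3 : 2 * (m * (h + 1)) = 2 * m * h + 2 * m := by ring
  by_cases hcase : 2 * m + (Finset.univ.image lab).card ≤ m * (h + 1) + s1.card
  · exact SchurHadamard.card_labelledTuples_le hΔ lab e Fin.val_injective hcase
  · have h4 : 2 * m + (Finset.univ.image lab).card ≤ m * (h + 1) + s2.card := by omega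
    refine SchurHadamard.card_labelledTuples_le hΔ lab e (fun c c' hcc => ?_) h4
    have hcc' : 2 * m - (c : ℕ) = 2 * m - (c' : ℕ) := hcc
    exact Fin.ext (by omega)

end Tuples

/-! ### Moments of products along circuits -/

section Moments

variable {Ω : Type*} [MeasurableSpace Ω] {P : Measure Ω} {x : ℕ → Ω → ℝ} {C : ℝ}

/-- Bounded independent random variables with mean `0` and variance `1`. -/
structure IsBddStandardized (P : Measure Ω) (x : ℕ → Ω → ℝ) (C : ℝ) : Prop where
  nonneg : 0 ≤ C
  measurable : ∀ i, Measurable (x i)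
  abs_le : ∀ i ω, |x i ω| ≤ C
  mean : ∀ i, ∫ ω, x i ω ∂P = 0
  sq : ∀ i, ∫ ω, x i ω ^ 2 ∂P = 1
  indep : iIndepFun x P

/-- The σ-algebra generated by the variables with indices in `S`. -/
abbrev sigmaOf {Ω : Type*} (x : ℕ → Ω → ℝ) (S : Set ℕ) : MeasurableSpace Ω :=
  ⨆ i ∈ S, MeasurableSpace.comap (x i) inferInstance

theorem measurable_sigmaOf {Ω : Type*} {x : ℕ → Ω → ℝ} {S : Set ℕ} {i : ℕ} (hi : i ∈ S) :
    Measurable[sigmaOf x S] (x i) :=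
  (comap_measurable (x i)).mono (le_iSup₂_of_le i hi le_rfl) le_rfl

theorem sigmaOf_le (hx : ∀ i, Measurable (x i)) (S : Set ℕ) :
    sigmaOf x S ≤ (inferInstance : MeasurableSpace Ω) :=
  iSup₂_le fun i _ => (hx i).comap_le

theorem integral_mul_of_disjoint (hx : ∀ i, Measurable (x i)) (hi : iIndepFun x P) (S : Set ℕ)
    {f g : Ω → ℝ} (hf : Measurable[sigmaOf x S] f) (hg : Measurable[sigmaOf x Sᶜ] g) :
    ∫ ω, f ω * g ω ∂P = (∫ ω, f ω ∂P) * ∫ ω, g ω ∂P := by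
  have h1 : Indep (sigmaOf x S) (sigmaOf x Sᶜ) P :=
    indep_iSup_of_disjoint (fun i => (hx i).comap_le) hi.iIndep disjoint_compl_right
  have h2 : IndepFun f g P := by
    rw [IndepFun_iff_Indep]
    exact indep_of_indep_of_le_left (indep_of_indep_of_le_right h1 hg.comap_le) hf.comap_le
  exact h2.integral_fun_mul_eq_mul_integral
    ((hf.mono (sigmaOf_le hx S) le_rfl).aestronglyMeasurable)
    ((hg.mono (sigmaOf_le hx Sᶜ) le_rfl).aestronglyMeasurable)

variable {h n : ℕ}

/-- The product of the entries `u_{L(π(i-1), π(i))}` along a circuit. -/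
def circuitWeight (L : Link) (π : Fin (h + 1) → Fin n) (u : ℕ → ℝ) : ℝ :=
  ∏ i, u (L.edge π i)

theorem measurable_circuitWeight (L : Link) (π : Fin (h + 1) → Fin n) :
    Measurable (circuitWeight L π) :=
  Finset.measurable_prod _ fun _ _ => measurable_pi_apply _

theorem abs_circuitWeight_le (L : Link) (π : Fin (h + 1) → Fin n) {u : ℕ → ℝ}
    (hu : ∀ i, |u i| ≤ C) : |circuitWeight L π u| ≤ C ^ h := by
  rw [circuitWeight, Finset.abs_prod]
  refine (Finset.prod_le_prod (fun i _ => abs_nonneg _) fun i _ => hu (L.edge π i)).trans ?_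
  simp

theorem measurable_circuitWeight_sigmaOf {Ω : Type*} {x : ℕ → Ω → ℝ} (L : Link)
    (π : Fin (h + 1) → Fin n) {S : Set ℕ}
    (hS : ∀ i, L.edge π i ∈ S) :
    Measurable[sigmaOf x S] fun ω => circuitWeight L π fun i => x i ω :=
  @Finset.measurable_prod _ _ _ _ _ _ (sigmaOf x S) _ Finset.univ
    fun i _ => measurable_sigmaOf (hS i)

theorem measurable_circuitWeight_sub_sigmaOf {Ω : Type*} {x : ℕ → Ω → ℝ} (L : Link)
    (π : Fin (h + 1) → Fin n) {S : Set ℕ}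
    (hS : ∀ i, L.edge π i ∈ S) (r : ℝ) :
    Measurable[sigmaOf x S] fun ω => circuitWeight L π (fun i => x i ω) - r :=
  (measurable_id.sub_const r).comp (measurable_circuitWeight_sigmaOf L π hS)

/-- The expectation of `circuitWeight`. -/
noncomputable def meanWeight (P : Measure Ω) (x : ℕ → Ω → ℝ) (L : Link)
    (π : Fin (h + 1) → Fin n) : ℝ :=
  ∫ ω, circuitWeight L π (fun i => x i ω) ∂P

theorem meanWeight_eq_zero (hx : IsBddStandardized P x C) {L : Link} {π : Fin (h + 1) → Fin n}
    {i : Fin h} (hi : ∀ j, j ≠ i → L.edge π j ≠ L.edge π i) : meanWeight P x L π = 0 := by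
  classical
  have h1 : ∀ ω, circuitWeight L π (fun i => x i ω) =
      x (L.edge π i) ω * ∏ j ∈ Finset.univ.erase i, x (L.edge π j) ω := fun ω =>
    (Finset.mul_prod_erase _ _ (Finset.mem_univ i)).symm
  simp only [meanWeight, h1]
  rw [integral_mul_of_disjoint hx.measurable hx.indep {L.edge π i}, hx.mean, zero_mul]
  · exact measurable_sigmaOf rfl
  · exact @Finset.measurable_prod _ _ _ _ _ _ (sigmaOf x _) _ _
      fun j hj => measurable_sigmaOf (hi j (Finset.ne_of_mem_erase hj))

theorem abs_meanWeight_le [IsProbabilityMeasure P] (hx : IsBddStandardized P x C) (L : Link)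
    (π : Fin (h + 1) → Fin n) : |meanWeight P x L π| ≤ C ^ h := by
  have := norm_integral_le_of_norm_le_const (μ := P) (C := C ^ h)
    (f := fun ω => circuitWeight L π fun i => x i ω)
    (ae_of_all _ fun ω => abs_circuitWeight_le L π fun i => hx.abs_le i ω)
  simpa [meanWeight] using this

/-- The product of the centred weights along the circuits of a tuple. -/
noncomputable def centredProd {m : ℕ} (P : Measure Ω) (x : ℕ → Ω → ℝ) (L : Link)
    (q : Fin m → Fin (h + 1) → Fin n) (u : ℕ → ℝ) : ℝ :=
  ∏ c, (circuitWeight L (q c) u - meanWeight P x L (q c))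

theorem measurable_centredProd {m : ℕ} (L : Link) (q : Fin m → Fin (h + 1) → Fin n) :
    Measurable (centredProd P x L q) :=
  Finset.measurable_prod _ fun _ _ => (measurable_circuitWeight L _).sub_const _

theorem abs_centredProd_le [IsProbabilityMeasure P] (hx : IsBddStandardized P x C) {m : ℕ}
    (L : Link) (q : Fin m → Fin (h + 1) → Fin n) (ω : Ω) :
    |centredProd P x L q fun i => x i ω| ≤ (2 * C ^ h) ^ m := by
  rw [centredProd, Finset.abs_prod]
  have : ∀ c, |circuitWeight L (q c) (fun i => x i ω) - meanWeight P x L (q c)| ≤ 2 * C ^ h := by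
    intro c
    have h1 := abs_circuitWeight_le L (q c) fun i => hx.abs_le i ω
    have h2 := abs_meanWeight_le hx L (q c)
    have h3 := abs_sub (circuitWeight L (q c) (fun i => x i ω)) (meanWeight P x L (q c))
    linarith
  refine (Finset.prod_le_prod (fun i _ => abs_nonneg _) fun i _ => this i).trans ?_
  simp

/-- If a value is used by a single edge, its circuit has mean weight 0, so the product contains that
variable as a factor of mean zero independent of the rest. If a circuit shares no value with the
others, its centred weight is an independent factor of mean zero. -/
theorem integral_centredProd_eq_zero [IsProbabilityMeasure P] (hx : IsBddStandardized P x C)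
    {m : ℕ} {L : Link} {q : Fin m → Fin (h + 1) → Fin n}
    (hq : ¬ ((∀ a : Fin m × Fin h, ∃ b : Fin m × Fin h, b ≠ a ∧
        L.edge (q b.1) b.2 = L.edge (q a.1) a.2) ∧
      ∀ c, ∃ i, ∃ b : Fin m × Fin h, b.1 ≠ c ∧ L.edge (q b.1) b.2 = L.edge (q c) i)) :
    ∫ ω, centredProd P x L q (fun i => x i ω) ∂P = 0 := by
  classical
  have hsplit : ∀ c ω, centredProd P x L q (fun i => x i ω) =
      (circuitWeight L (q c) (fun i => x i ω) - meanWeight P x L (q c)) *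
        ∏ d ∈ Finset.univ.erase c,
          (circuitWeight L (q d) (fun i => x i ω) - meanWeight P x L (q d)) := fun c ω =>
    (Finset.mul_prod_erase _ _ (Finset.mem_univ c)).symm
  rw [not_and_or] at hq
  rcases hq with hq | hq
  · push Not at hq
    obtain ⟨⟨c, i⟩, hci⟩ := hq
    have h0 : meanWeight P x L (q c) = 0 :=
      meanWeight_eq_zero hx fun j hj => hci (c, j) (by simpa using hj)
    have h1 : ∀ ω, centredProd P x L q (fun i => x i ω) = x (L.edge (q c) i) ω *
        ((∏ j ∈ Finset.univ.erase i, x (L.edge (q c) j) ω) * ∏ d ∈ Finset.univ.erase c,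
          (circuitWeight L (q d) (fun i => x i ω) - meanWeight P x L (q d))) := by
      intro ω
      rw [hsplit c, h0, sub_zero, ← mul_assoc]
      congr 1
      exact (Finset.mul_prod_erase _ _ (Finset.mem_univ i)).symm
    simp only [h1]
    rw [integral_mul_of_disjoint hx.measurable hx.indep {L.edge (q c) i}, hx.mean, zero_mul]
    · exact measurable_sigmaOf rfl
    · refine Measurable.mul ?_ ?_
      · exact @Finset.measurable_prod _ _ _ _ _ _ (sigmaOf x _) _ _
          fun j hj => measurable_sigmaOf (hci (c, j) (by simpa using Finset.ne_of_mem_erase hj))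
      · exact @Finset.measurable_prod _ _ _ _ _ _ (sigmaOf x _) _ _
          fun d hd => measurable_circuitWeight_sub_sigmaOf L _ (fun j => hci (d, j) fun hh =>
              Finset.ne_of_mem_erase hd (congrArg Prod.fst hh)) _
  · push Not at hq
    obtain ⟨c, hc⟩ := hq
    simp only [hsplit c]
    have hint : Integrable (fun ω => circuitWeight L (q c) fun i => x i ω) P := by
      refine Integrable.of_bound (C := C ^ h) ?_
        (ae_of_all _ fun ω => abs_circuitWeight_le L (q c) fun i => hx.abs_le i ω)
      exact ((measurable_circuitWeight L (q c)).comp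
        (measurable_pi_lambda _ hx.measurable)).aestronglyMeasurable
    rw [integral_mul_of_disjoint hx.measurable hx.indep (Set.range fun i => L.edge (q c) i),
      integral_sub hint (integrable_const _)]
    · simp [meanWeight]
    · exact measurable_circuitWeight_sub_sigmaOf L _ (fun j => Set.mem_range_self j) _
    · refine @Finset.measurable_prod _ _ _ _ _ _ (sigmaOf x _) _ _
        fun d hd => measurable_circuitWeight_sub_sigmaOf L _ (fun j => ?_) _
      rintro ⟨i, hi⟩
      exact hc i (d, j) (Finset.ne_of_mem_erase hd) hi.symm

/-- Expand over quadruples of circuits. The coefficients are independent of `x`, so only quadruples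
that are jointly matched and cross-matched contribute, and there are `O(n ^ (2 * (h + 1)))` of them.
Allowing coefficients that depend on `y` makes it enough to count matches of a single link. -/
theorem fourth_moment_le [IsProbabilityMeasure P] (hx : IsBddStandardized P x C)
    {L : Link} {Δ : ℕ}
    (hΔ : ∀ n t : ℕ, ∀ k ∈ Finset.Icc 1 n,
      ((Finset.Icc 1 n).filter (fun l => L.val n k l = t)).card ≤ Δ)
    {β : Type*} [MeasurableSpace β] {y : Ω → β} (hy : Measurable y)
    (hxy : IndepFun (fun ω i => x i ω) y P) {a : (Fin (h + 1) → Fin n) → β → ℝ}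
    (ha : ∀ π, Measurable (a π)) {B : ℝ} (haB : ∀ π ω, |a π (y ω)| ≤ B) [NeZero n] :
    Integrable (fun ω => (∑ π ∈ circuits h n, a π (y ω) *
      (circuitWeight L π (fun i => x i ω) - meanWeight P x L π)) ^ 4) P ∧
    ∫ ω, (∑ π ∈ circuits h n, a π (y ω) *
      (circuitWeight L π (fun i => x i ω) - meanWeight P x L π)) ^ 4 ∂P ≤
    (4 * h) ^ (4 * h) * (Δ + 1) ^ (4 * (h + 1)) * (B * (2 * C ^ h)) ^ 4 *
      (n : ℝ) ^ (2 * (h + 1)) := by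
  classical
  have hxm : Measurable fun ω i => x i ω := measurable_pi_lambda _ hx.measurable
  have hexp : ∀ ω, (∑ π ∈ circuits h n, a π (y ω) *
      (circuitWeight L π (fun i => x i ω) - meanWeight P x L π)) ^ 4 =
      ∑ q ∈ Fintype.piFinset fun _ : Fin 4 => circuits h n,
        (∏ c, a (q c) (y ω)) * centredProd P x L q fun i => x i ω := by
    intro ω
    have := Finset.prod_univ_sum (fun _ : Fin 4 => circuits h n) fun _ π => a π (y ω) *
      (circuitWeight L π (fun i => x i ω) - meanWeight P x L π)
    rw [Finset.prod_const, Finset.card_univ, Fintype.card_fin] at this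
    rw [this]
    refine Finset.sum_congr rfl fun q _ => ?_
    rw [Finset.prod_mul_distrib, centredProd]
  have hbdd : ∀ (q : Fin 4 → Fin (h + 1) → Fin n) ω,
      |(∏ c, a (q c) (y ω)) * centredProd P x L q fun i => x i ω| ≤ (B * (2 * C ^ h)) ^ 4 := by
    intro q ω
    rw [abs_mul, mul_pow]
    refine mul_le_mul ?_ (abs_centredProd_le hx L q ω) (abs_nonneg _) (by positivity)
    rw [Finset.abs_prod]
    refine (Finset.prod_le_prod (fun i _ => abs_nonneg _) fun i _ => haB (q i) ω).trans ?_
    simp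
  have hmeas : ∀ q : Fin 4 → Fin (h + 1) → Fin n, Measurable fun b => ∏ c, a (q c) b :=
    fun q => Finset.measurable_prod _ fun c _ => ha _
  have hint : ∀ q : Fin 4 → Fin (h + 1) → Fin n, Integrable (fun ω =>
      (∏ c, a (q c) (y ω)) * centredProd P x L q fun i => x i ω) P := fun q =>
    Integrable.of_bound (((hmeas q).comp hy).mul
      ((measurable_centredProd L q).comp hxm)).aestronglyMeasurable _ (ae_of_all _ (hbdd q))
  simp only [hexp]
  refine ⟨integrable_finsetSum _ fun q _ => hint q, ?_⟩
  rw [integral_finsetSum _ fun q _ => hint q]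
  set G := (Fintype.piFinset fun _ : Fin 4 => circuits h n).filter fun q =>
    (∀ a : Fin 4 × Fin h, ∃ b : Fin 4 × Fin h, b ≠ a ∧
        L.edge (q b.1) b.2 = L.edge (q a.1) a.2) ∧
      ∀ c, ∃ i, ∃ b : Fin 4 × Fin h, b.1 ≠ c ∧ L.edge (q b.1) b.2 = L.edge (q c) i with hG
  have hcard : (G.card : ℝ) ≤ (4 * h) ^ (4 * h) *
      ((Δ + 1) ^ (4 * (h + 1)) * (n : ℝ) ^ (2 * (h + 1))) := by
    have := card_le_of_patterns (L := L) (m := 4) (h := h) (n := n)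
      (Good := IsJointlyCrossMatched) (X := (Δ + 1) ^ (4 * (h + 1)) * n ^ (2 * (h + 1)))
      (fun lab hlab => hlab.card_labelledTuples_le (m := 2) hΔ) G (by
        intro q hq
        rw [hG, Finset.mem_filter, Fintype.mem_piFinset] at hq
        refine ⟨hq.1, fun lab hlab => ⟨fun a => ?_, fun c => ?_⟩⟩
        · obtain ⟨b, hb, hb'⟩ := hq.2.1 a
          exact ⟨b, hb, (hlab b a).2 hb'⟩
        · obtain ⟨i, b, hb, hb'⟩ := hq.2.2 c
          exact ⟨i, b, hb, (hlab b (c, i)).2 hb'⟩)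
    exact_mod_cast this
  calc ∑ q ∈ Fintype.piFinset fun _ : Fin 4 => circuits h n,
        ∫ ω, (∏ c, a (q c) (y ω)) * centredProd P x L q (fun i => x i ω) ∂P
      = ∑ q ∈ G, ∫ ω, (∏ c, a (q c) (y ω)) * centredProd P x L q (fun i => x i ω) ∂P := by
        refine (Finset.sum_subset (Finset.filter_subset _ _) fun q hq hqG => ?_).symm
        have hI : IndepFun (fun ω => ∏ c, a (q c) (y ω))
            (fun ω => centredProd P x L q fun i => x i ω) P :=
          hxy.symm.comp (hmeas q) (measurable_centredProd L q)
        rw [hI.integral_fun_mul_eq_mul_integral ((hmeas q).comp hy).aestronglyMeasurable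
          ((measurable_centredProd L q).comp hxm).aestronglyMeasurable,
          integral_centredProd_eq_zero hx (fun hh => hqG (Finset.mem_filter.2 ⟨hq, hh⟩)), mul_zero]
    _ ≤ ∑ q ∈ G, (B * (2 * C ^ h)) ^ 4 := by
        refine Finset.sum_le_sum fun q _ => (le_abs_self _).trans ?_
        have := norm_integral_le_of_norm_le_const (μ := P) (C := (B * (2 * C ^ h)) ^ 4)
          (f := fun ω => (∏ c, a (q c) (y ω)) * centredProd P x L q fun i => x i ω)
          (ae_of_all P (hbdd q))
        simpa using this
    _ = G.card * (B * (2 * C ^ h)) ^ 4 := by rw [Finset.sum_const, nsmul_eq_mul]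
    _ ≤ (4 * h) ^ (4 * h) * ((Δ + 1) ^ (4 * (h + 1)) * (n : ℝ) ^ (2 * (h + 1))) *
          (B * (2 * C ^ h)) ^ 4 := mul_le_mul_of_nonneg_right hcard (by positivity)
    _ = _ := by ring

end Moments

/-! ### Traces of powers as sums over circuits -/

theorem pow_apply_eq_sum_paths {n : ℕ} (A : Matrix (Fin n) (Fin n) ℝ) (h : ℕ) (a b : Fin n) :
    (A ^ h) a b = ∑ π : Fin (h + 1) → Fin n, if π 0 = a ∧ π (Fin.last h) = b then
      ∏ i : Fin h, A (π i.castSucc) (π i.succ) else 0 := by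
  induction h generalizing a b with
  | zero =>
    rw [pow_zero, ← (Equiv.funUnique (Fin 1) (Fin n)).symm.sum_comp]
    simp only [Equiv.funUnique_symm_apply, uniqueElim_const, Finset.univ_eq_empty,
      Finset.prod_empty]
    rw [Matrix.one_apply]
    split_ifs with hab
    · subst hab; simp
    · refine (Finset.sum_eq_zero fun c _ => if_neg ?_).symm
      rintro ⟨rfl, hh⟩
      exact hab hh
  | succ h ih =>
    rw [pow_succ', Matrix.mul_apply, ← (Fin.consEquiv fun _ => Fin n).sum_comp,
      Fintype.sum_prod_type]
    simp only [Fin.consEquiv_apply, Fin.cons_zero, Fin.prod_univ_succ, ih, Fin.castSucc_zero,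
      ← Fin.succ_castSucc, Fin.cons_succ, ← Fin.succ_last, ite_and, Finset.mul_sum]
    trans ∑ π : Fin (h + 1) → Fin n, if π (Fin.last h) = b then
      A a (π 0) * ∏ i : Fin h, A (π i.castSucc) (π i.succ) else 0
    · rw [Finset.sum_comm]
      simp [mul_ite]
    · rw [Finset.sum_comm]
      simp

theorem trace_pow_eq_sum_circuits {n : ℕ} (A : Matrix (Fin n) (Fin n) ℝ) (h : ℕ) :
    (A ^ h).trace = ∑ π ∈ circuits h n, ∏ i : Fin h, A (π i.castSucc) (π i.succ) := by
  simp only [Matrix.trace, Matrix.diag, pow_apply_eq_sum_paths, circuits, Finset.sum_filter]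
  rw [Finset.sum_comm]
  refine Finset.sum_congr rfl fun π _ => ?_
  simp only [ite_and, Finset.sum_ite_eq, Finset.mem_univ, if_true]
  simp only [eq_comm]

/-- The normalisation of the `h`-th moment. -/
noncomputable def momentScale (h n : ℕ) : ℝ := (n : ℝ)⁻¹ * (Real.sqrt n)⁻¹ ^ h

theorem trace_scaledProduct_pow (LX LY : Link) (n h : ℕ) (x y : ℕ → ℝ) :
    (n : ℝ)⁻¹ * (scaledProduct LX LY n x y ^ h).trace =
      momentScale h n * ∑ π ∈ circuits h n, circuitWeight LX π x * circuitWeight LY π y := by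
  rw [trace_pow_eq_sum_circuits, momentScale, mul_assoc]
  congr 1
  rw [Finset.mul_sum]
  refine Finset.sum_congr rfl fun π _ => ?_
  simp only [scaledProduct, Matrix.smul_apply, smul_eq_mul, Matrix.hadamard_apply, patterned,
    Matrix.of_apply, Finset.prod_mul_distrib, Finset.prod_const, Finset.card_univ,
    Fintype.card_fin, circuitWeight, Link.edge]

theorem momentScale_nonneg (h n : ℕ) : 0 ≤ momentScale h n := by
  unfold momentScale; positivity

theorem momentScale_sq_mul (h : ℕ) {n : ℕ} (hn : n ≠ 0) :
    momentScale h n ^ 2 * (n : ℝ) ^ (h + 2) = 1 := by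
  have h0 : (n : ℝ) ≠ 0 := Nat.cast_ne_zero.2 hn
  have h1 : (Real.sqrt n)⁻¹ ^ 2 = (n : ℝ)⁻¹ := by
    rw [inv_pow, Real.sq_sqrt (Nat.cast_nonneg n)]
  rw [momentScale, mul_pow, ← pow_mul, mul_comm h 2, pow_mul, h1, inv_pow, inv_pow,
    pow_add]
  field_simp

theorem momentScale_two_mul (k : ℕ) (n : ℕ) :
    momentScale (2 * k) n = ((n : ℝ) ^ (1 + k))⁻¹ := by
  rw [momentScale, pow_mul, inv_pow (Real.sqrt n), Real.sq_sqrt (Nat.cast_nonneg n), pow_add,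
    pow_one, mul_inv, inv_pow]

/-- Numbers of lower order than the total number of circuits vanish in the limit. -/
theorem tendsto_momentScale_mul_zero (h : ℕ) {f : ℕ → ℝ} (hf : ∀ n, 0 ≤ f n) {K : ℝ}
    (hK : ∀ n, n ≠ 0 → f n ≤ K * (n : ℝ) ^ ((h + 1) / 2)) :
    Tendsto (fun n => momentScale h n * f n) atTop (𝓝 0) := by
  -- Squaring avoids the half-integer power of `n` in `momentScale`.
  have hbound : ∀ᶠ n : ℕ in atTop, (momentScale h n * f n) ^ 2 ≤ K ^ 2 / n := by
    filter_upwards [eventually_gt_atTop 0] with n hn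
    have hn1 : (1 : ℝ) ≤ n := by exact_mod_cast hn
    have h1 : f n ^ 2 ≤ K ^ 2 * (n : ℝ) ^ (h + 1) := by
      have h3 := pow_le_pow_left₀ (hf n) (hK n hn.ne') 2
      rw [mul_pow, ← pow_mul] at h3
      refine h3.trans (mul_le_mul_of_nonneg_left (pow_le_pow_right₀ hn1 ?_) (sq_nonneg _))
      exact Nat.div_mul_le_self _ _
    have h2 := momentScale_sq_mul h hn.ne'
    rw [le_div_iff₀ (by positivity), mul_pow]
    calc momentScale h n ^ 2 * f n ^ 2 * n
        ≤ momentScale h n ^ 2 * (K ^ 2 * (n : ℝ) ^ (h + 1)) * n := by gcongr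
      _ = K ^ 2 * (momentScale h n ^ 2 * (n : ℝ) ^ (h + 2)) := by ring
      _ = K ^ 2 := by rw [h2, mul_one]
  have hsq : Tendsto (fun n => (momentScale h n * f n) ^ 2) atTop (𝓝 0) :=
    squeeze_zero' (Eventually.of_forall fun n => sq_nonneg _) hbound
      (tendsto_const_div_atTop_nhds_zero_nat _)
  have := hsq.sqrt
  rw [Real.sqrt_zero] at this
  refine this.congr fun n => Real.sqrt_sq (mul_nonneg (momentScale_nonneg h n) (hf n))

/-! ### The limit of the expected moments -/

section Mean

variable {h n : ℕ}

/-- The number of edges of a circuit with the same `L`-value as a given edge. -/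
def edgeCount (L : Link) (π : Fin (h + 1) → Fin n) (i : Fin h) : ℕ :=
  (Finset.univ.filter fun j => L.edge π j = L.edge π i).card

variable {Ω : Type*} [MeasurableSpace Ω] {P : Measure Ω} {x : ℕ → Ω → ℝ} {C : ℝ}

theorem integral_prod_sq [IsProbabilityMeasure P] (hx : IsBddStandardized P x C) (s : Finset ℕ) :
    ∫ ω, ∏ t ∈ s, x t ω ^ 2 ∂P = 1 := by
  induction s using Finset.induction_on with
  | empty => simp
  | insert a s ha ih =>
    simp only [Finset.prod_insert ha]
    rw [integral_mul_of_disjoint hx.measurable hx.indep {a} (f := fun ω => x a ω ^ 2)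
      (g := fun ω => ∏ t ∈ s, x t ω ^ 2), ih, hx.sq, one_mul]
    · exact (measurable_id.pow_const 2).comp (measurable_sigmaOf rfl)
    · refine @Finset.measurable_prod _ _ _ _ _ _ (sigmaOf x _) _ _
        fun t ht => (measurable_id.pow_const 2).comp (measurable_sigmaOf ?_)
      rintro rfl
      exact ha ht

theorem meanWeight_eq_one [IsProbabilityMeasure P] (hx : IsBddStandardized P x C) {L : Link}
    {π : Fin (h + 1) → Fin n} (hπ : ∀ i, edgeCount L π i = 2) : meanWeight P x L π = 1 := by
  rw [meanWeight, ← integral_prod_sq hx (Finset.univ.image (L.edge π))]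
  congr 1
  funext ω
  rw [circuitWeight, Finset.prod_comp (fun t => x t ω) (L.edge π)]
  refine Finset.prod_congr rfl fun t ht => ?_
  obtain ⟨i, -, rfl⟩ := Finset.mem_image.1 ht
  congr 1
  exact hπ i

theorem meanWeight_eq_zero_of_edgeCount (hx : IsBddStandardized P x C) {L : Link}
    {π : Fin (h + 1) → Fin n} (hπ : ¬ ∀ i, 2 ≤ edgeCount L π i) : meanWeight P x L π = 0 := by
  push Not at hπ
  obtain ⟨i, hi⟩ := hπ
  refine meanWeight_eq_zero hx (i := i) fun j hj hij => ?_
  have h1 : 2 ≤ edgeCount L π i := by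
    rw [edgeCount, ← Finset.card_pair hj]
    apply Finset.card_le_card
    intro a ha
    simp only [Finset.mem_insert, Finset.mem_singleton] at ha
    rcases ha with rfl | rfl
    · simpa using hij
    · simp
  omega

/-- The circuits in which each `L`-value is repeated, some more than twice. -/
def overmatched (L : Link) (h n : ℕ) : Finset (Fin (h + 1) → Fin n) :=
  (circuits h n).filter fun π => (∀ i, 2 ≤ edgeCount L π i) ∧ ¬ ∀ i, edgeCount L π i = 2

/-- All values are repeated and one occurs at least three times, so there are fewer than `h / 2`
values. With one starting vertex this leaves at most `(h + 1) / 2` free vertices. -/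
theorem card_overmatched_le {L : Link} (hL : PropertyB L) (h : ℕ) :
    ∃ K : ℝ, ∀ n, n ≠ 0 → ((overmatched L h n).card : ℝ) ≤ K * (n : ℝ) ^ ((h + 1) / 2) := by
  classical
  obtain ⟨Δ, hΔ⟩ := hL
  refine ⟨(1 * h : ℕ) ^ (1 * h) * (Δ + 1) ^ (1 * (h + 1)), fun n hn => ?_⟩
  have : NeZero n := ⟨hn⟩
  let cnt : (Fin 1 × Fin h → Fin 1 × Fin h) → Fin 1 × Fin h → ℕ := fun lab a =>
    (Finset.univ.filter fun b => lab b = lab a).card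
  have hmain := card_le_of_patterns (m := 1) (h := h) (n := n) (L := L)
    (Good := fun lab => (∀ a, 2 ≤ cnt lab a) ∧ ¬ ∀ a, cnt lab a = 2)
    (X := (Δ + 1) ^ (1 * (h + 1)) * n ^ ((h + 1) / 2)) (by
      rintro lab ⟨h2, h3⟩
      push Not at h3
      obtain ⟨a₀, ha₀⟩ := h3
      have hlt : 2 * (Finset.univ.image lab).card < h := by
        have e1 : (Finset.univ : Finset (Fin 1 × Fin h)).card = h := by simp
        refine lt_of_lt_of_eq ?_ e1
        rw [Finset.card_eq_sum_card_image lab Finset.univ, mul_comm, ← smul_eq_mul,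
          ← Finset.sum_const]
        refine Finset.sum_lt_sum (fun γ hγ => ?_) ⟨lab a₀, by simp, ?_⟩
        · obtain ⟨a, -, rfl⟩ := Finset.mem_image.1 hγ
          exact h2 a
        · exact lt_of_le_of_ne (h2 a₀) ha₀.symm
      have e0 : Fin h := a₀.2
      exact card_labelledTuples_le hΔ lab (fun _ => e0) (ρ := fun c => (c : ℕ))
        Fin.val_injective (by omega))
    ((overmatched L h n).image fun π _ => π) (by
      intro q hq
      obtain ⟨π, hπ, rfl⟩ := Finset.mem_image.1 hq
      simp only [overmatched, Finset.mem_filter] at hπ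
      refine ⟨fun _ => hπ.1, fun lab hlab => ?_⟩
      have hc : ∀ a : Fin 1 × Fin h, cnt lab a = edgeCount L π a.2 := by
        intro a
        simp only [cnt, edgeCount, hlab]
        refine Finset.card_bij (fun b _ => b.2) (by simp) ?_ ?_
        · intro b _ b' _ hbb
          exact Prod.ext (Subsingleton.elim _ _) hbb
        · intro j hj
          exact ⟨(0, j), by simpa using hj, rfl⟩
      refine ⟨fun a => by rw [hc]; exact hπ.2.1 a.2, fun hh => hπ.2.2 fun i => ?_⟩
      rw [← hh (0, i), hc])
  rw [Finset.card_image_of_injective _ (fun π π' hh => congrFun hh 0)] at hmain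
  calc ((overmatched L h n).card : ℝ)
      ≤ (((1 * h) ^ (1 * h) * ((Δ + 1) ^ (1 * (h + 1)) * n ^ ((h + 1) / 2)) : ℕ) : ℝ) := by
        exact_mod_cast hmain
    _ = _ := by push_cast; ring

/-- The circuits that are pair-matched for both link functions. -/
def pairMatchedCircuits (LX LY : Link) (h n : ℕ) : Finset (Fin (h + 1) → Fin n) :=
  (circuits h n).filter fun π => (∀ i, edgeCount LX π i = 2) ∧ ∀ i, edgeCount LY π i = 2

theorem edgeCount_eq_of_pattern {L : Link} {π : Fin (h + 1) → Fin n} {w : Word h}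
    (hw : ∀ i j, w.letter i = w.letter j ↔ L.edge π i = L.edge π j) (i : Fin h) :
    edgeCount L π i = (Finset.univ.filter fun j => w.letter j = w.letter i).card := by
  simp only [edgeCount, hw]

theorem card_pairMatchedCircuits (LX LY : Link) (h n : ℕ) [Fintype {w : Word h // w.PairMatched}] :
    (pairMatchedCircuits LX LY h n).card = ∑ w : {w : Word h // w.PairMatched},
      ∑ w' : {w : Word h // w.PairMatched},
        (circuitClass LX w.1 n ∩ circuitClass LY w'.1 n).card := by
  classical
  have hex : ∀ (L : Link) (π : Fin (h + 1) → Fin n), ∃ w : Word h,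
      ∀ i j, w.letter i = w.letter j ↔ L.edge π i = L.edge π j := fun L π => exists_word (L.edge π)
  rw [← Fintype.sum_prod_type' (f := fun w w' : {w : Word h // w.PairMatched} =>
    (circuitClass LX w.1 n ∩ circuitClass LY w'.1 n).card),
    ← Finset.card_biUnion]
  · congr 1
    ext π
    simp only [pairMatchedCircuits, Finset.mem_filter, Finset.mem_biUnion, Finset.mem_univ,
      true_and, Finset.mem_inter, circuitClass]
    constructor
    · rintro ⟨hπ, h1, h2⟩
      obtain ⟨w, hw⟩ := hex LX π
      obtain ⟨w', hw'⟩ := hex LY π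
      refine ⟨⟨⟨w, fun i => ?_⟩, ⟨w', fun i => ?_⟩⟩, ⟨hπ, hw⟩, hπ, hw'⟩
      · rw [← edgeCount_eq_of_pattern hw, h1]
      · rw [← edgeCount_eq_of_pattern hw', h2]
    · rintro ⟨⟨w, w'⟩, ⟨hπ, hw⟩, -, hw'⟩
      refine ⟨hπ, fun i => ?_, fun i => ?_⟩
      · rw [edgeCount_eq_of_pattern hw, w.2]
      · rw [edgeCount_eq_of_pattern hw', w'.2]
  · rintro ⟨w, w'⟩ - ⟨v, v'⟩ - hne
    rw [Function.onFun, Finset.disjoint_left]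
    intro π hπ hπ'
    simp only [Finset.mem_inter, circuitClass, Finset.mem_filter] at hπ hπ'
    apply hne
    rw [Prod.mk.injEq]
    exact ⟨Subtype.ext (Word.eq_of_pattern fun i j => (hπ.1.2 i j).trans (hπ'.1.2 i j).symm),
      Subtype.ext (Word.eq_of_pattern fun i j => (hπ.2.2 i j).trans (hπ'.2.2 i j).symm)⟩

theorem even_of_edgeCount {L : Link} {π : Fin (h + 1) → Fin n} (hπ : ∀ i, edgeCount L π i = 2) :
    Even h := by
  have e1 : (Finset.univ : Finset (Fin h)).card = h := by simp
  rw [← e1, Finset.card_eq_sum_card_image (L.edge π) Finset.univ]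
  refine Finset.even_sum _ fun γ hγ => ?_
  obtain ⟨a, -, rfl⟩ := Finset.mem_image.1 hγ
  exact ⟨1, hπ a⟩

/-- Sorting the circuits by their two words turns the limit into the sum of all word limits:
off-diagonal terms vanish and the diagonal counts Catalan words. For odd `h` nothing can be
pair-matched. -/
theorem tendsto_card_pairMatchedCircuits {LX LY : Link} (h1 : Compatible LX LY)
    (h2 : LeadsToWigner LX LY) {h : ℕ} (hh : h ≠ 0) :
    Tendsto (fun n => momentScale h n * (pairMatchedCircuits LX LY h n).card) atTop
      (𝓝 (semicircleMoment h)) := by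
  classical
  by_cases he : Even h
  · obtain ⟨k, hk⟩ := he
    obtain rfl : h = 2 * k := by omega
    have hk1 : 1 ≤ k := by omega
    have : Fintype {w : Word (2 * k) // w.PairMatched} := Fintype.ofFinite _
    have hlim : Tendsto (fun n : ℕ => ∑ w : {w : Word (2 * k) // w.PairMatched},
        ∑ w' : {w : Word (2 * k) // w.PairMatched},
          ((circuitClass LX w.1 n ∩ circuitClass LY w'.1 n).card : ℝ) / (n : ℝ) ^ (1 + k)) atTop
        (𝓝 (∑ w : {w : Word (2 * k) // w.PairMatched},
          ∑ w' : {w : Word (2 * k) // w.PairMatched},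
            if w = w' then if w.1.IsCatalan then 1 else 0 else 0)) := by
      refine tendsto_finsetSum _ fun w _ => tendsto_finsetSum _ fun w' _ => ?_
      split_ifs with hw hc
      · subst hw; exact ((h2 k hk1 w.1 w.2).1 hc).1
      · subst hw; exact ((h2 k hk1 w.1 w.2).2 hc).1
      · exact (h1.2.2 k w.1 w'.1 w.2 w'.2 fun hh => hw (Subtype.ext hh)).1
    have hval : (∑ w : {w : Word (2 * k) // w.PairMatched},
        ∑ w' : {w : Word (2 * k) // w.PairMatched},
          if w = w' then if w.1.IsCatalan then (1 : ℝ) else 0 else 0) =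
        semicircleMoment (2 * k) := by
      simp only [Finset.sum_ite_eq, Finset.mem_univ, if_true]
      rw [Finset.sum_boole, semicircleMoment, if_pos (even_two_mul k),
        Nat.mul_div_cancel_left _ two_pos, ← card_isCatalan hk1, ← Nat.card_eq_finsetCard]
      congr 1
      refine Nat.card_congr ⟨fun w => ⟨w.1.1, (Finset.mem_filter.1 w.2).2⟩,
        fun w => ⟨⟨w.1, w.2.pairMatched⟩, Finset.mem_filter.2 ⟨Finset.mem_univ _, w.2⟩⟩,
        fun _ => rfl, fun _ => rfl⟩
    rw [← hval]
    refine hlim.congr fun n => ?_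
    rw [card_pairMatchedCircuits, momentScale_two_mul]
    push_cast
    simp only [Finset.mul_sum]
    refine Finset.sum_congr rfl fun w _ => Finset.sum_congr rfl fun w' _ => ?_
    rw [div_eq_inv_mul]
  · have h0 : ∀ n, (pairMatchedCircuits LX LY h n).card = 0 := by
      intro n
      rw [Finset.card_eq_zero, pairMatchedCircuits, Finset.filter_eq_empty_iff]
      exact fun π _ hπ => he (even_of_edgeCount hπ.1)
    simp only [h0, semicircleMoment, if_neg he, Nat.cast_zero, mul_zero]
    exact tendsto_const_nhds

/-- The product of mean weights is 0 if some value of either link occurs once, and 1 if all values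
of both occur exactly twice. In the remaining case it is bounded, and the circuit is overmatched for
one of the links; there are too few such circuits to matter. -/
theorem tendsto_sum_meanWeight [IsProbabilityMeasure P] {y : ℕ → Ω → ℝ}
    (hx : IsBddStandardized P x C) (hy : IsBddStandardized P y C) {LX LY : Link}
    (h1 : Compatible LX LY) (h2 : LeadsToWigner LX LY) {h : ℕ} (hh : h ≠ 0) :
    Tendsto (fun n => momentScale h n *
      ∑ π ∈ circuits h n, meanWeight P x LX π * meanWeight P y LY π) atTop
      (𝓝 (semicircleMoment h)) := by
  classical
  obtain ⟨KX, hKX⟩ := card_overmatched_le h1.1 h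
  obtain ⟨KY, hKY⟩ := card_overmatched_le h1.2.1 h
  set f : ℕ → ℝ := fun n => (C ^ h * C ^ h) *
    ((overmatched LX h n).card + (overmatched LY h n).card) with hf
  have hC : 0 ≤ C ^ h * C ^ h := by have := hx.nonneg; positivity
  have hf0 : Tendsto (fun n => momentScale h n * f n) atTop (𝓝 0) := by
    refine tendsto_momentScale_mul_zero h (K := C ^ h * C ^ h * (KX + KY))
      (fun n => mul_nonneg hC (by positivity)) fun n hn => ?_
    rw [hf, mul_assoc]
    refine mul_le_mul_of_nonneg_left ?_ hC
    rw [add_mul]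
    exact add_le_add (hKX n hn) (hKY n hn)
  have hdiff : ∀ n, |momentScale h n *
      ∑ π ∈ circuits h n, meanWeight P x LX π * meanWeight P y LY π -
        momentScale h n * (pairMatchedCircuits LX LY h n).card| ≤ momentScale h n * f n := by
    intro n
    rw [← mul_sub, abs_mul, abs_of_nonneg (momentScale_nonneg h n)]
    refine mul_le_mul_of_nonneg_left ?_ (momentScale_nonneg h n)
    have e1 : ((pairMatchedCircuits LX LY h n).card : ℝ) = ∑ π ∈ circuits h n,
        if (∀ i, edgeCount LX π i = 2) ∧ ∀ i, edgeCount LY π i = 2 then (1 : ℝ) else 0 := by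
      rw [Finset.sum_boole, pairMatchedCircuits]
    have e2 : ∀ L : Link, ((overmatched L h n).card : ℝ) = ∑ π ∈ circuits h n,
        if (∀ i, 2 ≤ edgeCount L π i) ∧ ¬ ∀ i, edgeCount L π i = 2 then (1 : ℝ) else 0 := by
      intro L
      rw [Finset.sum_boole, overmatched]
    rw [e1, ← Finset.sum_sub_distrib, hf]
    simp only
    rw [e2, e2, ← Finset.sum_add_distrib, Finset.mul_sum]
    refine (Finset.abs_sum_le_sum_abs _ _).trans (Finset.sum_le_sum fun π _ => ?_)
    have hb : |meanWeight P x LX π * meanWeight P y LY π| ≤ C ^ h * C ^ h := by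
      rw [abs_mul]
      exact mul_le_mul (abs_meanWeight_le hx _ _) (abs_meanWeight_le hy _ _) (abs_nonneg _)
        (pow_nonneg hx.nonneg _)
    by_cases hX : ∀ i, 2 ≤ edgeCount LX π i
    · by_cases hY : ∀ i, 2 ≤ edgeCount LY π i
      · by_cases hX2 : ∀ i, edgeCount LX π i = 2
        · by_cases hY2 : ∀ i, edgeCount LY π i = 2
          · rw [if_pos ⟨hX2, hY2⟩, meanWeight_eq_one hx hX2, meanWeight_eq_one hy hY2]
            simp only [mul_one, sub_self, abs_zero]
            exact mul_nonneg hC (add_nonneg (by split_ifs <;> simp) (by split_ifs <;> simp))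
          · rw [if_neg (fun hh => hY2 hh.2), if_pos (⟨hY, hY2⟩ : _ ∧ _), sub_zero]
            refine hb.trans (le_mul_of_one_le_right hC ?_)
            split_ifs <;> norm_num
        · rw [if_neg (fun hh => hX2 hh.1), if_pos (⟨hX, hX2⟩ : _ ∧ _), sub_zero]
          refine hb.trans (le_mul_of_one_le_right hC ?_)
          split_ifs <;> norm_num
      · rw [meanWeight_eq_zero_of_edgeCount hy hY, mul_zero,
          if_neg (fun hh => hY fun i => (hh.2 i).ge)]
        simp only [sub_self, abs_zero]
        exact mul_nonneg hC (add_nonneg (by split_ifs <;> simp) (by split_ifs <;> simp))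
    · rw [meanWeight_eq_zero_of_edgeCount hx hX, zero_mul,
        if_neg (fun hh => hX fun i => (hh.1 i).ge)]
      simp only [sub_self, abs_zero]
      exact mul_nonneg hC (add_nonneg (by split_ifs <;> simp) (by split_ifs <;> simp))
  have := (tendsto_card_pairMatchedCircuits h1 h2 hh).add (squeeze_zero_norm hdiff hf0)
  rw [add_zero] at this
  exact this.congr fun n => by ring

end Mean

/-! ### Almost sure convergence of the moments, for bounded inputs -/

section AlmostSure

variable {Ω : Type*} [MeasurableSpace Ω] {P : Measure Ω} {C : ℝ}

/-- The series of the `g n` has finite expectation, hence converges almost surely. -/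
theorem ae_tendsto_zero_of_summable {g : ℕ → Ω → ℝ} (h0 : ∀ n ω, 0 ≤ g n ω)
    (hint : ∀ n, Integrable (g n) P) {b : ℕ → ℝ} (hb : Summable b)
    (hle : ∀ n, ∫ ω, g n ω ∂P ≤ b n) :
    ∀ᵐ ω ∂P, Tendsto (fun n => g n ω) atTop (𝓝 0) := by
  have hm : ∀ n, AEMeasurable (fun ω => ENNReal.ofReal (g n ω)) P := fun n =>
    (hint n).aestronglyMeasurable.aemeasurable.ennreal_ofReal
  have hfin : ∫⁻ ω, ∑' n, ENNReal.ofReal (g n ω) ∂P ≠ ∞ := by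
    rw [lintegral_tsum hm]
    refine ne_top_of_le_ne_top hb.tsum_ofReal_ne_top (ENNReal.tsum_le_tsum fun n => ?_)
    rw [← ofReal_integral_eq_lintegral_ofReal (hint n) (ae_of_all _ (h0 n))]
    exact ENNReal.ofReal_le_ofReal (hle n)
  filter_upwards [ae_lt_top' (AEMeasurable.tsum hm) hfin] with ω hω
  have h1 := ENNReal.tendsto_atTop_zero_of_tsum_ne_top hω.ne
  have h2 := (ENNReal.tendsto_toReal ENNReal.zero_ne_top).comp h1
  simpa [Function.comp_def, ENNReal.toReal_ofReal (h0 _ _)] using h2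

theorem ae_tendsto_zero_of_fourth_moment {f : ℕ → Ω → ℝ}
    (hint : ∀ n, n ≠ 0 → Integrable (fun ω => f n ω ^ 4) P) {K : ℝ}
    (hK : ∀ n, n ≠ 0 → ∫ ω, f n ω ^ 4 ∂P ≤ K * ((n : ℝ) ^ 2)⁻¹) :
    ∀ᵐ ω ∂P, Tendsto (fun n => f n ω) atTop (𝓝 0) := by
  have hs : Summable fun n : ℕ => K * (((n + 1 : ℕ) : ℝ) ^ 2)⁻¹ :=
    ((summable_nat_add_iff 1).2 (Real.summable_nat_pow_inv.2 one_lt_two)).mul_left K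
  have := ae_tendsto_zero_of_summable (P := P) (g := fun n ω => f (n + 1) ω ^ 4)
    (fun n ω => by positivity) (fun n => hint _ n.succ_ne_zero) hs
    (fun n => hK _ n.succ_ne_zero)
  filter_upwards [this] with ω hω
  rw [← tendsto_add_atTop_iff_nat 1]
  have h1 := hω.sqrt.sqrt
  simp only [Real.sqrt_zero] at h1
  rw [tendsto_zero_iff_abs_tendsto_zero]
  refine h1.congr fun n => ?_
  rw [show f (n + 1) ω ^ 4 = (f (n + 1) ω ^ 2) ^ 2 by ring, Real.sqrt_sq (sq_nonneg _),
    Real.sqrt_sq_eq_abs]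
  rfl

variable {x y : ℕ → Ω → ℝ}

theorem ae_tendsto_centred_sum [IsProbabilityMeasure P] (hx : IsBddStandardized P x C)
    {L : Link} (hL : PropertyB L) {β : Type*} [MeasurableSpace β] {z : Ω → β} (hz : Measurable z)
    (hxz : IndepFun (fun ω i => x i ω) z P) (h : ℕ)
    {a : ∀ n, (Fin (h + 1) → Fin n) → β → ℝ}
    (ha : ∀ n π, Measurable (a n π)) {B : ℝ} (haB : ∀ n π ω, |a n π (z ω)| ≤ B) :
    ∀ᵐ ω ∂P, Tendsto (fun n => momentScale h n * ∑ π ∈ circuits h n, a n π (z ω) *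
      (circuitWeight L π (fun i => x i ω) - meanWeight P x L π)) atTop (𝓝 0) := by
  obtain ⟨Δ, hΔ⟩ := hL
  have hmom : ∀ n, n ≠ 0 → _ := fun n hn =>
    have : NeZero n := ⟨hn⟩
    fourth_moment_le hx hΔ hz hxz (ha n) (haB n)
  refine ae_tendsto_zero_of_fourth_moment
    (K := (4 * h) ^ (4 * h) * (Δ + 1) ^ (4 * (h + 1)) * (B * (2 * C ^ h)) ^ 4) ?_ ?_
  · intro n hn
    simp only [mul_pow (momentScale h n)]
    exact (hmom n hn).1.const_mul _
  · intro n hn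
    simp only [mul_pow (momentScale h n)]
    rw [integral_const_mul]
    refine (mul_le_mul_of_nonneg_left (hmom n hn).2 (by positivity)).trans (le_of_eq ?_)
    have h0 : (n : ℝ) ≠ 0 := Nat.cast_ne_zero.2 hn
    have h1 : momentScale h n ^ 4 * (n : ℝ) ^ (2 * (h + 1)) = ((n : ℝ) ^ 2)⁻¹ := by
      have h2 := momentScale_sq_mul h hn
      refine eq_inv_of_mul_eq_one_left ?_
      calc momentScale h n ^ 4 * (n : ℝ) ^ (2 * (h + 1)) * (n : ℝ) ^ 2
          = (momentScale h n ^ 2 * (n : ℝ) ^ (h + 2)) ^ 2 := by ring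
        _ = 1 := by rw [h2, one_pow]
    rw [← h1]; ring

/-- Write `XY - EX EY = (X - EX) Y + EX (Y - EY)` for the weights along a circuit. Each of the two
centred sums tends to 0 almost surely by `ae_tendsto_centred_sum`, with the other factor as
coefficient. -/
theorem ae_tendsto_moment [IsProbabilityMeasure P] (hx : IsBddStandardized P x C)
    (hy : IsBddStandardized P y C) (hxy : IndepFun (fun ω i => x i ω) (fun ω i => y i ω) P)
    {LX LY : Link} (h1 : Compatible LX LY) (h2 : LeadsToWigner LX LY) (h : ℕ) :
    ∀ᵐ ω ∂P, Tendsto (fun n : ℕ => (n : ℝ)⁻¹ *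
      (scaledProduct LX LY n (fun i => x i ω) (fun i => y i ω) ^ h).trace) atTop
      (𝓝 (semicircleMoment h)) := by
  rcases eq_or_ne h 0 with rfl | hh
  · refine ae_of_all _ fun ω => ?_
    have : semicircleMoment 0 = 1 := by simp [semicircleMoment]
    rw [this]
    refine tendsto_const_nhds.congr' ?_
    filter_upwards [eventually_gt_atTop 0] with n hn
    have h0 : (n : ℝ) ≠ 0 := by positivity
    simp [h0]
  · have hxm : Measurable fun ω i => x i ω := measurable_pi_lambda _ hx.measurable
    have hym : Measurable fun ω i => y i ω := measurable_pi_lambda _ hy.measurable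
    have hU1 := ae_tendsto_centred_sum hx h1.1 hym hxy h
      (a := fun n π u => circuitWeight LY π u) (fun n π => measurable_circuitWeight LY π)
      (B := C ^ h) fun n π ω => abs_circuitWeight_le LY π fun i => hy.abs_le i ω
    have hU2 := ae_tendsto_centred_sum hy h1.2.1 hxm hxy.symm h
      (a := fun n π _ => meanWeight P x LX π) (fun n π => measurable_const)
      (B := C ^ h) fun n π ω => abs_meanWeight_le hx LX π
    have hE := tendsto_sum_meanWeight hx hy h1 h2 hh
    filter_upwards [hU1, hU2] with ω hω1 hω2
    have := (hω1.add hω2).add hE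
    rw [add_zero, zero_add] at this
    refine this.congr fun n => ?_
    rw [trace_scaledProduct_pow, ← mul_add, ← mul_add, ← Finset.sum_add_distrib,
      ← Finset.sum_add_distrib]
    congr 1
    refine Finset.sum_congr rfl fun π _ => ?_
    ring

end AlmostSure

/-! ### Standardized truncations -/

section Truncation

variable {Ω : Type*} [MeasurableSpace Ω] {P : Measure Ω}

/-- Truncation to `0` outside `[-M, M]`. -/
noncomputable def hardTrunc (M t : ℝ) : ℝ := if |t| ≤ M then t else 0

theorem measurable_hardTrunc (M : ℝ) : Measurable (hardTrunc M) :=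
  Measurable.ite (measurableSet_le measurable_id.abs measurable_const) measurable_id
    measurable_const

theorem abs_hardTrunc_le {M : ℝ} (hM : 0 ≤ M) (t : ℝ) : |hardTrunc M t| ≤ M := by
  unfold hardTrunc; split_ifs with h
  · exact h
  · simpa using hM

theorem mul_hardTrunc (M t : ℝ) : t * hardTrunc M t = hardTrunc M t ^ 2 := by
  unfold hardTrunc; split_ifs <;> ring

theorem sub_hardTrunc_sq (M t : ℝ) : (t - hardTrunc M t) ^ 2 = t ^ 2 - hardTrunc M t ^ 2 := by
  unfold hardTrunc; split_ifs <;> ring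

/-- The variance of a truncation. -/
noncomputable def truncVar (P : Measure Ω) (X : Ω → ℝ) (M : ℝ) : ℝ :=
  ∫ ω, hardTrunc M (X ω) ^ 2 ∂P - (∫ ω, hardTrunc M (X ω) ∂P) ^ 2

/-- The standardization of a truncation. -/
noncomputable def stdTrunc (P : Measure Ω) (X : Ω → ℝ) (M t : ℝ) : ℝ :=
  (hardTrunc M t - ∫ ω, hardTrunc M (X ω) ∂P) / Real.sqrt (truncVar P X M)

theorem measurable_stdTrunc (X : Ω → ℝ) (M : ℝ) : Measurable (stdTrunc P X M) :=
  ((measurable_hardTrunc M).sub_const _).div_const _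

/-- Let `m`, `q` and `s²` be the mean, second moment and variance of the truncation. Then `1 - q ≤
δ`, and `m² ≤ δ` because `m` is minus the mean of the tail, so `s² ≥ 1 - 2δ ≥ 1/2`. This gives `s ≥
1/2` and the bound `2M / s ≤ 4M`. As `X` times its truncation is the square of the truncation, the
`L²` error is `2 - 2q / s ≤ 2 - 2s ≤ 4δ`. -/
theorem stdTrunc_spec [IsProbabilityMeasure P] {X : Ω → ℝ} (hX : Measurable X) (hX2 : MemLp X 2 P)
    (hmean : ∫ ω, X ω ∂P = 0) (hsq : ∫ ω, X ω ^ 2 ∂P = 1) {M δ : ℝ} (hM : 0 ≤ M) (hδ : δ ≤ 1 / 4)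
    (htail : ∫ ω, (X ω - hardTrunc M (X ω)) ^ 2 ∂P ≤ δ) :
    (∀ t, |stdTrunc P X M t| ≤ 4 * M) ∧ ∫ ω, stdTrunc P X M (X ω) ∂P = 0 ∧
      ∫ ω, stdTrunc P X M (X ω) ^ 2 ∂P = 1 ∧
      Integrable (fun ω => (X ω - stdTrunc P X M (X ω)) ^ 2) P ∧
      ∫ ω, (X ω - stdTrunc P X M (X ω)) ^ 2 ∂P ≤ 4 * δ := by
  have hTm : Measurable fun ω => hardTrunc M (X ω) := (measurable_hardTrunc M).comp hX
  have hT : MemLp (fun ω => hardTrunc M (X ω)) 2 P :=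
    MemLp.of_bound hTm.aestronglyMeasurable M (ae_of_all _ fun ω => abs_hardTrunc_le hM _)
  have hTi : Integrable (fun ω => hardTrunc M (X ω)) P := hT.integrable one_le_two
  have hXi : Integrable X P := hX2.integrable one_le_two
  have hT2 : Integrable (fun ω => hardTrunc M (X ω) ^ 2) P := hT.integrable_sq
  have hXsq : Integrable (fun ω => X ω ^ 2) P := hX2.integrable_sq
  have hvar := variance_nonneg (fun ω => X ω - hardTrunc M (X ω)) P
  rw [variance_eq_sub (X := fun ω => X ω - hardTrunc M (X ω)) (hX2.sub hT)] at hvar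
  simp only [Pi.pow_apply] at hvar
  rw [integral_sub hXi hTi, hmean, zero_sub, neg_sq] at hvar
  have htail' : 1 - ∫ ω, hardTrunc M (X ω) ^ 2 ∂P =
      ∫ ω, (X ω - hardTrunc M (X ω)) ^ 2 ∂P := by
    simp only [sub_hardTrunc_sq]
    rw [integral_sub hXsq hT2, hsq]
  have htail0 : 0 ≤ ∫ ω, (X ω - hardTrunc M (X ω)) ^ 2 ∂P := integral_nonneg fun ω => sq_nonneg _
  have hs2 : truncVar P X M = ∫ ω, hardTrunc M (X ω) ^ 2 ∂P - (∫ ω, hardTrunc M (X ω) ∂P) ^ 2 := rfl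
  have hmabs : |∫ ω, hardTrunc M (X ω) ∂P| ≤ M := by
    have := norm_integral_le_of_norm_le_const (μ := P) (C := M)
      (f := fun ω => hardTrunc M (X ω)) (ae_of_all _ fun ω => abs_hardTrunc_le hM _)
    simpa using this
  have hdef : ∀ t, stdTrunc P X M t =
      (hardTrunc M t - ∫ ω, hardTrunc M (X ω) ∂P) / Real.sqrt (truncVar P X M) := fun t => rfl
  set q := ∫ ω, hardTrunc M (X ω) ^ 2 ∂P
  set m := ∫ ω, hardTrunc M (X ω) ∂P
  set s := Real.sqrt (truncVar P X M)
  have hs2lo : 1 / 2 ≤ truncVar P X M := by rw [hs2]; linarith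
  have hs2hi : truncVar P X M ≤ 1 := by rw [hs2]; nlinarith [sq_nonneg m]
  have hss : s ^ 2 = truncVar P X M := Real.sq_sqrt (by linarith)
  have hs0 : 0 ≤ s := Real.sqrt_nonneg _
  have hs1 : s ≤ 1 := by nlinarith
  have hslo : truncVar P X M ≤ s := by nlinarith
  have hspos : 0 < s := by linarith
  have hb : ∀ t, |stdTrunc P X M t| ≤ 4 * M := by
    intro t
    rw [hdef, abs_div, abs_of_pos hspos, div_le_iff₀ hspos]
    have h1 := abs_sub (hardTrunc M t) m
    have h2 := abs_hardTrunc_le hM t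
    nlinarith
  have hGm : Measurable fun ω => stdTrunc P X M (X ω) := (measurable_stdTrunc X M).comp hX
  have hG : MemLp (fun ω => stdTrunc P X M (X ω)) 2 P :=
    MemLp.of_bound hGm.aestronglyMeasurable (4 * M) (ae_of_all _ fun ω => hb _)
  have hGsq : ∫ ω, stdTrunc P X M (X ω) ^ 2 ∂P = 1 := by
    have h1 : ∀ ω, stdTrunc P X M (X ω) ^ 2 =
        (hardTrunc M (X ω) ^ 2 - 2 * m * hardTrunc M (X ω) + m ^ 2) / s ^ 2 := by
      intro ω; rw [hdef, div_pow]; ring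
    have h2 : Integrable (fun ω => hardTrunc M (X ω) ^ 2 - 2 * m * hardTrunc M (X ω)) P :=
      hT2.sub (hTi.const_mul _)
    simp only [h1]
    rw [integral_div, integral_add h2 (integrable_const _),
      integral_sub hT2 (hTi.const_mul _), integral_const_mul, integral_const, hss, hs2]
    rw [hs2] at hs2lo
    rw [div_eq_one_iff_eq (by linarith)]
    simp only [probReal_univ, one_smul]
    ring
  have hXT : Integrable (fun ω => X ω * stdTrunc P X M (X ω)) P := hX2.integrable_mul hG
  have hXG : ∫ ω, X ω * stdTrunc P X M (X ω) ∂P = q / s := by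
    have h1 : ∀ ω, X ω * stdTrunc P X M (X ω) = (hardTrunc M (X ω) ^ 2 - m * X ω) / s := by
      intro ω; rw [hdef, ← mul_hardTrunc]; ring
    simp only [h1]
    rw [integral_div, integral_sub hT2 (hXi.const_mul _), integral_const_mul, hmean, mul_zero,
      sub_zero]
  refine ⟨hb, ?_, hGsq, (hX2.sub hG).integrable_sq, ?_⟩
  · simp only [hdef]
    rw [integral_div, integral_sub hTi (integrable_const _)]
    simp [m]
  · have h1 : ∀ ω, (X ω - stdTrunc P X M (X ω)) ^ 2 = X ω ^ 2 + stdTrunc P X M (X ω) ^ 2 -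
        2 * (X ω * stdTrunc P X M (X ω)) := fun ω => by ring
    have h3 : Integrable (fun ω => X ω ^ 2 + stdTrunc P X M (X ω) ^ 2) P :=
      hXsq.add hG.integrable_sq
    simp only [h1]
    rw [integral_sub h3 (hXT.const_mul _),
      integral_add hXsq hG.integrable_sq, integral_const_mul, hsq, hGsq, hXG]
    have h2 : s ≤ q / s := by
      rw [le_div_iff₀ hspos, ← sq, hss, hs2]
      nlinarith [sq_nonneg m]
    linarith

theorem IsStandardized.integral_sq [IsProbabilityMeasure P] {x : ℕ → Ω → ℝ}
    (hx : IsStandardized P x) (i : ℕ) :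
    ∫ ω, x i ω ^ 2 ∂P = 1 := by
  have h1 := hx.variance i
  rw [variance_eq_sub (hx.memLp i), hx.mean i] at h1
  simpa using h1

theorem IsStandardized.isBddStandardized_stdTrunc [IsProbabilityMeasure P] {x : ℕ → Ω → ℝ}
    (hx : IsStandardized P x)
    {M δ : ℝ} (hM : 0 ≤ M) (hδ : δ ≤ 1 / 4)
    (htail : ∀ i, ∫ ω, (x i ω - hardTrunc M (x i ω)) ^ 2 ∂P ≤ δ) :
    IsBddStandardized P (fun i ω => stdTrunc P (x i) M (x i ω)) (4 * M) := by
  have h := fun i => stdTrunc_spec (hx.measurable i) (hx.memLp i) (hx.mean i) (hx.integral_sq i) hM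
    hδ (htail i)
  exact ⟨by positivity, fun i => (measurable_stdTrunc _ _).comp (hx.measurable i),
    fun i ω => (h i).1 _, fun i => (h i).2.1, fun i => (h i).2.2.1,
    hx.indep.comp _ fun i => measurable_stdTrunc (x i) M⟩

/-! ### Laws of large numbers -/

/-- Along `N = 2 ^ m` the variance of the normalized sum is `O(2 ^ (-m))`, which is summable, so
these sums are eventually at most `2a * 2 ^ m`. As the terms are nonnegative, a general `N` is
compared with the next power of two, which is at most `2N`; hence the factor 4. -/
theorem ae_eventually_sum_le_of_bdd_second_moment [IsProbabilityMeasure P] {u : ℕ → Ω → ℝ}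
    (h0 : ∀ i ω, 0 ≤ u i ω)
    (hu : ∀ i, MemLp (u i) 2 P) (hind : Pairwise fun i j => IndepFun (u i) (u j) P) {a V : ℝ}
    (ha : 0 < a) (hua : ∀ i, ∫ ω, u i ω ∂P ≤ a) (hV : ∀ i, ∫ ω, u i ω ^ 2 ∂P ≤ V) :
    ∀ᵐ ω ∂P, ∀ᶠ N : ℕ in atTop, ∑ i ∈ Finset.range N, u i ω ≤ 4 * a * N := by
  have hS : ∀ N : ℕ, MemLp (∑ i ∈ Finset.range N, u i) 2 P := fun N =>
    memLp_finsetSum' _ fun i _ => hu i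
  have hES : ∀ N : ℕ, ∫ ω, (∑ i ∈ Finset.range N, u i) ω ∂P ≤ a * N := by
    intro N
    simp only [Finset.sum_apply]
    rw [integral_finsetSum _ fun i _ => (hu i).integrable one_le_two]
    refine (Finset.sum_le_sum fun i _ => hua i).trans ?_
    simp [mul_comm]
  have hvar : ∀ N : ℕ, Var[∑ i ∈ Finset.range N, u i; P] ≤ V * N := by
    intro N
    rw [IndepFun.variance_sum (fun i _ => hu i) fun i _ j _ hij => hind hij]
    refine (Finset.sum_le_sum fun i _ =>
      (variance_le_expectation_sq (hu i).aestronglyMeasurable).trans (hV i)).trans ?_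
    simp [mul_comm]
  have hae := ae_tendsto_zero_of_summable (P := P) (g := fun m ω =>
      (((∑ i ∈ Finset.range (2 ^ m), u i) ω - ∫ ω, (∑ i ∈ Finset.range (2 ^ m), u i) ω ∂P) ^ 2) /
        (2 ^ m) ^ 2) (b := fun m => V * (1 / 2) ^ m)
    (fun m ω => by positivity)
    (fun m => (((hS _).sub (memLp_const _)).integrable_sq).div_const _)
    ((summable_geometric_of_lt_one (by norm_num) (by norm_num)).mul_left V) (by
      intro m
      rw [integral_div, ← variance_eq_integral (hS _).aemeasurable, div_le_iff₀ (by positivity)]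
      refine (hvar _).trans (le_of_eq ?_)
      push_cast
      rw [one_div, inv_pow]
      field_simp)
  filter_upwards [hae] with ω hω
  obtain ⟨m₀, hm₀⟩ := eventually_atTop.1 (hω.eventually (gt_mem_nhds (pow_pos ha 2)))
  filter_upwards [eventually_ge_atTop (2 ^ m₀ + 2)] with N hN
  have h0' : 1 ≤ 2 ^ m₀ := Nat.one_le_two_pow
  have h1 : N ≤ 2 ^ Nat.clog 2 N := Nat.le_pow_clog one_lt_two N
  have h2 : 2 ^ (Nat.clog 2 N).pred < N := Nat.pow_pred_clog_lt_self one_lt_two (by omega)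
  have h3 : m₀ ≤ Nat.clog 2 N := by
    refine (Nat.pow_le_pow_iff_right one_lt_two).1 ?_
    omega
  have h4 : 0 < Nat.clog 2 N := Nat.clog_pos one_lt_two (by omega)
  have h5 : 2 ^ Nat.clog 2 N ≤ 2 * N := by
    have : 2 ^ Nat.clog 2 N = 2 * 2 ^ (Nat.clog 2 N).pred := by
      rw [← pow_succ', Nat.pred_eq_sub_one, Nat.sub_add_cancel h4]
    omega
  have h6 := hm₀ _ h3
  set m := Nat.clog 2 N
  rw [div_lt_iff₀ (by positivity), ← mul_pow] at h6
  have h7 := (abs_lt.1 (abs_lt_of_sq_lt_sq h6 (by positivity))).2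
  have h8 := hES (2 ^ m)
  have h9 : ∑ i ∈ Finset.range N, u i ω ≤ (∑ i ∈ Finset.range (2 ^ m), u i) ω := by
    rw [Finset.sum_apply]
    exact Finset.sum_le_sum_of_subset_of_nonneg (Finset.range_mono h1) fun i _ _ => h0 i ω
  have h10 : ((2 ^ m : ℕ) : ℝ) ≤ 2 * N := by exact_mod_cast h5
  push_cast at h8 h10
  nlinarith

theorem ae_eventually_sum_le_of_identDistrib {u : ℕ → Ω → ℝ} (hu : Integrable (u 0) P)
    (hind : Pairwise fun i j => IndepFun (u i) (u j) P)
    (hid : ∀ i, IdentDistrib (u i) (u 0) P P) {a : ℝ} (ha : 0 < a) (hua : ∫ ω, u 0 ω ∂P ≤ a) :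
    ∀ᵐ ω ∂P, ∀ᶠ N : ℕ in atTop, ∑ i ∈ Finset.range N, u i ω ≤ 4 * a * N := by
  filter_upwards [strong_law_ae_real u hu hind hid] with ω hω
  filter_upwards [hω.eventually (gt_mem_nhds (show P[u 0] < 4 * a by linarith)),
    eventually_gt_atTop 0] with N hN hN0
  rw [div_lt_iff₀ (by exact_mod_cast hN0)] at hN
  exact hN.le

/-! ### Approximation by bounded inputs -/

theorem AssumptionA1.assumptionA3 [IsProbabilityMeasure P] {x : ℕ → Ω → ℝ}
    (h : AssumptionA1 P x) : AssumptionA3 P x := by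
  obtain ⟨hx, C, hC⟩ := h
  refine ⟨hx, fun p => ⟨C ^ p, fun i => ?_⟩⟩
  have hb : ∀ᵐ ω ∂P, ‖|x i ω| ^ p‖ ≤ C ^ p := by
    filter_upwards [hC i] with ω hω
    rw [Real.norm_eq_abs, abs_of_nonneg (by positivity)]
    exact pow_le_pow_left₀ (abs_nonneg _) hω p
  refine ⟨Integrable.of_bound ((hx.measurable i).abs.pow_const p).aestronglyMeasurable _ hb, ?_⟩
  have := norm_integral_le_of_norm_le_const hb
  rw [probReal_univ, mul_one] at this
  exact (le_abs_self _).trans this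

theorem exists_tail_le {X : Ω → ℝ} (hX : Measurable X) (hX2 : MemLp X 2 P) {δ : ℝ} (hδ : 0 < δ) :
    ∃ M : ℝ, 0 ≤ M ∧ ∫ ω, (X ω - hardTrunc M (X ω)) ^ 2 ∂P ≤ δ := by
  have h1 : Tendsto (fun n : ℕ => ∫ ω, (X ω - hardTrunc n (X ω)) ^ 2 ∂P) atTop
      (𝓝 (∫ _, (0 : ℝ) ∂P)) := by
    refine tendsto_integral_of_dominated_convergence (fun ω => X ω ^ 2)
      (fun n => ((hX.sub ((measurable_hardTrunc n).comp hX)).pow_const 2).aestronglyMeasurable)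
      hX2.integrable_sq (fun n => ae_of_all _ fun ω => ?_) (ae_of_all _ fun ω => ?_)
    · rw [Real.norm_eq_abs, abs_of_nonneg (sq_nonneg _), sub_hardTrunc_sq]
      nlinarith [sq_nonneg (hardTrunc n (X ω))]
    · obtain ⟨n₀, hn₀⟩ := exists_nat_ge |X ω|
      refine tendsto_const_nhds.congr' ?_
      filter_upwards [eventually_ge_atTop n₀] with n hn
      have : |X ω| ≤ n := hn₀.trans (by exact_mod_cast hn)
      simp [hardTrunc, this]
  rw [integral_zero] at h1
  obtain ⟨n, hn⟩ := (h1.eventually (gt_mem_nhds hδ)).exists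
  exact ⟨n, Nat.cast_nonneg n, hn.le⟩

/-- The inputs are close, in mean square along the sequence, to bounded ones. -/
def HasBddApprox (P : Measure Ω) (x : ℕ → Ω → ℝ) : Prop :=
  ∀ ε > 0, ∃ (C : ℝ) (g : ℕ → ℝ → ℝ), (∀ i, Measurable (g i)) ∧
    IsBddStandardized P (fun i ω => g i (x i ω)) C ∧
    ∀ᵐ ω ∂P, ∀ᶠ N : ℕ in atTop,
      ∑ i ∈ Finset.range N, (x i ω - g i (x i ω)) ^ 2 ≤ ε * N

/-- A common law gives one truncation level and one standardized truncation for all inputs, and the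
strong law of large numbers controls the errors without moments beyond the second. -/
theorem AssumptionA2.hasBddApprox [IsProbabilityMeasure P] {x : ℕ → Ω → ℝ}
    (h : AssumptionA2 P x) : HasBddApprox P x := by
  obtain ⟨hx, hid⟩ := h
  intro ε hε
  -- Truncation loses a factor 4 in `L²`, and the law of large numbers another 4.
  set δ := min (1 / 4) (ε / 16) with hδ
  have hδ0 : 0 < δ := lt_min (by norm_num) (by positivity)
  have hδ1 : δ ≤ 1 / 4 := min_le_left _ _
  have hδ2 : δ ≤ ε / 16 := min_le_right _ _
  obtain ⟨M, hM, hM0⟩ := exists_tail_le (hx.measurable 0) (hx.memLp 0) hδ0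
  have htail : ∀ i, ∫ ω, (x i ω - hardTrunc M (x i ω)) ^ 2 ∂P ≤ δ := by
    intro i
    refine le_trans (le_of_eq ?_) hM0
    exact ((hid i).comp ((measurable_id.sub (measurable_hardTrunc M)).pow_const 2)).integral_eq
  have hg : ∀ i, stdTrunc P (x i) M = stdTrunc P (x 0) M := by
    intro i
    have h1 : ∫ ω, hardTrunc M (x i ω) ∂P = ∫ ω, hardTrunc M (x 0 ω) ∂P :=
      ((hid i).comp (measurable_hardTrunc M)).integral_eq
    have h2 : ∫ ω, hardTrunc M (x i ω) ^ 2 ∂P = ∫ ω, hardTrunc M (x 0 ω) ^ 2 ∂P :=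
      ((hid i).comp ((measurable_hardTrunc M).pow_const 2)).integral_eq
    funext t
    simp only [stdTrunc, truncVar, h1, h2]
  have hspec := stdTrunc_spec (hx.measurable 0) (hx.memLp 0) (hx.mean 0) (hx.integral_sq 0) hM
    hδ1 (htail 0)
  refine ⟨4 * M, fun i => stdTrunc P (x i) M, fun i => measurable_stdTrunc _ _,
    hx.isBddStandardized_stdTrunc hM hδ1 htail, ?_⟩
  have hφ : Measurable fun t => (t - stdTrunc P (x 0) M t) ^ 2 :=
    (measurable_id.sub (measurable_stdTrunc _ _)).pow_const 2
  have key := ae_eventually_sum_le_of_identDistrib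
    (u := fun i ω => (x i ω - stdTrunc P (x 0) M (x i ω)) ^ 2) hspec.2.2.2.1
    (fun i j hij => (hx.indep.indepFun hij).comp hφ hφ) (fun i => (hid i).comp hφ)
    (a := 4 * δ) (by positivity) hspec.2.2.2.2
  filter_upwards [key] with ω hω
  filter_upwards [hω] with N hN
  simp only [hg]
  refine hN.trans (mul_le_mul_of_nonneg_right ?_ (Nat.cast_nonneg N))
  linarith

/-- Fourth moments are used twice: they make the tails uniformly small, since `x² ≤ x⁴ / M` where
`|x| > M ≥ 1`, and they bound the second moments of the squared errors. -/
theorem AssumptionA3.hasBddApprox [IsProbabilityMeasure P] {x : ℕ → Ω → ℝ}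
    (h : AssumptionA3 P x) : HasBddApprox P x := by
  obtain ⟨hx, hmom⟩ := h
  intro ε hε
  set δ := min (1 / 4) (ε / 16) with hδ
  have hδ0 : 0 < δ := lt_min (by norm_num) (by positivity)
  have hδ1 : δ ≤ 1 / 4 := min_le_left _ _
  have hδ2 : δ ≤ ε / 16 := min_le_right _ _
  obtain ⟨C, hC⟩ := hmom 4
  have hC' : ∀ i, Integrable (fun ω => x i ω ^ 4) P ∧ ∫ ω, x i ω ^ 4 ∂P ≤ C := by
    intro i
    have := hC i
    simpa only [Even.pow_abs (show Even 4 by decide)] using this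
  set M := max 1 (C / δ) with hMdef
  have hM1 : 1 ≤ M := le_max_left _ _
  have hM : 0 ≤ M := by linarith
  have htail : ∀ i, ∫ ω, (x i ω - hardTrunc M (x i ω)) ^ 2 ∂P ≤ δ := by
    intro i
    have h1 : ∫ ω, (x i ω - hardTrunc M (x i ω)) ^ 2 ∂P ≤ ∫ ω, x i ω ^ 4 / M ∂P := by
      refine integral_mono_of_nonneg (ae_of_all _ fun ω => sq_nonneg _) ((hC' i).1.div_const _)
        (ae_of_all _ fun ω => ?_)
      simp only
      rw [le_div_iff₀ (by linarith)]
      unfold hardTrunc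
      split_ifs with hh
      · rw [sub_self]
        nlinarith [pow_nonneg (sq_nonneg (x i ω)) 2]
      · push Not at hh
        have h2 : M ≤ x i ω ^ 2 := by
          rw [← sq_abs]; nlinarith
        have h3 : x i ω ^ 4 = x i ω ^ 2 * x i ω ^ 2 := by ring
        rw [sub_zero, h3]
        exact mul_le_mul_of_nonneg_left h2 (sq_nonneg _)
    rw [integral_div] at h1
    refine h1.trans ?_
    rw [div_le_iff₀ (by linarith)]
    refine (hC' i).2.trans ?_
    have : C / δ ≤ M := le_max_right _ _
    rw [div_le_iff₀ hδ0] at this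
    linarith
  have hspec := fun i => stdTrunc_spec (hx.measurable i) (hx.memLp i) (hx.mean i)
    (hx.integral_sq i) hM hδ1 (htail i)
  refine ⟨4 * M, fun i => stdTrunc P (x i) M, fun i => measurable_stdTrunc _ _,
    hx.isBddStandardized_stdTrunc hM hδ1 htail, ?_⟩
  have hφ : ∀ i, Measurable fun t => (t - stdTrunc P (x i) M t) ^ 2 := fun i =>
    (measurable_id.sub (measurable_stdTrunc _ _)).pow_const 2
  have hum : ∀ i, Measurable fun ω => (x i ω - stdTrunc P (x i) M (x i ω)) ^ 2 := fun i =>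
    (hφ i).comp (hx.measurable i)
  have hle : ∀ i ω, ((x i ω - stdTrunc P (x i) M (x i ω)) ^ 2) ^ 2 ≤
      8 * (x i ω ^ 4 + (4 * M) ^ 4) := by
    intro i ω
    have h1 : stdTrunc P (x i) M (x i ω) ^ 4 ≤ (4 * M) ^ 4 := by
      rw [← Even.pow_abs (show Even 4 by decide)]
      exact pow_le_pow_left₀ (abs_nonneg _) ((hspec i).1 _) 4
    have h2 : ∀ a b : ℝ, ((a - b) ^ 2) ^ 2 ≤ 8 * (a ^ 4 + b ^ 4) := by
      intro a b
      nlinarith [sq_nonneg (a + b), sq_nonneg (a ^ 2 - b ^ 2), sq_nonneg ((a + b) ^ 2),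
        mul_nonneg (sq_nonneg (a + b)) (sq_nonneg (a - b)), sq_nonneg (a ^ 2 + b ^ 2)]
    linarith [h2 (x i ω) (stdTrunc P (x i) M (x i ω))]
  have hbi : ∀ i, Integrable (fun ω => 8 * (x i ω ^ 4 + (4 * M) ^ 4)) P := fun i =>
    ((hC' i).1.add (integrable_const _)).const_mul _
  have hint : ∀ i, Integrable (fun ω => ((x i ω - stdTrunc P (x i) M (x i ω)) ^ 2) ^ 2) P :=
    fun i => (hbi i).mono' ((hum i).pow_const 2).aestronglyMeasurable (ae_of_all _ fun ω => by
      rw [Real.norm_eq_abs, abs_of_nonneg (sq_nonneg _)]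
      exact hle i ω)
  have key := ae_eventually_sum_le_of_bdd_second_moment (P := P)
    (u := fun i ω => (x i ω - stdTrunc P (x i) M (x i ω)) ^ 2) (fun i ω => sq_nonneg _)
    (fun i => (memLp_two_iff_integrable_sq (hum i).aestronglyMeasurable).2 (hint i))
    (fun i j hij => (hx.indep.indepFun hij).comp (hφ i) (hφ j))
    (a := 4 * δ) (V := 8 * (C + (4 * M) ^ 4)) (by positivity) (fun i => (hspec i).2.2.2.2) (by
      intro i
      refine (integral_mono (hint i) (hbi i) (hle i)).trans ?_
      rw [integral_const_mul, integral_add (hC' i).1 (integrable_const _)]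
      simp only [integral_const, probReal_univ, one_smul]
      linarith [(hC' i).2])
  filter_upwards [key] with ω hω
  filter_upwards [hω] with N hN
  refine hN.trans (mul_le_mul_of_nonneg_right ?_ (Nat.cast_nonneg N))
  linarith

theorem hasBddApprox_of_assumptions [IsProbabilityMeasure P] {x : ℕ → Ω → ℝ}
    (h : AssumptionA1 P x ∨ AssumptionA2 P x ∨ AssumptionA3 P x) : HasBddApprox P x := by
  rcases h with h | h | h
  · exact h.assumptionA3.hasBddApprox
  · exact h.hasBddApprox
  · exact h.hasBddApprox

theorem HasBddApprox.exists_sum_sq_le {x : ℕ → Ω → ℝ} (h : HasBddApprox P x) :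
    ∃ K : ℝ, 0 ≤ K ∧ ∀ᵐ ω ∂P, ∀ᶠ N : ℕ in atTop, ∑ i ∈ Finset.range N, x i ω ^ 2 ≤ K * N := by
  obtain ⟨C, g, -, hb, hg⟩ := h 1 one_pos
  refine ⟨2 + 2 * C ^ 2, by positivity, ?_⟩
  filter_upwards [hg] with ω hω
  filter_upwards [hω] with N hN
  calc ∑ i ∈ Finset.range N, x i ω ^ 2
      ≤ ∑ i ∈ Finset.range N, (2 * (x i ω - g i (x i ω)) ^ 2 + 2 * C ^ 2) := by
        refine Finset.sum_le_sum fun i _ => ?_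
        have h1 : g i (x i ω) ^ 2 ≤ C ^ 2 := sq_le_sq' (abs_le.1 (hb.abs_le i ω)).1
          (abs_le.1 (hb.abs_le i ω)).2
        nlinarith [sq_nonneg (x i ω - 2 * g i (x i ω))]
    _ = 2 * ∑ i ∈ Finset.range N, (x i ω - g i (x i ω)) ^ 2 + N * (2 * C ^ 2) := by
        rw [Finset.sum_add_distrib, ← Finset.mul_sum]
        simp
    _ ≤ _ := by linarith

end Truncation

/-! ### Sums over the entries of patterned matrices -/

section EntrySums

variable {n : ℕ}

theorem card_sub_add_eq_le [NeZero n] (a b : ZMod n) :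
    (Finset.univ.filter fun z : ZMod n × ZMod n => z.1 - z.2 = a ∧ z.1 + z.2 = b).card ≤ 4 := by
  rcases Finset.eq_empty_or_nonempty
    (Finset.univ.filter fun z : ZMod n × ZMod n => z.1 - z.2 = a ∧ z.1 + z.2 = b) with h | ⟨z₀, h⟩
  · simp [h]
  · simp only [Finset.mem_filter, Finset.mem_univ, true_and] at h
    refine (Finset.card_le_card_of_injOn Prod.fst ?_ ?_).trans (card_filter_nsmul_sub_le z₀.1)
    · intro z hz
      simp only [Finset.coe_filter, Finset.mem_univ, true_and, Set.mem_ofPred_eq] at hz ⊢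
      linear_combination 2 * (hz.1 + hz.2) - 2 * (h.1 + h.2)
    · intro z hz z' hz' hzz
      simp only [Finset.coe_filter, Finset.mem_univ, true_and, Set.mem_ofPred_eq] at hz hz'
      refine Prod.ext hzz ?_
      linear_combination -hz.1 + hz'.1 + hzz

/-- The two values determine `i - j` and `i + j` modulo `n` up to signs, four combinations in all.
Each has at most 4 solutions, since `2i` is then determined. -/
theorem card_entries_le {LX LY : Link} (hX : IsDiffLink LX) (hY : IsSumLink LY) (d s : ℕ) :
    (Finset.univ.filter fun p : Fin n × Fin n =>
      LX.val n (p.1 + 1) (p.2 + 1) = d ∧ LY.val n (p.1 + 1) (p.2 + 1) = s).card ≤ 16 := by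
  classical
  set F := Finset.univ.filter fun p : Fin n × Fin n =>
    LX.val n (p.1 + 1) (p.2 + 1) = d ∧ LY.val n (p.1 + 1) (p.2 + 1) = s with hF
  rcases F.eq_empty_or_nonempty with h | ⟨p₀, h⟩
  · simp [h]
  · have : NeZero n := ⟨fun h0 => by subst h0; exact p₀.1.elim0⟩
    have hmem : ∀ i : Fin n, (i : ℕ) + 1 ∈ Finset.Icc 1 n := fun i => by
      rw [Finset.mem_Icc]; omega
    let ψ : Fin n × Fin n → ZMod n × ZMod n := fun p =>
      (((p.1 + 1 : ℕ) : ZMod n), ((p.2 + 1 : ℕ) : ZMod n))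
    have hψ : Function.Injective ψ := by
      rintro ⟨i, j⟩ ⟨i', j'⟩ hh
      rw [Prod.mk.injEq] at hh
      have h1 := cast_zmod_injOn n (hmem i) (hmem i') hh.1
      have h2 := cast_zmod_injOn n (hmem j) (hmem j') hh.2
      exact Prod.ext (Fin.ext (by simpa using h1)) (Fin.ext (by simpa using h2))
    rw [← Finset.card_image_of_injective F hψ]
    set a := (ψ p₀).1 - (ψ p₀).2
    set b := (ψ p₀).1 + (ψ p₀).2
    have hsub : F.image ψ ⊆ (({a, -a} : Finset (ZMod n)) ×ˢ {b, -b}).biUnion fun c =>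
        Finset.univ.filter fun z : ZMod n × ZMod n => z.1 - z.2 = c.1 ∧ z.1 + z.2 = c.2 := by
      intro z hz
      obtain ⟨p, hp, rfl⟩ := Finset.mem_image.1 hz
      rw [hF, Finset.mem_filter] at hp h
      have h1 := hX n _ _ _ _ (hmem p.1) (hmem p.2) (hmem p₀.1) (hmem p₀.2)
        (hp.2.1.trans h.2.1.symm)
      have h2 := hY n _ _ _ _ (hmem p.1) (hmem p.2) (hmem p₀.1) (hmem p₀.2)
        (hp.2.2.trans h.2.2.symm)
      simp only [Finset.mem_biUnion, Finset.mem_product, Finset.mem_insert, Finset.mem_singleton,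
        Finset.mem_filter, Finset.mem_univ, true_and]
      exact ⟨((ψ p).1 - (ψ p).2, (ψ p).1 + (ψ p).2), ⟨h1, h2⟩, rfl, rfl⟩
    refine (Finset.card_le_card hsub).trans (Finset.card_biUnion_le.trans ?_)
    refine (Finset.sum_le_card_nsmul _ _ 4 fun c _ => card_sub_add_eq_le c.1 c.2).trans ?_
    rw [Finset.card_product, smul_eq_mul]
    have h1 := Finset.card_le_two (a := a) (b := -a)
    have h2 := Finset.card_le_two (a := b) (b := -b)
    nlinarith

/-- Group the entries by their pair of link values: each pair occurs at most 16 times, so the double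
sum is dominated by a product of single sums. -/
theorem sum_entries_le {LX LY : Link} (hX : IsDiffLink LX) (hY : IsSumLink LY)
    (hbX : ∀ i j : Fin n, LX.val n (i + 1) (j + 1) ≤ 2 * n)
    (hbY : ∀ i j : Fin n, LY.val n (i + 1) (j + 1) ≤ 2 * n) {u v : ℕ → ℝ} (hu : ∀ i, 0 ≤ u i)
    (hv : ∀ i, 0 ≤ v i) :
    ∑ i : Fin n, ∑ j : Fin n, u (LX.val n (i + 1) (j + 1)) * v (LY.val n (i + 1) (j + 1)) ≤
      16 * ((∑ d ∈ Finset.range (2 * n + 1), u d) * ∑ s ∈ Finset.range (2 * n + 1), v s) := by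
  classical
  let φ : Fin n × Fin n → ℕ × ℕ := fun p =>
    (LX.val n (p.1 + 1) (p.2 + 1), LY.val n (p.1 + 1) (p.2 + 1))
  have hmaps : ∀ p ∈ (Finset.univ : Finset (Fin n × Fin n)),
      φ p ∈ Finset.range (2 * n + 1) ×ˢ Finset.range (2 * n + 1) := fun p _ => by
    rw [Finset.mem_product, Finset.mem_range, Finset.mem_range]
    exact ⟨Nat.lt_succ_of_le (hbX _ _), Nat.lt_succ_of_le (hbY _ _)⟩
  rw [← Fintype.sum_prod_type' (f := fun i j : Fin n =>
    u (LX.val n (i + 1) (j + 1)) * v (LY.val n (i + 1) (j + 1))), Finset.sum_mul_sum,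
    ← Finset.sum_product', Finset.mul_sum, ← Finset.sum_fiberwise_of_maps_to hmaps]
  refine Finset.sum_le_sum fun c _ => ?_
  have h1 : ∀ p ∈ Finset.univ.filter fun p => φ p = c,
      u (LX.val n (p.1 + 1) (p.2 + 1)) * v (LY.val n (p.1 + 1) (p.2 + 1)) = u c.1 * v c.2 := by
    intro p hp
    obtain ⟨-, rfl⟩ := Finset.mem_filter.1 hp
    rfl
  rw [Finset.sum_congr rfl h1, Finset.sum_const, nsmul_eq_mul]
  refine mul_le_mul_of_nonneg_right ?_ (mul_nonneg (hu _) (hv _))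
  have h2 := card_entries_le (n := n) hX hY c.1 c.2
  simp only [φ, Prod.ext_iff]
  exact_mod_cast h2

/-- The Frobenius distance between scaled products with different inputs. -/
theorem sum_scaledProduct_sub_sq_le {LX LY : Link} (hX : IsDiffLink LX) (hY : IsSumLink LY)
    (hbX : ∀ i j : Fin n, LX.val n (i + 1) (j + 1) ≤ 2 * n)
    (hbY : ∀ i j : Fin n, LY.val n (i + 1) (j + 1) ≤ 2 * n) (x x' y y' : ℕ → ℝ) :
    ∑ i, ∑ j, (scaledProduct LX LY n x y i j - scaledProduct LX LY n x' y' i j) ^ 2 ≤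
      (n : ℝ)⁻¹ * (32 * ((∑ i ∈ Finset.range (2 * n + 1), (x i - x' i) ^ 2) *
          (∑ i ∈ Finset.range (2 * n + 1), y i ^ 2) +
        (∑ i ∈ Finset.range (2 * n + 1), x' i ^ 2) *
          ∑ i ∈ Finset.range (2 * n + 1), (y i - y' i) ^ 2)) := by
  have h1 := sum_entries_le hX hY hbX hbY (u := fun i => (x i - x' i) ^ 2) (v := fun i => y i ^ 2)
    (fun i => sq_nonneg _) fun i => sq_nonneg _
  have h2 := sum_entries_le hX hY hbX hbY (u := fun i => x' i ^ 2) (v := fun i => (y i - y' i) ^ 2)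
    (fun i => sq_nonneg _) fun i => sq_nonneg _
  -- `ab - a'b' = (a - a') b + a' (b - b')`, and the square of a sum is at most twice the sum of the
  -- squares.
  have h3 : ∀ i j, (scaledProduct LX LY n x y i j - scaledProduct LX LY n x' y' i j) ^ 2 ≤
      (n : ℝ)⁻¹ * (2 * ((x (LX.val n (i + 1) (j + 1)) - x' (LX.val n (i + 1) (j + 1))) ^ 2 *
        y (LY.val n (i + 1) (j + 1)) ^ 2) + 2 * (x' (LX.val n (i + 1) (j + 1)) ^ 2 *
        (y (LY.val n (i + 1) (j + 1)) - y' (LY.val n (i + 1) (j + 1))) ^ 2)) := by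
    intro i j
    simp only [scaledProduct, Matrix.smul_apply, smul_eq_mul, Matrix.hadamard_apply, patterned,
      Matrix.of_apply]
    rw [← mul_sub, mul_pow, inv_pow, Real.sq_sqrt (Nat.cast_nonneg n)]
    refine mul_le_mul_of_nonneg_left ?_ (by positivity)
    generalize x (LX.val n (i + 1) (j + 1)) = a
    generalize x' (LX.val n (i + 1) (j + 1)) = a'
    generalize y (LY.val n (i + 1) (j + 1)) = b
    generalize y' (LY.val n (i + 1) (j + 1)) = b'
    nlinarith [sq_nonneg ((a - a') * b - a' * (b - b'))]
  refine (Finset.sum_le_sum fun i _ => Finset.sum_le_sum fun j _ => h3 i j).trans ?_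
  simp only [← Finset.mul_sum, Finset.sum_add_distrib]
  refine mul_le_mul_of_nonneg_left ?_ (by positivity)
  linarith

end EntrySums

/-! ### The limiting spectral distribution -/

/-- Bounded approximations within `ε` of both inputs give matrices whose squared Frobenius distance
to the given ones is `O(ε) * n`, while their moments converge almost surely to those of the
semicircle. -/
theorem isLSD_semicircleLaw {Ω : Type*} [MeasurableSpace Ω] {P : Measure Ω}
    [IsProbabilityMeasure P] {x y : ℕ → Ω → ℝ} (hx : HasBddApprox P x) (hy : HasBddApprox P y)
    (hxy : IndepFun (fun ω i => x i ω) (fun ω i => y i ω) P)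
    {LX LY : Link} (hX : IsDiffLink LX) (hY : IsSumLink LY)
    (hbX : ∀ n (i j : Fin n), LX.val n (i + 1) (j + 1) ≤ 2 * n)
    (hbY : ∀ n (i j : Fin n), LY.val n (i + 1) (j + 1) ≤ 2 * n) :
    IsLSD P (fun n ω => scaledProduct LX LY n (fun i => x i ω) (fun i => y i ω))
      (fun n ω => scaledProduct_isHermitian LX LY n (fun i => x i ω) (fun i => y i ω))
      semicircleLaw := by
  obtain ⟨KX, hKX0, hKX⟩ := hx.exists_sum_sq_le
  obtain ⟨KY, hKY0, hKY⟩ := hy.exists_sum_sq_le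
  have key : ∀ m : ℕ, ∀ᵐ ω ∂P, ∃ B : ∀ n : ℕ, Matrix (Fin n) (Fin n) ℝ,
      (∀ n, (B n).IsHermitian) ∧ (∀ h : ℕ, Tendsto (fun n : ℕ => (n : ℝ)⁻¹ * (B n ^ h).trace) atTop
        (𝓝 (semicircleMoment h))) ∧ ∀ᶠ n : ℕ in atTop, ∑ i, ∑ j,
          (scaledProduct LX LY n (fun i => x i ω) (fun i => y i ω) i j - B n i j) ^ 2 ≤
            (1 / ((m : ℝ) + 1)) ^ 2 * n := by
    intro m
    set δ : ℝ := 1 / ((m : ℝ) + 1) with hδ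
    have hδ0 : 0 < δ := by positivity
    -- `288 = 32 * 9`: the constant of the Frobenius bound, and the square from `2 * n + 1 ≤ 3 * n`.
    -- The factor `2 * KX + 2` bounds the mean square of the truncated `x`.
    set D : ℝ := 288 * (KY + 2 * KX + 2) with hD
    have hD0 : 0 < D := by positivity
    set ε : ℝ := min 1 (δ ^ 2 / D) with hε
    have hε0 : 0 < ε := lt_min one_pos (by positivity)
    have hε1 : ε ≤ 1 := min_le_left _ _
    have hεD : ε * D ≤ δ ^ 2 := (le_div_iff₀ hD0).1 (min_le_right _ _)
    obtain ⟨CX, gX, hgX, hbx, hax⟩ := hx ε hε0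
    obtain ⟨CY, gY, hgY, hby, hay⟩ := hy ε hε0
    have hbx' : IsBddStandardized P (fun i ω => gX i (x i ω)) (max CX CY) :=
      { hbx with
        nonneg := hbx.nonneg.trans (le_max_left _ _)
        abs_le := fun i ω => (hbx.abs_le i ω).trans (le_max_left _ _) }
    have hby' : IsBddStandardized P (fun i ω => gY i (y i ω)) (max CX CY) :=
      { hby with
        nonneg := hby.nonneg.trans (le_max_right _ _)
        abs_le := fun i ω => (hby.abs_le i ω).trans (le_max_right _ _) }
    have hind : IndepFun (fun ω i => gX i (x i ω)) (fun ω i => gY i (y i ω)) P :=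
      hxy.comp (φ := fun (u : ℕ → ℝ) i => gX i (u i)) (ψ := fun (u : ℕ → ℝ) i => gY i (u i))
        (measurable_pi_lambda _ fun i => (hgX i).comp (measurable_pi_apply (X := fun _ => ℝ) i))
        (measurable_pi_lambda _ fun i => (hgY i).comp (measurable_pi_apply (X := fun _ => ℝ) i))
    have hmom := ae_all_iff.2 fun h => ae_tendsto_moment hbx' hby' hind
      (compatible_of_diff_sum hX hY) (leadsToWigner_of_diff_sum hX hY) h
    filter_upwards [hmom, hax, hay, hKX, hKY] with ω h1 h2 h3 h4 h5
    refine ⟨_, fun n => scaledProduct_isHermitian LX LY n _ _, h1, ?_⟩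
    have htop : Tendsto (fun n : ℕ => 2 * n + 1) atTop atTop :=
      tendsto_atTop_mono (fun n => show n ≤ 2 * n + 1 by omega) tendsto_id
    filter_upwards [htop.eventually h2, htop.eventually h3, htop.eventually h4, htop.eventually h5,
      eventually_gt_atTop 0] with n e2 e3 e4 e5 hn
    refine (sum_scaledProduct_sub_sq_le hX hY (hbX n) (hbY n) _ _ _ _).trans ?_
    have hn1 : (1 : ℝ) ≤ n := by exact_mod_cast hn
    have hN : ((2 * n + 1 : ℕ) : ℝ) ≤ 3 * n := by push_cast; linarith
    set N : ℕ := 2 * n + 1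
    have e6 : ∑ i ∈ Finset.range N, gX i (x i ω) ^ 2 ≤ (2 * KX + 2) * N := by
      calc ∑ i ∈ Finset.range N, gX i (x i ω) ^ 2
          ≤ ∑ i ∈ Finset.range N, (2 * x i ω ^ 2 + 2 * (x i ω - gX i (x i ω)) ^ 2) := by
            refine Finset.sum_le_sum fun i _ => ?_
            nlinarith [sq_nonneg (2 * x i ω - gX i (x i ω))]
        _ = 2 * ∑ i ∈ Finset.range N, x i ω ^ 2 +
            2 * ∑ i ∈ Finset.range N, (x i ω - gX i (x i ω)) ^ 2 := by
            rw [Finset.sum_add_distrib, Finset.mul_sum, Finset.mul_sum]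
        _ ≤ 2 * (KX * N) + 2 * (1 * N) := by
            have : ε * (N : ℝ) ≤ 1 * N := mul_le_mul_of_nonneg_right hε1 (Nat.cast_nonneg N)
            linarith
        _ = _ := by ring
    have s1 : ∀ z : ℕ → ℝ, 0 ≤ ∑ i ∈ Finset.range N, z i ^ 2 := fun z =>
      Finset.sum_nonneg fun i _ => sq_nonneg _
    have t1 : (∑ i ∈ Finset.range N, (x i ω - gX i (x i ω)) ^ 2) *
        (∑ i ∈ Finset.range N, y i ω ^ 2) ≤ (ε * N) * (KY * N) :=
      mul_le_mul e2 e5 (s1 _) (by positivity)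
    have t2 : (∑ i ∈ Finset.range N, gX i (x i ω) ^ 2) *
        (∑ i ∈ Finset.range N, (y i ω - gY i (y i ω)) ^ 2) ≤ ((2 * KX + 2) * N) * (ε * N) :=
      mul_le_mul e6 e3 (s1 _) (by positivity)
    have t3 : (N : ℝ) ^ 2 ≤ (3 * n) ^ 2 := pow_le_pow_left₀ (Nat.cast_nonneg N) hN 2
    calc _ ≤ (n : ℝ)⁻¹ * (32 * ((ε * N) * (KY * N) + ((2 * KX + 2) * N) * (ε * N))) :=
          mul_le_mul_of_nonneg_left (mul_le_mul_of_nonneg_left (add_le_add t1 t2) (by norm_num))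
            (by positivity)
      _ = (n : ℝ)⁻¹ * (32 * ε * (KY + 2 * KX + 2)) * (N : ℝ) ^ 2 := by ring
      _ ≤ (n : ℝ)⁻¹ * (32 * ε * (KY + 2 * KX + 2)) * (3 * n) ^ 2 :=
          mul_le_mul_of_nonneg_left t3 (by positivity)
      _ = ε * D * n := by
          rw [hD]
          field_simp
          ring
      _ ≤ δ ^ 2 * n := mul_le_mul_of_nonneg_right hεD (Nat.cast_nonneg n)
  -- Only the precisions `1 / (m + 1)` are used, so that one null set serves for all of them.
  filter_upwards [ae_all_iff.2 key] with ω hω t _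
  refine tendsto_esd_of_approx _ (fun δ hδ => ?_) t
  obtain ⟨m, hm⟩ := exists_nat_one_div_lt hδ
  obtain ⟨B, hB1, hB2, hB3⟩ := hω m
  refine ⟨B, hB1, hB2, hB3.mono fun n hn => hn.trans ?_⟩
  exact mul_le_mul_of_nonneg_right (pow_le_pow_left₀ (by positivity) hm.le 2) (Nat.cast_nonneg n)

end SchurHadamard

theorem mainTheorem3 (LX LY : SchurHadamard.Link)
    (hX : LX = SchurHadamard.toeplitz ∨ LX = SchurHadamard.symCirculant)
    (hY : LY = SchurHadamard.hankel ∨ LY = SchurHadamard.revCirculant ∨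
      LY = SchurHadamard.doublySymHankel) :
    SchurHadamard.Compatible LX LY ∧
    SchurHadamard.LeadsToWigner LX LY ∧
    ∀ {Ω : Type*} [MeasurableSpace Ω] (P : MeasureTheory.Measure Ω)
      [MeasureTheory.IsProbabilityMeasure P] (x y : ℕ → Ω → ℝ),
      (SchurHadamard.AssumptionA1 P x ∨ SchurHadamard.AssumptionA2 P x ∨
        SchurHadamard.AssumptionA3 P x) →
      (SchurHadamard.AssumptionA1 P y ∨ SchurHadamard.AssumptionA2 P y ∨
        SchurHadamard.AssumptionA3 P y) →
      ProbabilityTheory.IndepFun (fun ω i => x i ω) (fun ω i => y i ω) P →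
      SchurHadamard.IsLSD P
        (fun n ω => SchurHadamard.scaledProduct LX LY n (fun i => x i ω) (fun i => y i ω))
        (fun n ω => SchurHadamard.scaledProduct_isHermitian LX LY n
          (fun i => x i ω) (fun i => y i ω))
        SchurHadamard.semicircleLaw := by
  have hX' : SchurHadamard.IsDiffLink LX := by
    rcases hX with rfl | rfl
    · exact SchurHadamard.isDiffLink_toeplitz
    · exact SchurHadamard.isDiffLink_symCirculant
  have hY' : SchurHadamard.IsSumLink LY := by
    rcases hY with rfl | rfl | rfl
    · exact SchurHadamard.isSumLink_hankel
    · exact SchurHadamard.isSumLink_revCirculant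
    · exact SchurHadamard.isSumLink_doublySymHankel
  -- Thus the matrices of size `n` involve only the first `2 * n + 1` inputs, to which the laws of
  -- large numbers are applied.
  have hbX : ∀ n (i j : Fin n), LX.val n (i + 1) (j + 1) ≤ 2 * n := by
    intro n i j
    rcases hX with rfl | rfl
    · simp only [SchurHadamard.toeplitz]; omega
    · simp only [SchurHadamard.symCirculant]; omega
  have hbY : ∀ n (i j : Fin n), LY.val n (i + 1) (j + 1) ≤ 2 * n := by
    intro n i j
    rcases hY with rfl | rfl | rfl
    · simp only [SchurHadamard.hankel]; omega
    · have := Nat.mod_lt ((i : ℕ) + 1 + (j + 1)) (Fin.pos i)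
      simp only [SchurHadamard.revCirculant]; omega
    · simp only [SchurHadamard.doublySymHankel]; omega
  exact ⟨SchurHadamard.compatible_of_diff_sum hX' hY',
    SchurHadamard.leadsToWigner_of_diff_sum hX' hY', fun P _ x y hx hy hxy =>
      SchurHadamard.isLSD_semicircleLaw (SchurHadamard.hasBddApprox_of_assumptions hx)
        (SchurHadamard.hasBddApprox_of_assumptions hy) hxy hX' hY' hbX hbY⟩
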